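/- Let $K_\nu$ be the completion of a number field at a place $\nu$, that is, $\mathbb R$, $\mathbb C$, or a finite extension of $\mathbb Q_p$ for some prime $p$, with normalized absolute value $|\cdot|$ (so $|z|=z\overline z$ on $\mathbb C$). Let $\lambda(x)=\exp(\pm 2\pi i\,\mathrm{Tr}(x))$, with sign $+$ at finite places and $-$ at archimedean places, and let $dy$ be the Haar measure that is self-dual for $\lambda$. Let $\mathcal F$ be the Fourier transform on $L^2(K_\nu,dy)$, i.e. the unitary operator given by $(\mathcal Ff)(x)=\int f(y)\lambda(-xy)\,dy$ for $f\in L^1\cap L^2$. Let $A$ be multiplication by $\log|y|$ on its maximal domain, $B=\mathcal F^{-1}A\mathcal F$, $H=A+B$, $K=i[B,A]$, $K_1=[A,H]$ and $K_{N+1}=[A,K_N]$ for $N\ge1$, all on their natural domains. For a unitary character $\chi:K_\nu^\times\to U(1)$ and real $\tau$, let $\widehat f(\chi,\tau)=\int f(y)\chi(y)|y|^{-1/2+i\tau}\,dy$ be the Mellin dual of $f$ on the component $\{\chi|\cdot|^{i\tau}\}$ of the group of unitary characters. Theorem: Let $D$ be the set of $f\in L^2(K_\nu,dy)$ with $\int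 |f(y)|\,|y|^{-1/2}\,dy<\infty$ whose Mellin dual vanishes outside finitely many components and is, on each component, of Schwartz class in $\tau$ (if $\nu$ is archimedean), respectively smooth in $\tau$ (if $\nu$ is finite, where the components are circles). Then $D$ is a dense linear subspace of $L^2(K_\nu,dy)$; it is contained in the domains of $A$, $B$, $H$, $K$ and all $K_N$ ($N\ge1$), and is stable under $\mathcal F$, $A$, $B$, $H$, $K$ and all $K_N$. Moreover every iterated commutator with $n\ge2$ entries, each equal to $A$ or $B$ and bracketed in any way, is defined on $D$, maps $D$ to itself, and is equal on $D$ to $0$, $K_{n-1}$ or $-K_{n-1}$. -/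

import Mathlib

open MeasureTheory
open scoped ContDiff ENNReal

namespace LocalCommutator

noncomputable section

/-! ### Unbounded operators: stability, products, commutators -/

section Operators

variable {E : Type*} [AddCommGroup E] [Module ℂ E]

/-- The subspace `D` is contained in the domain of `T`, and `T` maps it into itself. -/
def StableUnder (D : Submodule ℂ E) (T : E →ₗ.[ℂ] E) : Prop :=
  ∀ f ∈ D, ∃ h : f ∈ T.domain, T ⟨f, h⟩ ∈ D

/-- The product `S T` of two partially defined operators, on its natural domain
`{f ∈ dom T | T f ∈ dom S}`. -/
def opMul (S T : E →ₗ.[ℂ] E) : E →ₗ.[ℂ] E where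
  domain := (S.domain.comap T.toFun).map T.domain.subtype
  toFun :=
    { toFun := fun f => S ⟨T ⟨f.1, by
          obtain ⟨g, -, hg⟩ := f.2; exact hg ▸ g.2⟩, by
          obtain ⟨f, g, hg, rfl⟩ := f; exact hg⟩
      map_add' := fun f g => by
        rw [← LinearPMap.map_add]
        congr 1
        apply Subtype.ext
        exact LinearPMap.map_add T ⟨f.1, _⟩ ⟨g.1, _⟩
      map_smul' := fun c f => by
        rw [RingHom.id_apply, ← LinearPMap.map_smul]
        congr 1
        apply Subtype.ext
        exact LinearPMap.map_smul T c ⟨f.1, _⟩ }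

/-- The commutator `[S, T] = S T - T S` on its natural domain. -/
def opComm (S T : E →ₗ.[ℂ] E) : E →ₗ.[ℂ] E := opMul S T - opMul T S

theorem mem_opMul_domain {S T : E →ₗ.[ℂ] E} {f : E} :
    f ∈ (opMul S T).domain ↔ ∃ h : f ∈ T.domain, T ⟨f, h⟩ ∈ S.domain := by
  constructor
  · rintro ⟨g, hg, rfl⟩
    exact ⟨g.2, hg⟩
  · rintro ⟨h, h'⟩
    exact ⟨⟨f, h⟩, h', rfl⟩

theorem opMul_apply {S T : E →ₗ.[ℂ] E} {f : E} (h : f ∈ (opMul S T).domain)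
    (hT : f ∈ T.domain) (hS : T ⟨f, hT⟩ ∈ S.domain) :
    opMul S T ⟨f, h⟩ = S ⟨T ⟨f, hT⟩, hS⟩ := rfl

/-- Formal iterated commutators in two letters `a`, `b`. -/
inductive CommWord : Type
  | a : CommWord
  | b : CommWord
  | bracket : CommWord → CommWord → CommWord

/-- The number of letters of a formal iterated commutator. -/
def CommWord.weight : CommWord → ℕ
  | .a => 1
  | .b => 1
  | .bracket v w => v.weight + w.weight

/-- The value of a formal iterated commutator at two operators. -/
def CommWord.eval (A B : E →ₗ.[ℂ] E) : CommWord → (E →ₗ.[ℂ] E)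
  | .a => A
  | .b => B
  | .bracket v w => opComm (v.eval A B) (w.eval A B)

/-- `higherComm A H N` is `K_N`: here `K_0 = H`, so `K_1 = [A, H]`, and `K_{N+1} = [A, K_N]`. -/
def higherComm (A H : E →ₗ.[ℂ] E) : ℕ → (E →ₗ.[ℂ] E)
  | 0 => H
  | N + 1 => opComm A (higherComm A H N)

end Operators

/-! ### Absolute value, additive characters -/

section Local

variable (k : Type*) [NormedField k] {K : Type*} [NormedField K] [NormedAlgebra k K]

/-- The normalized absolute value of a finite extension `K` of `k = ℝ` or `k = ℚ_p`, through the
norm map: `|y|` for `K = ℝ`, `y * conj y` for `K = ℂ`, and `q ^ (-v(y))` for a finite extension of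
`ℚ_p` with normalized valuation `v` and residue field of cardinality `q`. -/
def absv (y : K) : ℝ := ‖Algebra.norm k y‖

/-- The basic additive character `x ↦ exp(-2πi x)` of `ℝ`. -/
def realChar (x : ℝ) : ℂ := Complex.exp (-(2 * Real.pi * Complex.I * x))

/-- Every `p`-adic number differs from some `m / p ^ n` by a `p`-adic integer. -/
theorem exists_padicFrac (p : ℕ) [Fact p.Prime] (x : ℚ_[p]) :
    ∃ c : ℤ × ℕ, ‖x - (c.1 : ℚ_[p]) / (p : ℚ_[p]) ^ c.2‖ ≤ 1 := by
  have hp : (1 : ℝ) < p := by exact_mod_cast (Fact.out : p.Prime).one_lt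
  have hp0 : (p : ℚ_[p]) ≠ 0 := by exact_mod_cast (Fact.out : p.Prime).ne_zero
  obtain ⟨n, hn⟩ := pow_unbounded_of_one_lt ‖x‖ hp
  have hpn : (0 : ℝ) < (p : ℝ) ^ n := by positivity
  have hz : ‖(p : ℚ_[p]) ^ n * x‖ ≤ 1 := by
    rw [norm_mul, norm_pow, Padic.norm_p, inv_pow, inv_mul_le_iff₀ hpn, mul_one]
    exact hn.le
  have h := PadicInt.appr_spec n ⟨(p : ℚ_[p]) ^ n * x, hz⟩
  rw [← PadicInt.norm_le_pow_iff_mem_span_pow] at h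
  set a := PadicInt.appr ⟨(p : ℚ_[p]) ^ n * x, hz⟩ n
  refine ⟨((a : ℤ), n), ?_⟩
  have h2 : ‖(p : ℚ_[p]) ^ n * x - (a : ℚ_[p])‖ ≤ ((p : ℝ) ^ n)⁻¹ := by
    have : ‖(p : ℚ_[p]) ^ n * x - (a : ℚ_[p])‖ ≤ (p : ℝ) ^ (-(n : ℤ)) := by
      rw [PadicInt.norm_def] at h
      exact h
    rwa [zpow_neg, zpow_natCast] at this
  have h3 : x - (((a : ℤ) : ℚ_[p])) / (p : ℚ_[p]) ^ n
      = ((p : ℚ_[p]) ^ n)⁻¹ * ((p : ℚ_[p]) ^ n * x - (a : ℚ_[p])) := by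
    push_cast
    field_simp
  change ‖x - (((a : ℤ) : ℚ_[p])) / (p : ℚ_[p]) ^ n‖ ≤ 1
  rw [h3, norm_mul, norm_inv, norm_pow, Padic.norm_p, inv_pow, inv_inv]
  calc (p : ℝ) ^ n * _ ≤ (p : ℝ) ^ n * ((p : ℝ) ^ n)⁻¹ := by gcongr
    _ = 1 := mul_inv_cancel₀ hpn.ne'

/-- A polar part of the `p`-adic number `x`: a rational number `r = m / p ^ n` with `x - r ∈ ℤ_p`.
It is unique modulo `ℤ`. -/
def padicFrac (p : ℕ) [Fact p.Prime] (x : ℚ_[p]) : ℚ :=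
  ((exists_padicFrac p x).choose.1 : ℚ) / (p : ℚ) ^ (exists_padicFrac p x).choose.2

/-- The basic additive character `x ↦ exp(2πi x)` of `ℚ_p`, through `ℚ_p → ℚ_p / ℤ_p → ℚ / ℤ`. -/
def padicChar (p : ℕ) [Fact p.Prime] (x : ℚ_[p]) : ℂ :=
  Complex.exp (2 * Real.pi * Complex.I * (padicFrac p x : ℂ))

variable {k}

/-- The additive character `λ = ψ ∘ Tr` of `K`, for a character `ψ` of the base field `k`. -/
def addCharTr (ψ : k → ℂ) (x : K) : ℂ := ψ (Algebra.trace k K x)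

variable (k) [MeasurableSpace K] (μ : Measure K)

/-! ### The operators -/

/-- `F` is the Fourier transform on `L²(K)`: on `L¹ ∩ L²` it is
`(F f)(x) = ∫ f(y) λ(-xy) dy`. (As `L¹ ∩ L²` is dense, there is at most one such `F`.) -/
def IsFourierTransform {k : Type*} [NormedField k] {K : Type*} [NormedField K] [NormedAlgebra k K]
    [MeasurableSpace K] {μ : Measure K} (ψ : k → ℂ)
    (F : Lp ℂ 2 μ ≃ₗᵢ[ℂ] Lp ℂ 2 μ) : Prop :=
  ∀ f : Lp ℂ 2 μ, Integrable f μ →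
    F f =ᵐ[μ] fun x => ∫ y, f y * addCharTr ψ (-(x * y)) ∂μ

/-- The operator `A` of multiplication by `log |y|` in `L²(K)`, on its maximal domain. -/
def opA : Lp ℂ 2 μ →ₗ.[ℂ] Lp ℂ 2 μ where
  domain :=
    { carrier := {f | MemLp (fun y => (Real.log (absv k y) : ℂ) * f y) 2 μ}
      zero_mem' := by
        refine (MemLp.zero' : MemLp (fun _ : K => (0 : ℂ)) 2 μ).ae_eq ?_
        filter_upwards [Lp.coeFn_zero ℂ 2 μ] with y hy
        rw [hy, Pi.zero_apply, mul_zero]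
      add_mem' := fun {f g} hf hg => by
        refine (MemLp.add hf hg).ae_eq ?_
        filter_upwards [Lp.coeFn_add f g] with y hy
        simp only [hy, Pi.add_apply, mul_add]
      smul_mem' := fun c f hf => by
        refine (MemLp.const_smul hf c).ae_eq ?_
        filter_upwards [Lp.coeFn_smul c f] with y hy
        simp only [hy, Pi.smul_apply, smul_eq_mul, mul_left_comm] }
  toFun :=
    { toFun := fun f => MemLp.toLp (fun y => (Real.log (absv k y) : ℂ) * f.1 y) f.2
      map_add' := fun f g => by
        rw [← MemLp.toLp_add]
        refine MemLp.toLp_congr _ _ ?_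
        filter_upwards [Lp.coeFn_add f.1 g.1] with y hy
        simp only [Submodule.coe_add, hy, Pi.add_apply, mul_add]
      map_smul' := fun c f => by
        rw [RingHom.id_apply, ← MemLp.toLp_const_smul]
        refine MemLp.toLp_congr _ _ ?_
        filter_upwards [Lp.coeFn_smul c f.1] with y hy
        simp only [Submodule.coe_smul, hy, Pi.smul_apply, smul_eq_mul, mul_left_comm] }

variable {μ}

/-- The operator `B = F⁻¹ A F`: in the Fourier representation it is multiplication by `log |x|`. -/
def opB (F : Lp ℂ 2 μ ≃ₗᵢ[ℂ] Lp ℂ 2 μ) : Lp ℂ 2 μ →ₗ.[ℂ] Lp ℂ 2 μ where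
  domain := (opA k μ).domain.comap F.toLinearEquiv.toLinearMap
  toFun :=
    { toFun := fun f => F.symm (opA k μ ⟨F f.1, f.2⟩)
      map_add' := fun f g => by
        rw [← map_add, ← LinearPMap.map_add]
        congr 2
        exact Subtype.ext (map_add F f.1 g.1)
      map_smul' := fun c f => by
        rw [RingHom.id_apply, ← map_smul, ← LinearPMap.map_smul]
        congr 2
        exact Subtype.ext (map_smul F c f.1) }

/-- The conductor operator `H = A + B = log |y| + log |x|`. -/
def opH (F : Lp ℂ 2 μ ≃ₗᵢ[ℂ] Lp ℂ 2 μ) : Lp ℂ 2 μ →ₗ.[ℂ] Lp ℂ 2 μ := opA k μ + opB k F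

/-- The commutator operator `K = i [B, A]`. -/
def opK (F : Lp ℂ 2 μ ≃ₗᵢ[ℂ] Lp ℂ 2 μ) : Lp ℂ 2 μ →ₗ.[ℂ] Lp ℂ 2 μ :=
  Complex.I • opComm (opB k F) (opA k μ)

/-- The higher commutator operators: `K_1 = [A, H]`, `K_{N+1} = [A, K_N]` (and `K_0 = H`). -/
def opKN (F : Lp ℂ 2 μ ≃ₗᵢ[ℂ] Lp ℂ 2 μ) (N : ℕ) : Lp ℂ 2 μ →ₗ.[ℂ] Lp ℂ 2 μ :=
  higherComm (opA k μ) (opH k F) N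

/-! ### The Mellin dual and the domain -/

/-- The Mellin dual of `f` on the component of the unitary character `χ`: the function
`τ ↦ ∫ f(y) χ(y) |y| ^ (-1/2 + iτ) dy`. Up to a positive constant `dy / |y|` is `d*y`, and
`f(y) |y| ^ (1/2)` is the function on the multiplicative group that corresponds to `f`. -/
def mellin (f : Lp ℂ 2 μ) (χ : Kˣ →ₜ* Circle) (τ : ℝ) : ℂ :=
  open scoped Classical in
  ∫ y, f y * (if h : y = 0 then 0 else (χ (Units.mk0 y h) : ℂ)) *
    ((absv k y : ℝ) : ℂ) ^ (-(1 / 2 : ℂ) + τ * Complex.I) ∂μ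

/-- Two unitary characters lie in the same component `{χ |·| ^ (it) : t ∈ ℝ}` of the dual. -/
def SameComponent (χ χ' : Kˣ →ₜ* Circle) : Prop :=
  ∃ t : ℝ, ∀ u : Kˣ, (χ' u : ℂ) = χ u * ((absv k (u : K) : ℝ) : ℂ) ^ (t * Complex.I)

/-- `f` has a Mellin dual (given by absolutely convergent integrals) which vanishes outside
finitely many components of the group of unitary characters and is of class `Sch` on each. -/
def HasSchwartzMellinDual (Sch : (ℝ → ℂ) → Prop) (f : Lp ℂ 2 μ) : Prop :=
  Integrable (fun y => f y * ((absv k y ^ (-(1 / 2) : ℝ) : ℝ) : ℂ)) μ ∧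
  (∀ χ : Kˣ →ₜ* Circle, Sch (mellin k f χ)) ∧
  ∃ S : Finset (Kˣ →ₜ* Circle), ∀ χ : Kˣ →ₜ* Circle,
    (∀ χ₀ ∈ S, ¬ SameComponent k χ₀ χ) → ∀ τ : ℝ, mellin k f χ τ = 0

/-- At an archimedean place the components are lines: the Schwartz class is the usual one. -/
def SchwartzOnLine (φ : ℝ → ℂ) : Prop := ∃ g : SchwartzMap ℝ ℂ, ∀ τ, φ τ = g τ

/-- At a finite place the components are circles (`τ` modulo a period): the Schwartz class is the
class of smooth functions. -/
def SchwartzOnCircle (φ : ℝ → ℂ) : Prop := ContDiff ℝ ∞ φ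

variable {k}

/-- The conclusion, for the field `K` over the base `k` with the character `λ = ψ ∘ Tr` and the
measure `μ`: the Fourier transform exists as a unitary operator of `L²(K, μ)`, and the functions
with Schwartz Mellin dual form a dense subspace `D`, stable under `F`, `A`, `B`, `H`, `K` and all
`K_N`, on which each iterated commutator of `A` and `B` with `n ≥ 2` letters is `0` or
`± K_{n-1}`. -/
def HasStableDomain {k : Type*} [NormedField k] {K : Type*} [NormedField K] [NormedAlgebra k K]
    [MeasurableSpace K] (ψ : k → ℂ) (Sch : (ℝ → ℂ) → Prop) (μ : Measure K) : Prop :=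
  ∃ F : Lp ℂ 2 μ ≃ₗᵢ[ℂ] Lp ℂ 2 μ, IsFourierTransform ψ F ∧
  ∃ D : Submodule ℂ (Lp ℂ 2 μ),
    (∀ f, f ∈ D ↔ HasSchwartzMellinDual k Sch f) ∧
    Dense (D : Set (Lp ℂ 2 μ)) ∧
    (∀ f ∈ D, F f ∈ D) ∧
    StableUnder D (opA k μ) ∧
    StableUnder D (opB k F) ∧
    StableUnder D (opH k F) ∧
    StableUnder D (opK k F) ∧
    (∀ N : ℕ, 1 ≤ N → StableUnder D (opKN k F N)) ∧
    ∀ w : CommWord, 2 ≤ w.weight →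
      StableUnder D (w.eval (opA k μ) (opB k F)) ∧
      ∃ ε : ℂ, (ε = 0 ∨ ε = 1 ∨ ε = -1) ∧
        ∀ f ∈ D, ∃ (h : f ∈ (w.eval (opA k μ) (opB k F)).domain)
          (h' : f ∈ (opKN k F (w.weight - 1)).domain),
          w.eval (opA k μ) (opB k F) ⟨f, h⟩ = ε • opKN k F (w.weight - 1) ⟨f, h'⟩

/-- The normalization of the self-dual Haar measure at a finite place: `μ(O) μ(O^⊥) = 1`, where
`O` is the ring of integers and `O^⊥ = {x | λ(xy) = 1 for all y ∈ O}` the inverse different. (The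
transform of `1_O` is `μ(O) 1_{O^⊥}`, and that of `1_{O^⊥}` is `μ(O^⊥) 1_O`.) -/
def IsSelfDualNormalized {k : Type*} [NormedField k] {K : Type*} [NormedField K] [NormedAlgebra k K]
    [MeasurableSpace K] (ψ : k → ℂ) (μ : Measure K) : Prop :=
  μ {x : K | ‖x‖ ≤ 1} * μ {x : K | ∀ y : K, ‖y‖ ≤ 1 → addCharTr ψ (x * y) = 1} = 1

end Local

end

end LocalCommutator

namespace LocalCommutator

noncomputable section

/-! ### Restrictions of partially defined operators to a stable subspace -/

section Restriction

variable {E : Type*} [AddCommGroup E] [Module ℂ E] {D : Submodule ℂ E}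

/-! The Mellin transform turns multiplicative convolution into pointwise multiplication, so D is an
algebra under convolution. There A becomes -i d/dτ and is therefore a derivation: A(f*g) = Af*g +
f*Ag. The Fourier transform exchanges the unitary dilations by u and by u⁻¹, hence F(f*g) = Ff * g',
where g' has Mellin dual ĝ(χ⁻¹, -τ). Moving A through this identity gives B(f*g) = Bf*g - f*Ag, the
sign coming from the reflection of τ. Adding the two rules, H(f*g) = Hf*g, so H is a multiplier of
the algebra. The commutator of the derivation A with a multiplier is again a multiplier, so all K_N
are multipliers. Two multipliers commute, because STf*g and TSf*g both equal Sf*Tg and no point of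
the dual is a common zero of D. This is `commute_ringHigherComm`. Now [H, K_N] = 0, so [A, K_N] =
K_{N+1} and [B, K_N] = -K_{N+1}, and induction over brackets finishes the algebra
(`CommWord.ringEval_eq`).

The analytic point is that F preserves D. The space D is spanned by the profiles χ(y)⁻¹|y|^(-1/2)
φ(log|y|) with φ rapidly decreasing (`IsProfileClass.domain_eq_span`), and A only replaces φ(s) by
sφ(s). For F, no gamma factor is computed. Instead φ is written as a sum of two convolutions κ*φ₁
with kernels κ whose profiles have transforms that are bounded and O(1/|x|). Such a transform is
again a profile, for χ⁻¹, with a kernel κ' of size exp(-|s|/2) (`IsAdmissible.exists_kernel`). The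
transform of κ*φ₁ is then the profile of the correlation of κ' with φ₁, which is rapidly decreasing
(`IsProfileClass.fourier_mem`). At archimedean places κ comes from a parametrix of the fourth
derivative (`exists_parametrix`). At finite places it is a multiple of the indicator of 0. Density
and the spanning property rest on the fact that unitary characters separate finite measures on the
multiplicative group (`ext_of_forall_integral_char`).

`IsPlace` and `IsProfileClass` collect what this argument needs from the field, and the later
sections verify them. The real and complex Fourier transforms are deduced from the Euclidean one. At
finite places the Plancherel theorem is proved from locally constant functions of compact support.
-/

/-- The partially defined operator `T` is defined on `D`, where it is the endomorphism `T'`. -/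
def RestrictsTo (T : E →ₗ.[ℂ] E) (T' : Module.End ℂ D) : Prop :=
  ∀ f : D, ∃ h : (f : E) ∈ T.domain, T ⟨f, h⟩ = T' f

theorem RestrictsTo.stableUnder {T : E →ₗ.[ℂ] E} {T' : Module.End ℂ D} (h : RestrictsTo T T') :
    StableUnder D T := fun f hf => by
  obtain ⟨h1, h2⟩ := h ⟨f, hf⟩
  exact ⟨h1, h2 ▸ (T' ⟨f, hf⟩).2⟩

theorem RestrictsTo.opMul {S T : E →ₗ.[ℂ] E} {S' T' : Module.End ℂ D} (hS : RestrictsTo S S')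
    (hT : RestrictsTo T T') : RestrictsTo (opMul S T) (S' * T') := fun f => by
  obtain ⟨h1, h2⟩ := hT f
  obtain ⟨h3, h4⟩ := hS (T' f)
  have h5 : T ⟨f, h1⟩ ∈ S.domain := h2 ▸ h3
  refine ⟨mem_opMul_domain.2 ⟨h1, h5⟩, ?_⟩
  rw [opMul_apply _ h1 h5, Module.End.mul_apply, ← h4]
  congr 2

theorem RestrictsTo.sub {S T : E →ₗ.[ℂ] E} {S' T' : Module.End ℂ D} (hS : RestrictsTo S S')
    (hT : RestrictsTo T T') : RestrictsTo (S - T) (S' - T') := fun f => by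
  obtain ⟨h1, h2⟩ := hT f
  obtain ⟨h3, h4⟩ := hS f
  refine ⟨⟨h3, h1⟩, ?_⟩
  rw [LinearPMap.sub_apply, LinearMap.sub_apply, Submodule.coe_sub, ← h2, ← h4]

theorem RestrictsTo.add {S T : E →ₗ.[ℂ] E} {S' T' : Module.End ℂ D} (hS : RestrictsTo S S')
    (hT : RestrictsTo T T') : RestrictsTo (S + T) (S' + T') := fun f => by
  obtain ⟨h1, h2⟩ := hT f
  obtain ⟨h3, h4⟩ := hS f
  refine ⟨⟨h3, h1⟩, ?_⟩
  rw [LinearPMap.add_apply, LinearMap.add_apply, Submodule.coe_add, ← h2, ← h4]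

theorem RestrictsTo.smul {T : E →ₗ.[ℂ] E} {T' : Module.End ℂ D} (c : ℂ)
    (hT : RestrictsTo T T') : RestrictsTo (c • T) (c • T') := fun f => by
  obtain ⟨h1, h2⟩ := hT f
  refine ⟨h1, ?_⟩
  rw [LinearPMap.smul_apply, LinearMap.smul_apply, Submodule.coe_smul, ← h2]

theorem RestrictsTo.opComm {S T : E →ₗ.[ℂ] E} {S' T' : Module.End ℂ D} (hS : RestrictsTo S S')
    (hT : RestrictsTo T T') : RestrictsTo (opComm S T) (S' * T' - T' * S') :=
  (hS.opMul hT).sub (hT.opMul hS)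

/-- The value of a formal iterated commutator at two elements of a ring. -/
def CommWord.ringEval {R : Type*} [Ring R] (A B : R) : CommWord → R
  | .a => A
  | .b => B
  | .bracket v w => v.ringEval A B * w.ringEval A B - w.ringEval A B * v.ringEval A B

/-- The iterated commutators `[A, [A, …, [A, H]]]` in a ring. -/
def ringHigherComm {R : Type*} [Ring R] (A H : R) : ℕ → R
  | 0 => H
  | N + 1 => A * ringHigherComm A H N - ringHigherComm A H N * A

theorem RestrictsTo.eval {S T : E →ₗ.[ℂ] E} {S' T' : Module.End ℂ D} (hS : RestrictsTo S S')
    (hT : RestrictsTo T T') (w : CommWord) : RestrictsTo (w.eval S T) (w.ringEval S' T') := by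
  induction w with
  | a => exact hS
  | b => exact hT
  | bracket v w hv hw => exact hv.opComm hw

theorem RestrictsTo.higherComm {S T : E →ₗ.[ℂ] E} {S' T' : Module.End ℂ D}
    (hS : RestrictsTo S S') (hT : RestrictsTo T T') (N : ℕ) :
    RestrictsTo (higherComm S T N) (ringHigherComm S' T' N) := by
  induction N with
  | zero => exact hT
  | succ N h => exact hS.opComm h

theorem CommWord.one_le_weight (w : CommWord) : 1 ≤ w.weight := by
  induction w with
  | a => exact le_rfl
  | b => exact le_rfl
  | bracket v w hv hw => exact hv.trans (Nat.le_add_right _ _)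

/-- If the `K_N` commute with each other, then each iterated commutator of `A` and `B` of weight
`n ≥ 2` is `0` or `± K_{n-1}`. -/
theorem CommWord.ringEval_eq {R : Type*} [Ring R] [Algebra ℂ R] {A B : R}
    (hcomm : ∀ M N, Commute (ringHigherComm A (A + B) M) (ringHigherComm A (A + B) N))
    (w : CommWord) : w = .a ∨ w = .b ∨ (2 ≤ w.weight ∧ ∃ ε : ℂ, (ε = 0 ∨ ε = 1 ∨ ε = -1) ∧
      w.ringEval A B = ε • ringHigherComm A (A + B) (w.weight - 1)) := by
  have hA : ∀ N, A * ringHigherComm A (A + B) N - ringHigherComm A (A + B) N * A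
      = ringHigherComm A (A + B) (N + 1) := fun N => rfl
  -- Since B = H - A and H = K_0 commutes with K_N, bracketing with B is minus bracketing with A.
  have hB : ∀ N, B * ringHigherComm A (A + B) N - ringHigherComm A (A + B) N * B
      = - ringHigherComm A (A + B) (N + 1) := fun N => by
    rw [← hA]
    have h : (A + B) * ringHigherComm A (A + B) N = ringHigherComm A (A + B) N * (A + B) :=
      hcomm 0 N
    rw [add_mul, mul_add] at h
    rw [neg_sub, sub_eq_sub_iff_add_eq_add, add_comm, h]
  have hneg : ∀ ε : ℂ, (ε = 0 ∨ ε = 1 ∨ ε = -1) → (-ε = 0 ∨ -ε = 1 ∨ -ε = -1) := by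
    rintro ε (rfl | rfl | rfl) <;> simp
  induction w with
  | a => exact Or.inl rfl
  | b => exact Or.inr (Or.inl rfl)
  | bracket v w hv hw =>
    refine Or.inr (Or.inr ⟨add_le_add v.one_le_weight w.one_le_weight, ?_⟩)
    rcases hv with rfl | rfl | ⟨hv, ε, hε, hv'⟩
    · rcases hw with rfl | rfl | ⟨hw, δ, hδ, hw'⟩
      · exact ⟨0, by simp, by simp [ringEval]⟩
      · refine ⟨1, by simp, ?_⟩
        simp only [ringEval, weight, one_smul, Nat.reduceAdd, Nat.add_one_sub_one, ringHigherComm]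
        noncomm_ring
      · refine ⟨δ, hδ, ?_⟩
        have : (CommWord.a.bracket w).weight - 1 = w.weight - 1 + 1 := by
          simp only [weight]; omega
        rw [this, ← hA]
        simp only [ringEval, hw', mul_smul_comm, smul_mul_assoc, smul_sub]
    · rcases hw with rfl | rfl | ⟨hw, δ, hδ, hw'⟩
      · refine ⟨-1, by simp, ?_⟩
        simp only [ringEval, weight, Nat.reduceAdd, Nat.add_one_sub_one, ringHigherComm, neg_smul,
          one_smul]
        noncomm_ring
      · exact ⟨0, by simp, by simp [ringEval]⟩
      · refine ⟨-δ, hneg δ hδ, ?_⟩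
        have : (CommWord.b.bracket w).weight - 1 = w.weight - 1 + 1 := by
          simp only [weight]; omega
        rw [this, neg_smul, ← smul_neg, ← hB]
        simp only [ringEval, hw', mul_smul_comm, smul_mul_assoc, smul_sub]
    · rcases hw with rfl | rfl | ⟨hw, δ, hδ, hw'⟩
      · refine ⟨-ε, hneg ε hε, ?_⟩
        have : (v.bracket CommWord.a).weight - 1 = v.weight - 1 + 1 := by
          simp only [weight]; omega
        rw [this, ← hA, neg_smul, smul_sub, neg_sub]
        simp only [ringEval, hv', mul_smul_comm, smul_mul_assoc]
      · refine ⟨ε, hε, ?_⟩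
        have : (v.bracket CommWord.b).weight - 1 = v.weight - 1 + 1 := by
          simp only [weight]; omega
        rw [this, ← neg_neg (ringHigherComm A (A + B) _), ← hB, neg_sub, smul_sub]
        simp only [ringEval, hv', mul_smul_comm, smul_mul_assoc]
      -- Both factors are multiples of some K_N, and these commute.
      · refine ⟨0, by simp, ?_⟩
        simp only [ringEval, hv', hw', zero_smul, mul_smul_comm, smul_mul_assoc,
          (hcomm (v.weight - 1) (w.weight - 1)).eq, smul_comm ε δ, sub_self]

end Restriction

/-! ### Superpositions of square integrable functions -/

section Superposition

variable {T X : Type*} [MeasurableSpace T] [MeasurableSpace X] {ν : Measure T} {μ : Measure X}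

/-- Square integrable simple functions live on sets of finite measure, so they are integrable. -/
theorem dense_integrable_Lp_two : Dense {f : Lp ℂ 2 μ | Integrable f μ} := by
  refine (Lp.simpleFunc.dense (E := ℂ) (μ := μ) (p := 2) (by norm_num)).mono ?_
  intro f hf
  have h1 := Lp.simpleFunc.toSimpleFunc_eq_toFun (⟨f, hf⟩ : Lp.simpleFunc ℂ 2 μ)
  have h2 : MemLp (Lp.simpleFunc.toSimpleFunc (⟨f, hf⟩ : Lp.simpleFunc ℂ 2 μ)) 2 μ :=
    Lp.simpleFunc.memLp _
  exact (SimpleFunc.memLp_iff_integrable (by norm_num) (by norm_num) |>.1 h2).congr h1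

/-- Cauchy–Schwarz for the factors a^(1/2) and a^(1/2) b. -/
theorem sq_lintegral_mul_le (a b : T → ℝ≥0∞) (ha : AEMeasurable a ν) (hb : AEMeasurable b ν) :
    (∫⁻ u, a u * b u ∂ν) ^ 2 ≤ (∫⁻ u, a u ∂ν) * ∫⁻ u, a u * b u ^ 2 ∂ν := by
  have h := ENNReal.lintegral_mul_le_Lp_mul_Lq ν (Real.HolderConjugate.two_two)
    (f := fun u => a u ^ (1 / 2 : ℝ)) (g := fun u => a u ^ (1 / 2 : ℝ) * b u)
    (ha.pow_const _) ((ha.pow_const _).mul hb)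
  have e1 : ∀ x : ℝ≥0∞, x ^ (1 / 2 : ℝ) * x ^ (1 / 2 : ℝ) = x := fun x => by
    rw [← ENNReal.rpow_add_of_nonneg _ _ (by norm_num) (by norm_num)]; norm_num
  have e2 : ∀ x : ℝ≥0∞, (x ^ (1 / 2 : ℝ)) ^ (2 : ℝ) = x := fun x => by
    rw [← ENNReal.rpow_mul]; norm_num
  simp only [Pi.mul_apply, ← mul_assoc, e1, e2, ENNReal.mul_rpow_of_nonneg _ _ zero_le_two] at h
  calc (∫⁻ u, a u * b u ∂ν) ^ 2
      ≤ ((∫⁻ u, a u ∂ν) ^ (1 / 2 : ℝ) * (∫⁻ u, a u * b u ^ (2 : ℝ) ∂ν) ^ (1 / 2 : ℝ)) ^ 2 := by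
        gcongr
    _ = _ := by
        rw [mul_pow, ← ENNReal.rpow_natCast, ← ENNReal.rpow_natCast, Nat.cast_ofNat, e2, e2]
        simp only [ENNReal.rpow_ofNat]

theorem lintegral_enorm_mul_le (f g : X → ℂ) (hf : AEStronglyMeasurable f μ)
    (hg : AEStronglyMeasurable g μ) :
    ∫⁻ y, ‖f y‖ₑ * ‖g y‖ₑ ∂μ ≤ eLpNorm f 2 μ * eLpNorm g 2 μ := by
  have h := eLpNorm_smul_le_mul_eLpNorm (p := 2) (q := 2) (r := 1) hg hf
  rw [eLpNorm_one_eq_lintegral_enorm] at h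
  simpa [enorm_mul] using h

variable [SFinite ν] [SFinite μ] {G : T → X → ℂ} {h : T → ℂ} {C : ℝ≥0∞}

/-- Cauchy–Schwarz with weight |h| bounds the square of the integral, and Tonelli then leaves the
uniform bound on the L² norms of the components. -/
theorem memLp_superposition (hG : Measurable (Function.uncurry G)) (hh : Integrable h ν)
    (hC : C ≠ ⊤) (hGC : ∀ u, eLpNorm (G u) 2 μ ≤ C) :
    MemLp (fun y => ∫ u, h u * G u y ∂ν) 2 μ := by
  have hmeas : AEStronglyMeasurable (fun z : X × T => h z.2 * G z.2 z.1) (μ.prod ν) :=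
    hh.1.comp_snd.mul
      (hG.comp measurable_swap).stronglyMeasurable.aestronglyMeasurable
  refine ⟨hmeas.integral_prod_right', ?_⟩
  rw [eLpNorm_lt_top_iff_lintegral_rpow_enorm_lt_top (by norm_num) (by norm_num)]
  have hb : ∀ y, ‖∫ u, h u * G u y ∂ν‖ₑ ^ (2 : ℝ)
      ≤ (∫⁻ u, ‖h u‖ₑ ∂ν) * ∫⁻ u, ‖h u‖ₑ * ‖G u y‖ₑ ^ 2 ∂ν := fun y => by
    refine le_trans ?_ (sq_lintegral_mul_le _ _ hh.1.enorm
      (hG.comp measurable_prodMk_right).enorm.aemeasurable)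
    rw [ENNReal.rpow_ofNat]
    gcongr
    refine (enorm_integral_le_lintegral_enorm _).trans (le_of_eq ?_)
    simp only [enorm_mul]
  have hG2 : ∀ u, ∫⁻ y, ‖G u y‖ₑ ^ 2 ∂μ ≤ C ^ 2 := fun u => by
    have h1 := eLpNorm_eq_lintegral_rpow_enorm_toReal (p := 2) (f := G u) (μ := μ) (by norm_num)
      (by norm_num)
    have h2 : ∫⁻ y, ‖G u y‖ₑ ^ 2 ∂μ = eLpNorm (G u) 2 μ ^ 2 := by
      rw [h1, ← ENNReal.rpow_natCast, ← ENNReal.rpow_mul]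
      simp
    rw [h2]
    gcongr
    exact hGC u
  have hI : ∫⁻ u, ‖h u‖ₑ ∂ν < ⊤ := hh.2
  calc ∫⁻ y, ‖∫ u, h u * G u y ∂ν‖ₑ ^ (ENNReal.toReal 2) ∂μ
      ≤ ∫⁻ y, (∫⁻ u, ‖h u‖ₑ ∂ν) * ∫⁻ u, ‖h u‖ₑ * ‖G u y‖ₑ ^ 2 ∂ν ∂μ := by
        refine lintegral_mono fun y => ?_
        simpa using hb y
    _ = (∫⁻ u, ‖h u‖ₑ ∂ν) * ∫⁻ u, ∫⁻ y, ‖h u‖ₑ * ‖G u y‖ₑ ^ 2 ∂μ ∂ν := by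
        rw [lintegral_const_mul' _ _ hI.ne, lintegral_lintegral_swap]
        exact hh.1.enorm.comp_snd.mul
          ((hG.comp measurable_swap).enorm.pow_const 2).aemeasurable
    _ ≤ (∫⁻ u, ‖h u‖ₑ ∂ν) * ∫⁻ u, ‖h u‖ₑ * C ^ 2 ∂ν := by
        gcongr with u
        rw [lintegral_const_mul' _ _ enorm_ne_top]
        gcongr
        exact hG2 u
    _ < ⊤ := by
        rw [lintegral_mul_const' _ _ (by finiteness)]
        finiteness

/-- Fubini, justified by Cauchy–Schwarz in y uniformly in u. The superposition thus behaves as a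
weak L²-valued integral, without vector-valued integration. -/
theorem inner_superposition (hG : Measurable (Function.uncurry G)) (hh : Integrable h ν)
    (hC : C ≠ ⊤) (hGC : ∀ u, eLpNorm (G u) 2 μ ≤ C) (hGm : ∀ u, MemLp (G u) 2 μ)
    (w : Lp ℂ 2 μ) :
    inner ℂ w (memLp_superposition hG hh hC hGC).toLp = ∫ u, h u * inner ℂ w (hGm u).toLp ∂ν := by
  have hw : Measurable w := (Lp.stronglyMeasurable w).measurable
  have hmeas : AEStronglyMeasurable
      (fun z : X × T => h z.2 * G z.2 z.1 * (starRingEnd ℂ) (w z.1)) (μ.prod ν) :=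
    (hh.1.comp_snd.mul
      (hG.comp measurable_swap).stronglyMeasurable.aestronglyMeasurable).mul
      (RCLike.continuous_conj.comp_aestronglyMeasurable
        (hw.comp measurable_fst).stronglyMeasurable.aestronglyMeasurable)
  have hint : Integrable (fun z : X × T => h z.2 * G z.2 z.1 * (starRingEnd ℂ) (w z.1))
      (μ.prod ν) := by
    refine ⟨hmeas, ?_⟩
    rw [HasFiniteIntegral, lintegral_prod_symm _ hmeas.enorm]
    calc ∫⁻ u, ∫⁻ y, ‖h u * G u y * (starRingEnd ℂ) (w y)‖ₑ ∂μ ∂ν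
        ≤ ∫⁻ u, ‖h u‖ₑ * (C * eLpNorm w 2 μ) ∂ν := by
          refine lintegral_mono fun u => ?_
          simp only [enorm_mul, RCLike.enorm_conj, mul_assoc]
          rw [lintegral_const_mul' _ _ enorm_ne_top]
          gcongr
          refine (lintegral_enorm_mul_le _ _ (hGm u).1 (Lp.aestronglyMeasurable w)).trans ?_
          gcongr
          exact hGC u
      _ < ⊤ := by
          have h1 := Lp.eLpNorm_lt_top w
          have h2 : ∫⁻ u, ‖h u‖ₑ ∂ν < ⊤ := hh.2
          rw [lintegral_mul_const' _ _ (by finiteness)]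
          finiteness
  rw [L2.inner_def]
  calc ∫ y, (inner ℂ (w y) (((memLp_superposition hG hh hC hGC).toLp : Lp ℂ 2 μ) y) : ℂ) ∂μ
      = ∫ y, ∫ u, h u * G u y * (starRingEnd ℂ) (w y) ∂ν ∂μ := by
        refine integral_congr_ae ?_
        filter_upwards [(memLp_superposition hG hh hC hGC).coeFn_toLp] with y hy
        rw [hy, integral_mul_const]
        rfl
    _ = ∫ u, ∫ y, h u * G u y * (starRingEnd ℂ) (w y) ∂μ ∂ν := integral_integral_swap hint
    _ = ∫ u, h u * inner ℂ w (hGm u).toLp ∂ν := by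
        refine integral_congr_ae (Filter.Eventually.of_forall fun u => ?_)
        simp only
        rw [L2.inner_def, ← integral_const_mul]
        refine integral_congr_ae ?_
        filter_upwards [(hGm u).coeFn_toLp] with y hy
        rw [hy, mul_assoc]
        rfl

/-- A unitary operator acts on a superposition through its action on the components. -/
theorem map_superposition (F : Lp ℂ 2 μ ≃ₗᵢ[ℂ] Lp ℂ 2 μ) {G' : T → X → ℂ}
    (hG : Measurable (Function.uncurry G)) (hG' : Measurable (Function.uncurry G'))
    (hh : Integrable h ν) (hC : C ≠ ⊤) (hGC : ∀ u, eLpNorm (G u) 2 μ ≤ C)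
    (hGC' : ∀ u, eLpNorm (G' u) 2 μ ≤ C) (hGm : ∀ u, MemLp (G u) 2 μ)
    (hGm' : ∀ u, MemLp (G' u) 2 μ) (hF : ∀ᵐ u ∂ν, F (hGm u).toLp = (hGm' u).toLp) :
    F (memLp_superposition hG hh hC hGC).toLp = (memLp_superposition hG' hh hC hGC').toLp := by
  -- Testing against w moves F onto the other argument, so that only scalar integrals have to be
  -- compared.
  refine ext_inner_left ℂ fun w => ?_
  have h1 : inner ℂ w (F (memLp_superposition hG hh hC hGC).toLp)
      = inner ℂ (F.symm w) (memLp_superposition hG hh hC hGC).toLp := by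
    rw [← F.inner_map_map (F.symm w), F.apply_symm_apply]
  rw [h1, inner_superposition hG hh hC hGC hGm, inner_superposition hG' hh hC hGC' hGm']
  refine integral_congr_ae ?_
  filter_upwards [hF] with u hu
  rw [← hu, ← F.inner_map_map (F.symm w), F.apply_symm_apply]

end Superposition

section Place

variable (k : Type*) [NormedField k] {K : Type*} [NormedField K] [NormedAlgebra k K]

/-! ### The logarithm of the absolute value and extended characters -/

/-- The logarithm of the normalized absolute value. -/
def lg (y : K) : ℝ := Real.log (absv k y)

/-- The weight `|y| ^ (-1/2)`. -/
def wt (y : K) : ℝ := absv k y ^ (-(1 / 2) : ℝ)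

/-- A unitary character, extended by `0` to a function on the field. -/
def extChar (χ : Kˣ →ₜ* Circle) (y : K) : ℂ :=
  open scoped Classical in if h : y = 0 then 0 else (χ (Units.mk0 y h) : ℂ)

theorem extChar_zero (χ : Kˣ →ₜ* Circle) : extChar χ 0 = 0 := dif_pos rfl

theorem extChar_coe (χ : Kˣ →ₜ* Circle) (u : Kˣ) : extChar χ (u : K) = χ u := by
  rw [extChar, dif_neg u.ne_zero, Units.mk0_val]

theorem extChar_mul (χ : Kˣ →ₜ* Circle) (x y : K) :
    extChar χ (x * y) = extChar χ x * extChar χ y := by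
  rcases eq_or_ne x 0 with rfl | hx
  · simp [extChar_zero]
  rcases eq_or_ne y 0 with rfl | hy
  · simp [extChar_zero]
  lift x to Kˣ using hx.isUnit
  lift y to Kˣ using hy.isUnit
  rw [← Units.val_mul, extChar_coe, extChar_coe, extChar_coe, map_mul, Circle.coe_mul]

theorem norm_extChar (χ : Kˣ →ₜ* Circle) {y : K} (hy : y ≠ 0) : ‖extChar χ y‖ = 1 := by
  lift y to Kˣ using hy.isUnit
  rw [extChar_coe, Circle.norm_coe]

theorem norm_extChar_le (χ : Kˣ →ₜ* Circle) (y : K) : ‖extChar χ y‖ ≤ 1 := by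
  rcases eq_or_ne y 0 with rfl | hy
  · simp [extChar_zero]
  · exact (norm_extChar χ hy).le

theorem char_inv_apply (χ : Kˣ →ₜ* Circle) (u : Kˣ) : χ⁻¹ u = (χ u)⁻¹ := rfl

theorem conj_extChar (χ : Kˣ →ₜ* Circle) (y : K) :
    (starRingEnd ℂ) (extChar χ y) = extChar χ⁻¹ y := by
  rcases eq_or_ne y 0 with rfl | hy
  · simp [extChar_zero]
  lift y to Kˣ using hy.isUnit
  rw [extChar_coe, extChar_coe, char_inv_apply, Circle.coe_inv_eq_conj]

theorem extChar_inv_mul (χ : Kˣ →ₜ* Circle) {y : K} (hy : y ≠ 0) :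
    extChar χ⁻¹ y * extChar χ y = 1 := by
  rw [← conj_extChar, mul_comm, Complex.mul_conj, Complex.normSq_eq_norm_sq, norm_extChar χ hy]
  simp

theorem extChar_inv (χ : Kˣ →ₜ* Circle) (y : K) : extChar χ y⁻¹ = extChar χ⁻¹ y := by
  rcases eq_or_ne y 0 with rfl | hy
  · simp [extChar_zero]
  lift y to Kˣ using hy.isUnit
  rw [← Units.val_inv_eq_inv_val, extChar_coe, extChar_coe, char_inv_apply, map_inv]

theorem continuousOn_extChar (χ : Kˣ →ₜ* Circle) : ContinuousOn (extChar χ) {0}ᶜ := by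
  rw [continuousOn_iff_continuous_domRestrict]
  have : Continuous fun y : ({0}ᶜ : Set K) => (χ (Units.mk0 y.1 y.2) : ℂ) := by
    refine continuous_subtype_val.comp (χ.continuous_toFun.comp ?_)
    exact Units.continuous_iff.2 ⟨continuous_subtype_val,
      continuous_subtype_val.inv₀ fun y => y.2⟩
  refine this.congr fun y => ?_
  have h : y.1 ≠ 0 := y.2
  rw [Set.domRestrict_apply, extChar, dif_neg h]

theorem measurable_extChar [MeasurableSpace K] [BorelSpace K] (χ : Kˣ →ₜ* Circle) :
    Measurable (extChar χ) := by
  classical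
  have h : extChar χ = ({0}ᶜ : Set K).piecewise (extChar χ) 0 := by
    ext y
    by_cases hy : y ∈ ({0}ᶜ : Set K)
    · rw [Set.piecewise_eq_of_mem _ _ _ hy]
    · rw [Set.piecewise_eq_of_notMem _ _ _ hy]
      rw [Set.notMem_compl_iff.1 hy |> Set.mem_singleton_iff.1, extChar_zero, Pi.zero_apply]
  rw [h]
  exact ContinuousOn.measurable_piecewise (continuousOn_extChar χ) continuousOn_const
    (measurableSet_singleton 0).compl

theorem absv_nonneg (y : K) : 0 ≤ absv k y := norm_nonneg _

theorem absv_mul (x y : K) : absv k (x * y) = absv k x * absv k y := by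
  rw [absv, absv, absv, map_mul, norm_mul]

theorem absv_one : absv k (1 : K) = 1 := by rw [absv, map_one, norm_one]

theorem wt_nonneg (y : K) : 0 ≤ wt k y := Real.rpow_nonneg (absv_nonneg k y) _

theorem wt_mul (x y : K) : wt k (x * y) = wt k x * wt k y := by
  rw [wt, absv_mul, Real.mul_rpow (absv_nonneg k x) (absv_nonneg k y), wt, wt]

theorem wt_sq (y : K) : wt k y ^ 2 = (absv k y)⁻¹ := by
  rw [wt, ← Real.rpow_natCast, ← Real.rpow_mul (absv_nonneg k y), ← Real.rpow_neg_one]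
  norm_num

variable [FiniteDimensional k K]

theorem absv_pos {y : K} (hy : y ≠ 0) : 0 < absv k y :=
  norm_pos_iff.2 (Algebra.norm_ne_zero_iff.2 hy)

theorem absv_zero : absv k (0 : K) = 0 := by rw [absv, Algebra.norm_zero, norm_zero]

theorem absv_inv (y : K) : absv k y⁻¹ = (absv k y)⁻¹ := by
  rcases eq_or_ne y 0 with rfl | hy
  · simp [absv_zero]
  · exact eq_inv_of_mul_eq_one_left (by rw [← absv_mul, inv_mul_cancel₀ hy, absv_one])

theorem lg_mul {x y : K} (hx : x ≠ 0) (hy : y ≠ 0) : lg k (x * y) = lg k x + lg k y := by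
  rw [lg, absv_mul, Real.log_mul (absv_pos k hx).ne' (absv_pos k hy).ne', lg, lg]

theorem lg_inv (y : K) : lg k y⁻¹ = - lg k y := by rw [lg, absv_inv, Real.log_inv, lg]

theorem exp_lg {y : K} (hy : y ≠ 0) : Real.exp (lg k y) = absv k y := Real.exp_log (absv_pos k hy)

theorem wt_zero : wt k (0 : K) = 0 := by
  rw [wt, absv_zero, Real.zero_rpow (by norm_num)]

theorem wt_inv (y : K) : wt k y⁻¹ = (wt k y)⁻¹ := by
  rw [wt, absv_inv, Real.inv_rpow (absv_nonneg k y), wt]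

theorem wt_pos {y : K} (hy : y ≠ 0) : 0 < wt k y := Real.rpow_pos_of_pos (absv_pos k hy) _

/-- The working form of the Mellin dual. At y = 0 both integrands vanish because the extended
character does, so nothing about the mass of {0} is needed. -/
theorem mellin_eq_integral [MeasurableSpace K] {μ : Measure K} (f : Lp ℂ 2 μ) (χ : Kˣ →ₜ* Circle)
    (τ : ℝ) : mellin k f χ τ =
      ∫ y, f y * wt k y * (extChar χ y * Complex.exp (τ * lg k y * Complex.I)) ∂μ := by
  refine integral_congr_ae (Filter.Eventually.of_forall fun y => ?_)
  change f y * extChar χ y * _ = _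
  rcases eq_or_ne y 0 with rfl | hy
  · simp [extChar_zero]
  · have h := absv_pos k hy
    beta_reduce
    rw [Complex.cpow_add _ _ (by exact_mod_cast h.ne'), show wt k y = absv k y ^ (-(1 / 2) : ℝ) from rfl,
      Complex.ofReal_cpow h.le,
      Complex.cpow_def_of_ne_zero (x := (absv k y : ℂ)) (y := τ * Complex.I)
        (by exact_mod_cast h.ne'), ← Complex.ofReal_log h.le, lg]
    push_cast
    rw [show (Real.log (absv k y) : ℂ) * (τ * Complex.I) = τ * Real.log (absv k y) * Complex.I by
      ring]
    ring

/-- The unitary character `χ |·| ^ (it)`. -/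
def twist (hc : Continuous (absv k : K → ℝ)) (χ : Kˣ →ₜ* Circle) (t : ℝ) : Kˣ →ₜ* Circle where
  toFun u := χ u * Circle.exp (t * lg k (u : K))
  map_one' := by simp [lg, absv_one]
  map_mul' u v := by
    rw [map_mul, Units.val_mul, lg_mul k u.ne_zero v.ne_zero, mul_add, Circle.exp_add,
      mul_mul_mul_comm]
  continuous_toFun := by
    refine χ.continuous_toFun.mul (Circle.exp.continuous.comp (continuous_const.mul ?_))
    exact (hc.comp Units.continuous_val).log fun u => (absv_pos k u.ne_zero).ne'

theorem extChar_twist (hc : Continuous (absv k : K → ℝ)) (χ : Kˣ →ₜ* Circle) (t : ℝ) (y : K) :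
    extChar (twist k hc χ t) y = extChar χ y * Complex.exp (t * lg k y * Complex.I) := by
  rcases eq_or_ne y 0 with rfl | hy
  · simp [extChar_zero]
  lift y to Kˣ using hy.isUnit
  rw [extChar_coe, extChar_coe]
  change ((χ y * Circle.exp (t * lg k (y : K)) : Circle) : ℂ) = _
  rw [Circle.coe_mul, Circle.coe_exp, Complex.ofReal_mul]

theorem sameComponent_iff (hc : Continuous (absv k : K → ℝ)) (χ χ' : Kˣ →ₜ* Circle) :
    SameComponent k χ χ' ↔ ∃ t, χ' = twist k hc χ t := by
  refine exists_congr fun t => ?_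
  have h : ∀ u : Kˣ, ((absv k (u : K) : ℝ) : ℂ) ^ (t * Complex.I)
      = Complex.exp (t * lg k (u : K) * Complex.I) := fun u => by
    have h := absv_pos k u.ne_zero
    rw [Complex.cpow_def_of_ne_zero (by exact_mod_cast h.ne'), ← Complex.ofReal_log h.le, lg]
    ring_nf
  simp only [h, ← extChar_coe]
  constructor
  · intro H
    ext u
    exact (extChar_coe χ' u).symm.trans ((H u).trans ((extChar_twist k hc χ t u).symm.trans
      (extChar_coe _ u)))
  · rintro rfl u
    rw [extChar_twist]

end Place

/-- The properties of a local field with its normalized absolute value, its Haar measure and its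
additive character on which the construction of the stable domain depends. -/
structure IsPlace (k : Type*) [NormedField k] (K : Type*) [NormedField K] [NormedAlgebra k K]
    [MeasurableSpace K] (μ : Measure K) (ψ : k → ℂ) : Prop where
  continuous_absv : Continuous (absv k : K → ℝ)
  map_mul_left : ∀ a : K, a ≠ 0 →
    μ.map (fun y => a * y) = ENNReal.ofReal (absv k a)⁻¹ • μ
  measure_zero : μ {0} = 0
  continuous_char : Continuous (addCharTr ψ : K → ℂ)
  norm_char : ∀ x : K, ‖addCharTr ψ x‖ = 1
  exists_char : ∀ u : Kˣ, u ≠ 1 → ∃ χ : Kˣ →ₜ* Circle, χ u ≠ 1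
  sameComponent : ∀ χ χ' : Kˣ →ₜ* Circle, (∀ u : Kˣ, absv k (u : K) = 1 → χ u = χ' u) →
    SameComponent k χ χ'
  -- A measurable choice of an element of given absolute value. It serves to read a function
  -- determined by |y| as a measurable function of log|y|.
  exists_section : ∃ σ : ℝ → K, Measurable σ ∧ ∀ y : K, y ≠ 0 →
    σ (lg k y) ≠ 0 ∧ lg k (σ (lg k y)) = lg k y

section Place

set_option linter.unusedSectionVars false

variable {k : Type*} [NormedField k] {K : Type*} [NormedField K] [NormedAlgebra k K]
  [MeasurableSpace K] {μ : Measure K} {ψ : k → ℂ}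

/-! ### Scaling -/

namespace IsPlace

variable [BorelSpace K] (P : IsPlace k K μ ψ)
include P

theorem ae_ne_zero : ∀ᵐ y ∂μ, y ≠ 0 := by
  rw [ae_iff]
  simpa using P.measure_zero

theorem measurable_absv : Measurable (absv k : K → ℝ) := P.continuous_absv.measurable

theorem measurable_lg : Measurable (lg k : K → ℝ) := P.measurable_absv.log

theorem measurable_wt : Measurable (wt k : K → ℝ) := P.measurable_absv.pow_const _

theorem lintegral_mul_left (g : K → ℝ≥0∞) {a : K} (ha : a ≠ 0) :
    ∫⁻ y, g (a * y) ∂μ = ENNReal.ofReal (absv k a)⁻¹ * ∫⁻ y, g y ∂μ := by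
  have h := lintegral_map_equiv (μ := μ) g (MeasurableEquiv.mulLeft₀ a ha)
  rw [MeasurableEquiv.coe_mulLeft₀, P.map_mul_left a ha, lintegral_smul_measure, smul_eq_mul] at h
  exact h.symm

theorem integral_mul_left (g : K → ℂ) {a : K} (ha : a ≠ 0) :
    ∫ y, g (a * y) ∂μ = ((absv k a)⁻¹ : ℝ) * ∫ y, g y ∂μ := by
  have h := integral_map_equiv (μ := μ) (MeasurableEquiv.mulLeft₀ a ha) g
  rw [MeasurableEquiv.coe_mulLeft₀, P.map_mul_left a ha, integral_smul_measure,
    ENNReal.toReal_ofReal (inv_nonneg.2 (absv_nonneg k a)), Complex.real_smul] at h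
  exact h.symm

theorem integrable_mul_left {g : K → ℂ} (hg : Integrable g μ) {a : K} (ha : a ≠ 0) :
    Integrable (fun y => g (a * y)) μ := by
  have h := integrable_map_equiv (μ := μ) (MeasurableEquiv.mulLeft₀ a ha) g
  rw [MeasurableEquiv.coe_mulLeft₀, P.map_mul_left a ha] at h
  exact h.1 (hg.smul_measure ENNReal.ofReal_ne_top)

theorem quasiMeasurePreserving_mul_left {a : K} (ha : a ≠ 0) :
    Measure.QuasiMeasurePreserving (fun y => a * y) μ μ :=
  ⟨measurable_const_mul a, by
    rw [P.map_mul_left a ha]; exact Measure.smul_absolutelyContinuous⟩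

end IsPlace

variable (k) in
/-- The unitary dilation `f ↦ |u| ^ (-1/2) f(y / u)`. -/
def dilate (u : K) (f : K → ℂ) (y : K) : ℂ := f (u⁻¹ * y) * wt k u

namespace IsPlace

variable [BorelSpace K] [FiniteDimensional k K] (P : IsPlace k K μ ψ)
include P

/-- For u ≠ 0 the weight exactly compensates the scaling of the measure. The inequality also covers
u = 0, where the weight vanishes, so that superpositions over all u have a uniform bound. -/
theorem eLpNorm_dilate_le (u : K) (f : K → ℂ) :
    eLpNorm (dilate k u f) 2 μ ≤ eLpNorm f 2 μ := by
  rcases eq_or_ne u 0 with rfl | hu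
  · have h0 : dilate k (0 : K) f = 0 := funext fun y => by
      rw [dilate, wt_zero k, Complex.ofReal_zero, mul_zero, Pi.zero_apply]
    rw [h0, eLpNorm_zero]
    exact zero_le
  have h0 := absv_pos k hu
  have hw := wt_sq k u
  rw [eLpNorm_eq_lintegral_rpow_enorm_toReal (by norm_num) (by norm_num),
    eLpNorm_eq_lintegral_rpow_enorm_toReal (by norm_num) (by norm_num)]
  refine ENNReal.rpow_le_rpow (le_of_eq ?_) (by norm_num)
  simp only [dilate, ENNReal.toReal_ofNat, enorm_mul, ENNReal.rpow_ofNat, mul_pow]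
  have h1 : ‖((wt k u : ℝ) : ℂ)‖ₑ ^ 2 = ENNReal.ofReal (absv k u)⁻¹ := by
    rw [← ofReal_norm, Complex.norm_real, Real.norm_of_nonneg (wt_nonneg k u),
      ← ENNReal.ofReal_pow (wt_nonneg k u), hw]
  rw [lintegral_mul_const' _ _ (by finiteness), h1,
    P.lintegral_mul_left (fun y => ‖f y‖ₑ ^ 2) (inv_ne_zero hu), absv_inv, inv_inv, mul_right_comm,
    ← ENNReal.ofReal_mul h0.le, mul_inv_cancel₀ h0.ne', ENNReal.ofReal_one, one_mul]

theorem measurable_uncurry_dilate {f : K → ℂ} (hf : Measurable f) [SecondCountableTopology K] :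
    Measurable (Function.uncurry fun u => dilate k u f) := by
  have h1 : Measurable fun z : K × K => z.1⁻¹ * z.2 := measurable_fst.inv.mul measurable_snd
  exact (hf.comp h1).mul (Complex.measurable_ofReal.comp (P.measurable_wt.comp measurable_fst))

theorem memLp_dilate (u : K) {f : K → ℂ} (hf : Measurable f) (h2 : MemLp f 2 μ) :
    MemLp (dilate k u f) 2 μ :=
  ⟨((hf.comp (measurable_const_mul _)).mul_const _).aestronglyMeasurable,
    (P.eLpNorm_dilate_le u f).trans_lt h2.2⟩

end IsPlace

/-! ### Unitary characters separate complex measures -/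

instance [BorelSpace K] : BorelSpace Kˣ where
  measurable_eq := by
    rw [Units.isEmbedding_val₀.eq_induced, borel_comap, ← BorelSpace.measurable_eq (α := K)]
    rfl

/-- The unit group is homeomorphic to an open subset of a Polish space. This is what the uniqueness
theorem for finite measures asks for. -/
instance [CompleteSpace K] [SecondCountableTopology K] : PolishSpace Kˣ := by
  have : PolishSpace ({0}ᶜ : Set K) := (isClosed_singleton.isOpen_compl).polishSpace
  have : PolishSpace {y : K // y ≠ 0} := this
  exact ((unitsHomeomorphNeZero (G₀ := K)).isClosedEmbedding).polishSpace

/-- Unitary characters as bounded continuous functions. -/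
def boundedChar (χ : Kˣ →ₜ* Circle) : BoundedContinuousFunction Kˣ ℂ :=
  BoundedContinuousFunction.ofNormedAddCommGroup (fun u => (χ u : ℂ))
    (continuous_subtype_val.comp χ.continuous_toFun) 1 fun _ => (Circle.norm_coe _).le

/-- Characters are closed under products and conjugation and separate points. Their span is
therefore a star subalgebra of the bounded continuous functions, and such an algebra determines a
finite measure on a Polish space. -/
theorem ext_of_forall_integral_char [BorelSpace K] [CompleteSpace K] [SecondCountableTopology K]
    (hsep : ∀ u : Kˣ, u ≠ 1 → ∃ χ : Kˣ →ₜ* Circle, χ u ≠ 1)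
    {ν ν' : Measure Kˣ} [IsFiniteMeasure ν] [IsFiniteMeasure ν']
    (h : ∀ χ : Kˣ →ₜ* Circle, ∫ u, (χ u : ℂ) ∂ν = ∫ u, (χ u : ℂ) ∂ν') : ν = ν' := by
  let M : Submonoid (BoundedContinuousFunction Kˣ ℂ) :=
    { carrier := Set.range boundedChar
      one_mem' := ⟨1, by ext u; rfl⟩
      mul_mem' := by rintro _ _ ⟨χ, rfl⟩ ⟨χ', rfl⟩; exact ⟨χ * χ', by ext u; rfl⟩ }
  let A : StarSubalgebra ℂ (BoundedContinuousFunction Kˣ ℂ) :=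
    { Algebra.adjoin ℂ (M : Set (BoundedContinuousFunction Kˣ ℂ)) with
      star_mem' := by
        intro a ha
        change star a ∈ Algebra.adjoin ℂ (M : Set (BoundedContinuousFunction Kˣ ℂ))
        change a ∈ Algebra.adjoin ℂ (M : Set (BoundedContinuousFunction Kˣ ℂ)) at ha
        induction ha using Algebra.adjoin_induction with
        | mem x hx =>
          obtain ⟨χ, rfl⟩ := hx
          refine Algebra.subset_adjoin ⟨χ⁻¹, ?_⟩
          ext u
          exact Circle.coe_inv_eq_conj _
        | algebraMap r =>
          rw [← algebraMap_star_comm]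
          exact Subalgebra.algebraMap_mem _ _
        | add x y _ _ hx hy => rw [star_add]; exact add_mem hx hy
        | mul x y _ _ hx hy => rw [star_mul]; exact mul_mem hy hx }
  refine ext_of_forall_mem_subalgebra_integral_eq_of_polish (A := A) ?_ ?_
  · intro u v huv
    obtain ⟨χ, hχ⟩ := hsep (u * v⁻¹) (by rwa [Ne, mul_inv_eq_one])
    refine ⟨_, ⟨_, ⟨boundedChar χ, Algebra.subset_adjoin ⟨χ, rfl⟩, rfl⟩, rfl⟩, ?_⟩
    change (χ u : ℂ) ≠ χ v
    intro h'
    refine hχ ?_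
    rw [map_mul, map_inv, mul_inv_eq_one]
    exact Subtype.ext h'
  · intro g hg
    change g ∈ Algebra.adjoin ℂ (M : Set (BoundedContinuousFunction Kˣ ℂ)) at hg
    -- The characters already form a monoid, so the algebra they generate is their linear span and
    -- the hypothesis extends by linearity.
    rw [← Subalgebra.mem_toSubmodule, Algebra.adjoin_eq_span_of_subset] at hg
    · induction hg using Submodule.span_induction with
      | mem x hx => obtain ⟨χ, rfl⟩ := hx; exact h χ
      | zero => simp
      | add x y _ _ hx hy =>
        simp only [BoundedContinuousFunction.coe_add, Pi.add_apply]
        rw [integral_add (x.integrable ν) (y.integrable ν),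
          integral_add (x.integrable ν') (y.integrable ν'), hx, hy]
      | smul c x _ hx =>
        simp only [BoundedContinuousFunction.coe_smul]
        rw [integral_smul, integral_smul, hx]
    · rw [Submonoid.closure_eq]
      exact Submodule.subset_span

/-- The conjugate of g has vanishing integrals too, since conjugation inverts characters; so the
real and imaginary parts can be treated separately. For a real density, the positive and negative
parts give two finite measures on the unit group with the same character integrals. -/
theorem IsPlace.ae_eq_zero_of_forall_integral_char [BorelSpace K] [CompleteSpace K]
    [SecondCountableTopology K] (P : IsPlace k K μ ψ) {g : K → ℂ} (hg : Integrable g μ)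
    (h : ∀ χ : Kˣ →ₜ* Circle, ∫ y, g y * extChar χ y ∂μ = 0) : g =ᵐ[μ] 0 := by
  have hint : ∀ χ : Kˣ →ₜ* Circle, ∀ {g' : K → ℂ}, Integrable g' μ →
      Integrable (fun y => g' y * extChar χ y) μ := fun χ g' hg' =>
    hg'.mul_bdd (c := 1) (measurable_extChar χ).aestronglyMeasurable
      (Filter.Eventually.of_forall fun y => norm_extChar_le χ y)
  have hconj : ∀ χ : Kˣ →ₜ* Circle, ∫ y, (starRingEnd ℂ) (g y) * extChar χ y ∂μ = 0 := fun χ => by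
    rw [← map_zero (starRingEnd ℂ), ← h χ⁻¹, ← integral_conj]
    simp only [map_mul, conj_extChar, inv_inv]
  have hemb : MeasurableEmbedding (Units.val : Kˣ → K) :=
    Units.isOpenEmbedding_val.measurableEmbedding
  -- The measure has no mass at 0, so restricting it to the unit group loses nothing.
  have hmap : ∀ s : K → ℝ, Measure.map Units.val
      ((μ.withDensity fun y => ENNReal.ofReal (s y)).comap (Units.val : Kˣ → K))
      = μ.withDensity fun y => ENNReal.ofReal (s y) := fun s => by
    rw [hemb.map_comap, Measure.restrict_eq_self_of_ae_mem]
    refine (withDensity_absolutelyContinuous μ _).ae_le ?_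
    filter_upwards [P.ae_ne_zero] with y hy using ⟨Units.mk0 y hy, rfl⟩
  have hpm : ∀ s : K → ℝ, Integrable s μ → ∀ χ : Kˣ →ₜ* Circle,
      ∫ u, (χ u : ℂ) ∂((μ.withDensity fun y => ENNReal.ofReal (s y)).comap Units.val)
        = ∫ y, ((max (s y) 0 : ℝ) : ℂ) * extChar χ y ∂μ := fun s hs χ => by
    simp only [← extChar_coe]
    rw [← hemb.integral_map (g := extChar χ), hmap s]
    refine (integral_withDensity_eq_integral_smul₀ (f := fun y => (s y).toNNReal)
      hs.1.aemeasurable.real_toNNReal _).trans ?_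
    refine integral_congr_ae (Filter.Eventually.of_forall fun y => ?_)
    simp only [NNReal.smul_def, Real.coe_toNNReal', Complex.real_smul]
  have hfin : ∀ s : K → ℝ, Integrable s μ →
      IsFiniteMeasure ((μ.withDensity fun y => ENNReal.ofReal (s y)).comap (Units.val : Kˣ → K)) :=
    fun s hs => by
    have h1 : IsFiniteMeasure (μ.withDensity fun y => ENNReal.ofReal (s y)) :=
      isFiniteMeasure_withDensity_ofReal hs.2
    rw [← hmap s] at h1
    exact ⟨by simpa [hemb.measurable] using
      (Measure.map_apply hemb.measurable MeasurableSet.univ).symm.trans_lt h1.measure_univ_lt_top⟩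
  have hreal : ∀ r : K → ℝ, Integrable r μ →
      (∀ χ : Kˣ →ₜ* Circle, ∫ y, (r y : ℂ) * extChar χ y ∂μ = 0) → r =ᵐ[μ] 0 := by
    intro r hr hr0
    have := hfin r hr
    have := hfin _ hr.neg
    have hcomap := ext_of_forall_integral_char P.exists_char
      (ν := (μ.withDensity fun y => ENNReal.ofReal (r y)).comap (Units.val : Kˣ → K))
      (ν' := (μ.withDensity fun y => ENNReal.ofReal ((-r) y)).comap (Units.val : Kˣ → K))
      fun χ => by
        have h1 := integral_sub (hint χ hr.pos_part.ofReal) (hint χ hr.neg.pos_part.ofReal)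
        rw [hpm r hr, hpm _ hr.neg, ← sub_eq_zero]
        refine h1.symm.trans ((integral_congr_ae ?_).trans (hr0 χ))
        refine Filter.Eventually.of_forall fun y => ?_
        change ((max (r y) 0 : ℝ) : ℂ) * _ - ((max (-r y) 0 : ℝ) : ℂ) * _ = _
        rw [← sub_mul, ← Complex.ofReal_sub, max_zero_sub_max_neg_zero_eq_self]
    have hd := congrArg (Measure.map Units.val) hcomap
    rw [hmap, hmap, withDensity_eq_iff hr.1.aemeasurable.ennreal_ofReal
      hr.neg.1.aemeasurable.ennreal_ofReal hr.lintegral_lt_top.ne] at hd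
    filter_upwards [hd] with y hy
    rcases le_total (r y) 0 with h0 | h0
    · rw [ENNReal.ofReal_of_nonpos h0, eq_comm, ENNReal.ofReal_eq_zero] at hy
      exact le_antisymm h0 (neg_nonpos.1 hy)
    · rw [Pi.neg_apply, ENNReal.ofReal_of_nonpos (neg_nonpos.2 h0), ENNReal.ofReal_eq_zero] at hy
      exact le_antisymm hy h0
  have hconj_int : Integrable (fun y => (starRingEnd ℂ) (g y)) μ :=
    Complex.conjCLE.toContinuousLinearMap.integrable_comp hg
  have hre := hreal (fun y => (g y).re) hg.re fun χ => by
    have h1 := integral_add (hint χ hg) (hint χ hconj_int)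
    rw [h, hconj, add_zero] at h1
    rw [← mul_right_inj' (two_ne_zero (α := ℂ)), mul_zero, ← h1, ← integral_const_mul]
    refine integral_congr_ae (Filter.Eventually.of_forall fun y => ?_)
    simp only [← add_mul, Complex.add_conj]
    push_cast
    ring
  have him := hreal (fun y => (g y).im) hg.im fun χ => by
    have h1 := integral_sub (hint χ hg) (hint χ hconj_int)
    rw [h, hconj, sub_zero] at h1
    rw [← mul_right_inj' (mul_ne_zero (two_ne_zero (α := ℂ)) Complex.I_ne_zero), mul_zero, ← h1,
      ← integral_const_mul]
    refine integral_congr_ae (Filter.Eventually.of_forall fun y => ?_)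
    simp only [← sub_mul, Complex.sub_conj]
    push_cast
    ring
  filter_upwards [hre, him] with y h1 h2
  exact Complex.ext h1 h2

/-! ### The Fourier transform -/

section Fourier

variable {F : Lp ℂ 2 μ ≃ₗᵢ[ℂ] Lp ℂ 2 μ}

theorem inner_star_eq_integral (f g : Lp ℂ 2 μ) :
    inner ℂ (star f) g = ∫ y, f y * g y ∂μ := by
  rw [L2.inner_def]
  refine integral_congr_ae ?_
  filter_upwards [Lp.coeFn_star f] with y hy
  rw [hy]
  change g y * (starRingEnd ℂ) ((starRingEnd ℂ) (f y)) = _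
  rw [Complex.conj_conj, mul_comm]

theorem continuous_integral_mul_left (g : Lp ℂ 2 μ) :
    Continuous fun f : Lp ℂ 2 μ => ∫ y, f y * g y ∂μ := by
  have : (fun f : Lp ℂ 2 μ => ∫ y, f y * g y ∂μ) = fun f => inner ℂ (star g) f := by
    ext f
    rw [inner_star_eq_integral]
    simp only [mul_comm]
  rw [this]
  fun_prop

variable [BorelSpace K] [SecondCountableTopology K] [SFinite μ]

/-- The multiplication formula for the Fourier transform. -/
theorem IsPlace.integral_fourier_mul (P : IsPlace k K μ ψ) (hF : IsFourierTransform ψ F)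
    (f g : Lp ℂ 2 μ) : ∫ y, F f y * g y ∂μ = ∫ y, f y * F g y ∂μ := by
  have hsymm : ∀ f g : Lp ℂ 2 μ, ∫ y, f y * F g y ∂μ = ∫ y, F g y * f y ∂μ := fun f g => by
    simp only [mul_comm]
  have h1 : ∀ f g : Lp ℂ 2 μ, Integrable f μ → Integrable g μ →
      ∫ y, F f y * g y ∂μ = ∫ y, f y * F g y ∂μ := by
    intro f g hf hg
    have hint : Integrable (fun z : K × K => g z.1 * f z.2 * addCharTr ψ (-(z.1 * z.2)))
        (μ.prod μ) := by
      refine (hg.mul_prod hf).mul_bdd (c := 1) ?_ (Filter.Eventually.of_forall fun z => ?_)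
      · exact (P.continuous_char.comp (by fun_prop)).aestronglyMeasurable
      · exact (P.norm_char _).le
    calc ∫ x, F f x * g x ∂μ
        = ∫ x, ∫ y, g x * f y * addCharTr ψ (-(x * y)) ∂μ ∂μ := by
          refine integral_congr_ae ?_
          filter_upwards [hF f hf] with x hx
          rw [hx, mul_comm, ← integral_const_mul]
          simp only [mul_assoc]
      _ = ∫ y, ∫ x, g x * f y * addCharTr ψ (-(x * y)) ∂μ ∂μ := integral_integral_swap hint
      _ = _ := by
          refine integral_congr_ae ?_
          filter_upwards [hF g hg] with y hy
          rw [hy, ← integral_const_mul]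
          refine integral_congr_ae (Filter.Eventually.of_forall fun x => ?_)
          simp only
          rw [mul_comm x y]
          ring
  -- With one argument fixed, both sides are continuous in the other. Density of the integrable
  -- functions removes the two integrability assumptions one at a time.
  have h2 : ∀ g : Lp ℂ 2 μ, Integrable g μ → ∀ f : Lp ℂ 2 μ,
      ∫ y, F f y * g y ∂μ = ∫ y, f y * F g y ∂μ := fun g hg f =>
    congrFun (Continuous.ext_on dense_integrable_Lp_two
      ((continuous_integral_mul_left g).comp F.continuous) (continuous_integral_mul_left (F g))
      fun f hf => h1 f g hf hg) f
  have h3 := Continuous.ext_on dense_integrable_Lp_two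
      ((continuous_integral_mul_left f).comp F.continuous) (continuous_integral_mul_left (F f))
      fun g hg => by
        change ∫ y, F g y * f y ∂μ = ∫ y, g y * F f y ∂μ
        rw [← hsymm, ← h2 g hg f]
        simp only [mul_comm]
  have h4 : ∫ y, F g y * f y ∂μ = ∫ y, g y * F f y ∂μ := congrFun h3 g
  rw [hsymm, h4]
  simp only [mul_comm]

/-- The inverse Fourier transform is the conjugate of the Fourier transform. -/
theorem IsPlace.fourier_symm_apply (P : IsPlace k K μ ψ) (hF : IsFourierTransform ψ F)
    (g : Lp ℂ 2 μ) : F.symm g = star (F (star g)) := by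
  refine ext_inner_left ℂ fun w => ?_
  have h1 : inner ℂ w (F.symm g) = inner ℂ (F w) g := by
    rw [← F.inner_map_map w, F.apply_symm_apply]
  have h2 : ∀ f g : Lp ℂ 2 μ, (inner ℂ f g : ℂ) = (starRingEnd ℂ) (∫ y, f y * (star g) y ∂μ) := by
    intro f g
    rw [← inner_conj_symm, ← star_star g, inner_star_eq_integral, star_star]
    simp only [mul_comm]
  rw [h1, h2, h2, star_star, P.integral_fourier_mul hF]

theorem eq_of_forall_integrable {f g : Lp ℂ 2 μ}
    (h : ∀ w : Lp ℂ 2 μ, Integrable w μ → ∫ y, f y * w y ∂μ = ∫ y, g y * w y ∂μ) : f = g := by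
  refine dense_integrable_Lp_two.eq_of_inner_right ℂ fun w hw => ?_
  have hw' : Integrable (star w : Lp ℂ 2 μ) μ := by
    refine Integrable.congr (Complex.conjCLE.toContinuousLinearMap.integrable_comp hw) ?_
    exact (Lp.coeFn_star w).symm
  rw [← star_star w, inner_star_eq_integral, inner_star_eq_integral]
  simpa only [mul_comm] using h _ hw'

omit [BorelSpace K] [SecondCountableTopology K] [SFinite μ] in
theorem integral_mul_congr {f f' : K → ℂ} (h : f =ᵐ[μ] f') (g : K → ℂ) :
    ∫ y, f y * g y ∂μ = ∫ y, f' y * g y ∂μ :=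
  integral_congr_ae (h.mono fun y hy => by simp only [hy])

theorem absv_mul_wt [FiniteDimensional k K] {u : K} (hu : u ≠ 0) :
    absv k u * wt k u = wt k u⁻¹ := by
  have h := wt_sq k u
  have h1 := absv_pos k hu
  have h2 := wt_pos k hu
  rw [wt_inv]
  refine eq_inv_of_mul_eq_one_left ?_
  rw [mul_assoc, ← pow_two, h, mul_inv_cancel₀ h1.ne']

variable [FiniteDimensional k K]

theorem IsPlace.integral_dilate_mul (P : IsPlace k K μ ψ) (f g : K → ℂ) {u : K} (hu : u ≠ 0) :
    ∫ y, dilate k u f y * g y ∂μ = ∫ y, f y * dilate k u⁻¹ g y ∂μ := by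
  have h := P.integral_mul_left (fun y => dilate k u f y * g y) hu
  have h1 : ((absv k u : ℝ) : ℂ) ≠ 0 := by exact_mod_cast (absv_pos k hu).ne'
  rw [Complex.ofReal_inv, eq_inv_mul_iff_mul_eq₀ h1] at h
  rw [← h, ← integral_const_mul]
  refine integral_congr_ae (Filter.Eventually.of_forall fun y => ?_)
  simp only [dilate, inv_inv, inv_mul_cancel_left₀ hu]
  rw [← absv_mul_wt hu]
  push_cast
  ring

/-- The Fourier transform turns dilations into inverse dilations. -/
theorem IsPlace.fourier_dilate (P : IsPlace k K μ ψ) (hF : IsFourierTransform ψ F)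
    (f : Lp ℂ 2 μ) {u : K} (hu : u ≠ 0) :
    F (P.memLp_dilate u (Lp.stronglyMeasurable f).measurable (Lp.memLp f)).toLp
      = (P.memLp_dilate u⁻¹ (Lp.stronglyMeasurable (F f)).measurable (Lp.memLp (F f))).toLp := by
  refine eq_of_forall_integrable fun w hw => ?_
  set w' : Lp ℂ 2 μ := (P.memLp_dilate u (Lp.stronglyMeasurable w).measurable (Lp.memLp w)).toLp
    with hw'
  have h1 : w' =ᵐ[μ] dilate k u w := MemLp.coeFn_toLp _
  have hw'i : Integrable w' μ := by
    refine Integrable.congr ?_ h1.symm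
    exact (P.integrable_mul_left hw (inv_ne_zero hu)).mul_const _
  -- The integral formula is available only for integrable functions, so it is applied to the test
  -- function w. The case of general f follows by duality from the multiplication formula.
  have hA : F w' =ᵐ[μ] dilate k u⁻¹ (F w) := by
    filter_upwards [hF w' hw'i, (P.quasiMeasurePreserving_mul_left hu).ae (hF w hw)] with x h2 h3
    rw [h2, dilate, inv_inv, h3, mul_comm, ← integral_const_mul]
    have h4 := P.integral_dilate_mul w (fun y => addCharTr ψ (-(x * y))) hu
    rw [integral_mul_congr h1, h4]
    refine integral_congr_ae (Filter.Eventually.of_forall fun y => ?_)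
    simp only [dilate, inv_inv]
    rw [show x * (u * y) = u * x * y by ring]
    ring
  rw [P.integral_fourier_mul hF]
  rw [integral_mul_congr (MemLp.coeFn_toLp _), integral_mul_congr (MemLp.coeFn_toLp _)]
  calc ∫ y, dilate k u f y * F w y ∂μ
      = ∫ y, f y * dilate k u⁻¹ (F w) y ∂μ := P.integral_dilate_mul _ _ hu
    _ = ∫ y, f y * F w' y ∂μ := integral_congr_ae (hA.mono fun y hy => by simp only [hy])
    _ = ∫ y, F f y * w' y ∂μ := (P.integral_fourier_mul hF _ _).symm
    _ = ∫ y, F f y * dilate k u w y ∂μ :=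
        integral_congr_ae (h1.mono fun y hy => by simp only [hy])
    _ = ∫ y, dilate k u⁻¹ (F f) y * w y ∂μ := by
        rw [P.integral_dilate_mul _ _ (inv_ne_zero hu), inv_inv]

/-- The Fourier transform turns multiplicative convolution with `h` into that with its
inversion. -/
theorem IsPlace.fourier_convolution (P : IsPlace k K μ ψ) (hF : IsFourierTransform ψ F)
    {f g h : K → ℂ} (hf : Measurable f) (hg : Measurable g) (hf2 : MemLp f 2 μ)
    (hg2 : MemLp g 2 μ) (hfg : F hf2.toLp = hg2.toLp) (hh : Integrable h μ) :
    ∃ (h1 : MemLp (fun y => ∫ u, h u * dilate k u f y ∂μ) 2 μ)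
      (h2 : MemLp (fun y => ∫ u, h u * dilate k u⁻¹ g y ∂μ) 2 μ), F h1.toLp = h2.toLp := by
  have hm : Measurable (Function.uncurry fun u => dilate k u⁻¹ g) :=
    (P.measurable_uncurry_dilate hg).comp (measurable_fst.inv.prodMk measurable_snd)
  -- F is isometric, so one constant bounds the dilates of both f and g.
  have hn : eLpNorm g 2 μ = eLpNorm f 2 μ := by
    have := F.norm_map hf2.toLp
    rw [hfg, Lp.norm_toLp, Lp.norm_toLp] at this
    exact (ENNReal.toReal_eq_toReal_iff' hg2.2.ne hf2.2.ne).1 this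
  -- Multiplication by a nonzero scalar preserves null sets, so the dilate does not depend on the
  -- chosen representative of the class.
  have hd : ∀ u : K, u ≠ 0 → ∀ {f' : K → ℂ} (hf' : Measurable f') (h2 : MemLp f' 2 μ),
      (P.memLp_dilate u hf' h2).toLp = (P.memLp_dilate u
        (Lp.stronglyMeasurable h2.toLp).measurable (Lp.memLp _)).toLp := by
    intro u hu f' hf' h2
    refine MemLp.toLp_congr _ _ ?_
    filter_upwards [(P.quasiMeasurePreserving_mul_left (inv_ne_zero hu)).ae h2.coeFn_toLp] with y hy
    rw [dilate, dilate, hy]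
  refine ⟨_, _, map_superposition F (P.measurable_uncurry_dilate hf) hm hh hf2.2.ne
    (fun u => P.eLpNorm_dilate_le u f) (fun u => hn ▸ P.eLpNorm_dilate_le u⁻¹ g)
    (fun u => P.memLp_dilate u hf hf2) (fun u => P.memLp_dilate u⁻¹ hg hg2)
    (P.ae_ne_zero.mono fun u hu => ?_)⟩
  rw [hd u hu hf hf2, hd u⁻¹ (inv_ne_zero hu) hg hg2, P.fourier_dilate hF _ hu]
  simp only [hfg]

end Fourier

end Place

/-! ### Profiles χ(y)⁻¹|y|^(-1/2) φ(log|y|) and their Mellin transforms -/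

section Profile

set_option linter.unusedSectionVars false

variable (k : Type*) [NormedField k] {K : Type*} [NormedField K] [NormedAlgebra k K]
  [MeasurableSpace K] (μ : Measure K) (ψ : k → ℂ)

/-- The function `χ(y)⁻¹ |y| ^ (-1/2) φ(log |y|)`. -/
def profile (χ : Kˣ →ₜ* Circle) (φ : ℝ → ℂ) (y : K) : ℂ :=
  extChar χ⁻¹ y * wt k y * φ (lg k y)

/-- The Fourier transform of `φ` for the image under `log |·|` of the measure `dy / |y|`. -/
def logMellin (φ : ℝ → ℂ) (τ : ℝ) : ℂ :=
  ∫ y : K, φ (lg k y) * ((absv k y)⁻¹ : ℝ) * Complex.exp (τ * lg k y * Complex.I) ∂μ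

/-- The convolution for the image under `log |·|` of the measure `dy / |y|`. -/
def logConv (φ φ' : ℝ → ℂ) (s : ℝ) : ℂ :=
  ∫ u : K, φ (s - lg k u) * φ' (lg k u) * ((absv k u)⁻¹ : ℝ) ∂μ

/-- The correlation for the image under `log |·|` of the measure `dy / |y|`. -/
def logCorr (φ φ' : ℝ → ℂ) (s : ℝ) : ℂ :=
  ∫ u : K, φ (s + lg k u) * φ' (lg k u) * ((absv k u)⁻¹ : ℝ) ∂μ

/-- The transform of `χ(y)⁻¹ |y| ^ (-1/2) φ(log |y|)` is given by an integral and is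
`O(1 / |x|)`. -/
structure IsAdmissible (χ : Kˣ →ₜ* Circle) (φ : ℝ → ℂ) : Prop where
  measurable : Measurable φ
  integrable : Integrable (profile k χ φ) μ
  memLp : MemLp (profile k χ φ) 2 μ
  decay : ∃ C : ℝ, ∀ x : K,
    absv k x * ‖∫ y, profile k χ φ y * addCharTr ψ (-(x * y)) ∂μ‖ ≤ C

/-- The properties of a class `Φ` of functions of `log |y|` that correspond to functions of class
`Sch` under the Mellin transform. -/
structure IsProfileClass (Sch Φ : (ℝ → ℂ) → Prop) : Prop where
  sch_add : ∀ f g, Sch f → Sch g → Sch (f + g)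
  sch_smul : ∀ (c : ℂ) f, Sch f → Sch (c • f)
  sch_mul : ∀ f g, Sch f → Sch g → Sch (f * g)
  measurable : ∀ φ, Φ φ → Measurable φ
  integrable : ∀ φ, Φ φ → Integrable (fun y : K => φ (lg k y) * ((absv k y)⁻¹ : ℝ)) μ
  bounded : ∀ φ, Φ φ → ∃ C : ℝ, ∀ y : K, y ≠ 0 → ‖φ (lg k y)‖ ≤ C
  id_mul : ∀ φ, Φ φ → Φ fun s => s * φ s
  exp_mul : ∀ (t : ℝ) φ, Φ φ → Φ fun s => Complex.exp (t * s * Complex.I) * φ s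
  conj : ∀ φ, Φ φ → Φ fun s => (starRingEnd ℂ) (φ s)
  gaussian : Φ fun s => (Real.exp (-s ^ 2) : ℂ)
  -- The bound on κ is the one satisfied by the transform of an admissible profile: boundedness
  -- gives it for |y| ≤ 1, the decay O(1/|x|) for |y| ≥ 1.
  correlation : ∀ κ φ, Φ φ → Measurable κ →
    (∃ C : ℝ, ∀ y : K, y ≠ 0 → ‖κ (lg k y)‖ ≤ C * Real.exp (-|lg k y| / 2)) →
    Φ (logCorr k μ κ φ)
  sch_logMellin : ∀ φ, Φ φ → Sch (logMellin k μ φ)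
  -- Stated for Mellin duals of actual functions rather than for all of `Sch`: at a finite place
  -- `Sch` does not include periodicity in τ, which is supplied by f.
  exists_logMellin_eq : ∀ (f : Lp ℂ 2 μ) (χ : Kˣ →ₜ* Circle),
    Integrable (fun y => f y * (wt k y : ℂ)) μ → Sch (mellin k f χ) →
    ∃ φ, Φ φ ∧ ∀ τ, mellin k f χ τ = logMellin k μ φ τ
  -- The two terms accommodate a parametrix together with its error. A single kernel would suffice
  -- at a finite place.
  exists_decomposition : ∀ φ (χ : Kˣ →ₜ* Circle), Φ φ → ∃ κ₁ φ₁ κ₂ φ₂,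
    (IsAdmissible k μ ψ χ κ₁ ∧ Φ φ₁) ∧ (IsAdmissible k μ ψ χ κ₂ ∧ Φ φ₂) ∧
    ∀ y : K, y ≠ 0 → φ (lg k y) = logConv k μ κ₁ φ₁ (lg k y) + logConv k μ κ₂ φ₂ (lg k y)

variable {k μ ψ}

theorem profile_mul [FiniteDimensional k K] (χ : Kˣ →ₜ* Circle) (φ : ℝ → ℂ) {a y : K} (ha : a ≠ 0)
    (hy : y ≠ 0) :
    profile k χ φ (a * y) = extChar χ⁻¹ a * wt k a * profile k χ (fun s => φ (lg k a + s)) y := by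
  rw [profile, profile, extChar_mul, wt_mul, lg_mul k ha hy]
  push_cast
  ring

variable [BorelSpace K] [FiniteDimensional k K] (P : IsPlace k K μ ψ)
include P

theorem IsPlace.measurable_profile (χ : Kˣ →ₜ* Circle) {φ : ℝ → ℂ} (hφ : Measurable φ) :
    Measurable (profile k χ φ : K → ℂ) :=
  ((measurable_extChar χ⁻¹).mul (Complex.measurable_ofReal.comp P.measurable_wt)).mul
    (hφ.comp P.measurable_lg)

/-! ### The Mellin transform -/

theorem IsPlace.integrable_mellin {f : K → ℂ} (hf : Integrable (fun y => f y * (wt k y : ℂ)) μ)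
    (χ : Kˣ →ₜ* Circle) (τ : ℝ) : Integrable (fun y =>
      f y * wt k y * (extChar χ y * Complex.exp (τ * lg k y * Complex.I))) μ := by
  refine hf.mul_bdd (c := 1) ?_ (Filter.Eventually.of_forall fun y => ?_)
  · refine ((measurable_extChar χ).mul ?_).aestronglyMeasurable
    exact Complex.measurable_exp.comp ((measurable_const.mul
      (Complex.measurable_ofReal.comp P.measurable_lg)).mul_const _)
  · rw [norm_mul, ← Complex.ofReal_mul, Complex.norm_exp_ofReal_mul_I, mul_one]
    exact norm_extChar_le χ y

theorem IsPlace.mellin_add {f g : Lp ℂ 2 μ} (hf : Integrable (fun y => f y * (wt k y : ℂ)) μ)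
    (hg : Integrable (fun y => g y * (wt k y : ℂ)) μ) (χ : Kˣ →ₜ* Circle) :
    mellin k (f + g) χ = mellin k f χ + mellin k g χ := by
  ext τ
  rw [Pi.add_apply, mellin_eq_integral, mellin_eq_integral, mellin_eq_integral,
    ← integral_add (P.integrable_mellin hf χ τ) (P.integrable_mellin hg χ τ)]
  refine integral_congr_ae ?_
  filter_upwards [Lp.coeFn_add f g] with y hy
  rw [hy, Pi.add_apply]
  ring

theorem IsPlace.mellin_smul (c : ℂ) (f : Lp ℂ 2 μ) (χ : Kˣ →ₜ* Circle) :
    mellin k (c • f) χ = c • mellin k f χ := by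
  ext τ
  rw [Pi.smul_apply, mellin_eq_integral, mellin_eq_integral, smul_eq_mul, ← integral_const_mul]
  refine integral_congr_ae ?_
  filter_upwards [Lp.coeFn_smul c f] with y hy
  rw [hy, Pi.smul_apply, smul_eq_mul]
  ring

theorem IsPlace.mellin_twist (f : Lp ℂ 2 μ) (χ : Kˣ →ₜ* Circle) (t τ : ℝ) :
    mellin k f (twist k P.continuous_absv χ t) τ = mellin k f χ (τ + t) := by
  rw [mellin_eq_integral, mellin_eq_integral]
  refine integral_congr_ae (Filter.Eventually.of_forall fun y => ?_)
  simp only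
  rw [extChar_twist, mul_assoc (extChar χ y), ← Complex.exp_add]
  push_cast
  ring_nf

/-- The values at τ = 0 for all χ are the integrals of f|y|^(-1/2) against every unitary character,
and these determine it. -/
theorem IsPlace.eq_zero_of_mellin [CompleteSpace K] [SecondCountableTopology K] {f : Lp ℂ 2 μ}
    (hf : Integrable (fun y => f y * (wt k y : ℂ)) μ) (h : ∀ χ τ, mellin k f χ τ = 0) : f = 0 := by
  have h1 := P.ae_eq_zero_of_forall_integral_char hf fun χ => by
    rw [← h χ 0, mellin_eq_integral]
    simp
  refine Lp.ext ?_
  filter_upwards [h1, P.ae_ne_zero, Lp.coeFn_zero ℂ 2 μ] with y h2 h3 h4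
  rw [h4]
  exact (mul_eq_zero.1 h2).resolve_right (by exact_mod_cast (wt_pos k h3).ne')

theorem IsPlace.mellin_profile_twist {χ : Kˣ →ₜ* Circle} {φ : ℝ → ℂ}
    (h2 : MemLp (profile k χ φ) 2 μ) (t τ : ℝ) :
    mellin k h2.toLp (twist k P.continuous_absv χ t) τ = logMellin k μ φ (τ + t) := by
  rw [P.mellin_twist, mellin_eq_integral]
  refine integral_congr_ae ?_
  filter_upwards [h2.coeFn_toLp, P.ae_ne_zero] with y hy hy0
  rw [hy, profile, ← wt_sq]
  push_cast
  linear_combination (↑(wt k y) ^ 2 * φ (lg k y) *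
    Complex.exp ((τ + t) * lg k y * Complex.I)) * extChar_inv_mul χ hy0

/-- Orthogonality of characters. On distinct components χ and χ' differ at some u with |u| = 1, and
the substitution y ↦ uy multiplies the integral by χ(u)⁻¹χ'(u) ≠ 1. -/
theorem IsPlace.mellin_profile_eq_zero {χ χ' : Kˣ →ₜ* Circle} {φ : ℝ → ℂ}
    (h2 : MemLp (profile k χ φ) 2 μ) (h : ¬ SameComponent k χ χ') (τ : ℝ) :
    mellin k h2.toLp χ' τ = 0 := by
  obtain ⟨u, hu, hχ⟩ : ∃ u : Kˣ, absv k (u : K) = 1 ∧ χ u ≠ χ' u := by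
    by_contra! H
    exact h (P.sameComponent χ χ' H)
  have hu0 : (u : K) ≠ 0 := u.ne_zero
  have hw : wt k (u : K) = 1 := by rw [wt, hu, Real.one_rpow]
  have hl : lg k (u : K) = 0 := by rw [lg, hu, Real.log_one]
  set g : K → ℂ := fun y => profile k χ φ y * wt k y *
    (extChar χ' y * Complex.exp (τ * lg k y * Complex.I)) with hg
  have h1 : mellin k h2.toLp χ' τ = ∫ y, g y ∂μ := by
    rw [mellin_eq_integral]
    refine integral_congr_ae ?_
    filter_upwards [h2.coeFn_toLp] with y hy
    rw [hy]
  have h3 := P.integral_mul_left g hu0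
  rw [hu, inv_one, Complex.ofReal_one, one_mul] at h3
  have h4 : ∫ y, g (u * y) ∂μ = extChar χ⁻¹ u * extChar χ' u * ∫ y, g y ∂μ := by
    rw [← integral_const_mul]
    refine integral_congr_ae (P.ae_ne_zero.mono fun y hy => ?_)
    simp only [hg]
    rw [profile_mul χ φ hu0 hy, wt_mul, hw, hl, extChar_mul, lg_mul k hu0 hy, hl]
    simp only [zero_add, Complex.ofReal_one]
    ring_nf
  rw [h1]
  by_contra h5
  have h6 := mul_right_cancel₀ h5 (h4.symm.trans h3 |>.trans (one_mul _).symm)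
  have h7 : extChar χ' (u : K) = extChar χ u := by
    linear_combination extChar χ u * h6 - extChar χ' u * extChar_inv_mul χ hu0
  rw [extChar_coe, extChar_coe] at h7
  exact hχ (Subtype.ext h7.symm)

end Profile

section Domain

set_option linter.unusedSectionVars false

variable {k : Type*} [NormedField k] {K : Type*} [NormedField K] [NormedAlgebra k K]
  [MeasurableSpace K] {μ : Measure K} {ψ : k → ℂ} {Sch Φ : (ℝ → ℂ) → Prop}
  [BorelSpace K] [FiniteDimensional k K] (P : IsPlace k K μ ψ) (Q : IsProfileClass k μ ψ Sch Φ)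

include P Q

/-! ### The domain is spanned by profiles -/

/-- The squared modulus is |φ|²/|y|, at most a bound of φ times the integrable |φ|/|y|. -/
theorem IsProfileClass.memLp_profile (χ : Kˣ →ₜ* Circle) {φ : ℝ → ℂ} (hφ : Φ φ) :
    MemLp (profile k χ φ) 2 μ := by
  obtain ⟨C, hC⟩ := Q.bounded φ hφ
  have hm := P.measurable_profile χ (Q.measurable φ hφ)
  rw [memLp_two_iff_integrable_sq_norm hm.aestronglyMeasurable]
  refine ((Q.integrable φ hφ).norm.const_mul C).mono (hm.norm.pow_const 2).aestronglyMeasurable ?_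
  filter_upwards [P.ae_ne_zero] with y hy
  have h1 : ‖extChar χ⁻¹ y‖ = 1 := norm_extChar _ hy
  have h2 := hC y hy
  have h3 := wt_sq k y
  have h4 := absv_nonneg k y
  simp only [profile, norm_mul, h1, one_mul, Complex.norm_real, norm_norm, norm_pow,
    Real.norm_of_nonneg (inv_nonneg.2 h4), Real.norm_of_nonneg (wt_nonneg k y), mul_pow, h3,
    Real.norm_of_nonneg ((norm_nonneg _).trans h2)]
  have : 0 ≤ ‖φ (lg k y)‖ * (absv k y)⁻¹ := by positivity
  nlinarith

theorem IsProfileClass.integrable_profile_wt (χ : Kˣ →ₜ* Circle) {φ : ℝ → ℂ} (hφ : Φ φ) :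
    Integrable (fun y => profile k χ φ y * (wt k y : ℂ)) μ := by
  refine ((Q.integrable φ hφ).mul_bdd (c := 1) (measurable_extChar χ⁻¹).aestronglyMeasurable
    (Filter.Eventually.of_forall fun y => norm_extChar_le _ y)).congr
    (Filter.Eventually.of_forall fun y => ?_)
  simp only [profile]
  rw [← wt_sq]
  push_cast
  ring

variable (k μ) in
/-- The square integrable function `χ(y)⁻¹ |y| ^ (-1/2) φ(log |y|)`. -/
def IsProfileClass.profileLp (χ : Kˣ →ₜ* Circle) (φ : {φ // Φ φ}) : Lp ℂ 2 μ :=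
  (Q.memLp_profile P χ φ.2).toLp

theorem IsProfileClass.coeFn_profileLp (χ : Kˣ →ₜ* Circle) (φ : {φ // Φ φ}) :
    Q.profileLp k μ P χ φ =ᵐ[μ] profile k χ φ.1 := MemLp.coeFn_toLp _

theorem IsProfileClass.sch_zero : Sch fun _ => 0 := by
  have h := Q.sch_smul 0 _ (Q.sch_logMellin _ Q.gaussian)
  rw [zero_smul] at h
  exact h

/-- On the component of χ, passing from χ to χ|·|^(it) translates the Mellin dual by t, which
amounts to multiplying φ by exp(its). On all other components the dual vanishes. -/
theorem IsProfileClass.profileLp_mem (χ : Kˣ →ₜ* Circle) (φ : {φ // Φ φ}) :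
    HasSchwartzMellinDual k Sch (Q.profileLp k μ P χ φ) := by
  refine ⟨?_, fun χ' => ?_, {χ}, fun χ' h τ => ?_⟩
  · refine (Q.integrable_profile_wt P χ φ.2).congr ?_
    filter_upwards [Q.coeFn_profileLp P χ φ] with y hy
    rw [hy]
    rfl
  · by_cases h : SameComponent k χ χ'
    · obtain ⟨t, rfl⟩ := (sameComponent_iff k P.continuous_absv χ χ').1 h
      refine (congrArg Sch (funext fun τ => ?_)).mpr (Q.sch_logMellin _ (Q.exp_mul t φ.1 φ.2))
      rw [profileLp, P.mellin_profile_twist]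
      refine integral_congr_ae (Filter.Eventually.of_forall fun y => ?_)
      simp only [Complex.ofReal_add, add_mul, Complex.exp_add]
      ring
    · refine (congrArg Sch (funext fun τ => ?_)).mpr (Q.sch_zero P)
      exact P.mellin_profile_eq_zero _ h τ
  · exact P.mellin_profile_eq_zero _ (h χ (Finset.mem_singleton_self _)) τ

variable (k μ) in
/-- The subspace of functions with Schwartz Mellin dual. -/
def IsProfileClass.domain : Submodule ℂ (Lp ℂ 2 μ) where
  carrier := {f | HasSchwartzMellinDual k Sch f}
  zero_mem' := by
    have h := Q.profileLp_mem P (1 : Kˣ →ₜ* Circle) ⟨_, Q.gaussian⟩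
    obtain ⟨-, h2, h3⟩ := h
    have h0 : ∀ χ : Kˣ →ₜ* Circle, mellin k (0 : Lp ℂ 2 μ) χ = fun _ => 0 := fun χ => by
      rw [← zero_smul ℂ (0 : Lp ℂ 2 μ), P.mellin_smul, zero_smul]
      rfl
    refine ⟨?_, fun χ => ?_, ∅, fun χ _ τ => ?_⟩
    · refine (integrable_zero K ℂ μ).congr ?_
      filter_upwards [Lp.coeFn_zero ℂ 2 μ] with y hy
      rw [hy, Pi.zero_apply, zero_mul]
    · rw [h0]
      exact Q.sch_zero P
    · rw [h0]
  add_mem' := fun {f g} hf hg => by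
    classical
    obtain ⟨hf1, hf2, S, hS⟩ := hf
    obtain ⟨hg1, hg2, S', hS'⟩ := hg
    have h1 := P.mellin_add hf1 hg1
    refine ⟨?_, fun χ => ?_, S ∪ S', fun χ h τ => ?_⟩
    · refine (hf1.add hg1).congr ?_
      filter_upwards [Lp.coeFn_add f g] with y hy
      rw [hy, Pi.add_apply, Pi.add_apply, add_mul]
    · rw [h1]
      exact Q.sch_add _ _ (hf2 χ) (hg2 χ)
    · rw [h1, Pi.add_apply, hS χ fun χ₀ h₀ => h χ₀ (Finset.mem_union_left _ h₀),
        hS' χ fun χ₀ h₀ => h χ₀ (Finset.mem_union_right _ h₀), add_zero]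
  smul_mem' := fun c f hf => by
    obtain ⟨hf1, hf2, S, hS⟩ := hf
    refine ⟨?_, fun χ => ?_, S, fun χ h τ => ?_⟩
    · refine (hf1.const_mul c).congr ?_
      filter_upwards [Lp.coeFn_smul c f] with y hy
      rw [hy, Pi.smul_apply, smul_eq_mul, mul_assoc]
    · rw [P.mellin_smul]
      exact Q.sch_smul _ _ (hf2 χ)
    · rw [P.mellin_smul, Pi.smul_apply, hS χ h τ, smul_zero]

variable (k K) in
/-- The components of the group of unitary characters. -/
def componentSetoid (hc : Continuous (absv k : K → ℝ)) : Setoid (Kˣ →ₜ* Circle) where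
  r χ χ' := ∃ t, χ' = twist k hc χ t
  iseqv := by
    have h0 : ∀ χ : Kˣ →ₜ* Circle, twist k hc χ 0 = χ := fun χ => by
      ext u
      change ((χ u * Circle.exp (0 * lg k (u : K)) : Circle) : ℂ) = _
      rw [zero_mul, Circle.exp_zero, mul_one]
    have ha : ∀ (χ : Kˣ →ₜ* Circle) s t, twist k hc (twist k hc χ s) t = twist k hc χ (s + t) :=
      fun χ s t => by
        ext u
        change ((χ u * Circle.exp (s * lg k (u : K)) * Circle.exp (t * lg k (u : K)) : Circle) : ℂ)
          = ((χ u * Circle.exp ((s + t) * lg k (u : K)) : Circle) : ℂ)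
        rw [add_mul, Circle.exp_add, mul_assoc]
    refine ⟨fun χ => ⟨0, (h0 χ).symm⟩, ?_, ?_⟩
    · rintro χ _ ⟨t, rfl⟩
      exact ⟨-t, by rw [ha, add_neg_cancel, h0]⟩
    · rintro χ _ _ ⟨t, rfl⟩ ⟨s, rfl⟩
      exact ⟨t + s, ha _ _ _⟩

variable [CompleteSpace K] [SecondCountableTopology K]

/-- Subtract from f one profile for each component that its Mellin dual may meet, chosen with the
same dual there. The difference has zero Mellin dual everywhere, hence is zero. -/
theorem IsProfileClass.domain_eq_span : Q.domain k μ P =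
    Submodule.span ℂ {f | ∃ χ φ, f = Q.profileLp k μ P χ φ} := by
  classical
  refine le_antisymm (fun f hf => ?_) (Submodule.span_le.2 ?_)
  swap
  · rintro _ ⟨χ, φ, rfl⟩
    exact Q.profileLp_mem P χ φ
  have hf' := hf
  obtain ⟨hf1, hf2, S, hS⟩ := hf
  let r := componentSetoid k K P.continuous_absv
  -- S may contain several characters of one component. Passing to representatives prevents a
  -- component from being subtracted twice.
  let rep : (Kˣ →ₜ* Circle) → (Kˣ →ₜ* Circle) := fun χ => (Quotient.mk r χ).out
  have hrep : ∀ χ, r (rep χ) χ := fun χ => Quotient.mk_out χ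
  have hrep' : ∀ χ χ', r χ χ' → rep χ = rep χ' := fun χ χ' h =>
    congrArg Quotient.out (Quotient.sound h)
  choose φ hφ hφ' using fun χ => Q.exists_logMellin_eq f χ hf1 (hf2 χ)
  have hsame : ∀ χ χ', SameComponent k χ χ' ↔ r χ χ' := fun χ χ' =>
    sameComponent_iff k P.continuous_absv χ χ'
  have hg : f - ∑ χ ∈ S.image rep, Q.profileLp k μ P χ ⟨φ χ, hφ χ⟩ = 0 := by
    have hsum : ∀ T : Finset (Kˣ →ₜ* Circle),
        HasSchwartzMellinDual k Sch (∑ χ ∈ T, Q.profileLp k μ P χ ⟨φ χ, hφ χ⟩) ∧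
        ∀ χ' τ, mellin k (∑ χ ∈ T, Q.profileLp k μ P χ ⟨φ χ, hφ χ⟩) χ' τ
          = ∑ χ ∈ T, mellin k (Q.profileLp k μ P χ ⟨φ χ, hφ χ⟩) χ' τ := by
      intro T
      induction T using Finset.induction_on with
      | empty =>
        refine ⟨(Q.domain k μ P).zero_mem, fun χ' τ => ?_⟩
        rw [Finset.sum_empty, Finset.sum_empty, ← zero_smul ℂ (0 : Lp ℂ 2 μ), P.mellin_smul,
          zero_smul]
        rfl
      | insert χ T hχ ih =>
        refine ⟨(Q.domain k μ P).sum_mem fun χ _ => Q.profileLp_mem P χ _, fun χ' τ => ?_⟩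
        rw [Finset.sum_insert hχ, Finset.sum_insert hχ,
          P.mellin_add (Q.profileLp_mem P χ _).1 ih.1.1, Pi.add_apply, ih.2]
    have hD : HasSchwartzMellinDual k Sch
        (f - ∑ χ ∈ S.image rep, Q.profileLp k μ P χ ⟨φ χ, hφ χ⟩) :=
      (Q.domain k μ P).sub_mem hf' (hsum _).1
    refine P.eq_zero_of_mellin hD.1 fun χ' τ => ?_
    have hneg : HasSchwartzMellinDual k Sch
        ((-1 : ℂ) • ∑ χ ∈ S.image rep, Q.profileLp k μ P χ ⟨φ χ, hφ χ⟩) :=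
      (Q.domain k μ P).smul_mem _ (hsum _).1
    rw [sub_eq_add_neg, ← neg_one_smul ℂ, P.mellin_add hf1 hneg.1, P.mellin_smul, Pi.add_apply,
      Pi.smul_apply, (hsum _).2, neg_one_smul, ← sub_eq_add_neg, sub_eq_zero]
    have hterm : ∀ χ ∈ S.image rep, χ ≠ rep χ' →
        mellin k (Q.profileLp k μ P χ ⟨φ χ, hφ χ⟩) χ' τ = 0 := by
      intro χ hχ hne
      refine P.mellin_profile_eq_zero _ (fun h => hne ?_) τ
      obtain ⟨χ₁, -, rfl⟩ := Finset.mem_image.1 hχ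
      rw [← hrep' _ _ ((hsame _ _).1 h), hrep' _ _ (hrep χ₁)]
    by_cases hin : rep χ' ∈ S.image rep
    · rw [Finset.sum_eq_single_of_mem _ hin fun χ hχ hne => hterm χ hχ hne]
      obtain ⟨t, ht⟩ := hrep χ'
      have h1 : mellin k f χ' τ = mellin k f (rep χ') (τ + t) := by
        rw [← P.mellin_twist, ← ht]
      have h2 := P.mellin_profile_twist (Q.memLp_profile P (rep χ') (hφ (rep χ'))) t τ
      rw [← ht] at h2
      rw [h1, hφ', profileLp, h2]
    · rw [Finset.sum_eq_zero fun χ hχ => hterm χ hχ fun h => hin (h ▸ hχ)]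
      refine hS χ' (fun χ₀ h₀ h => hin ?_) τ
      rw [← hrep' _ _ ((hsame _ _).1 h)]
      exact Finset.mem_image_of_mem _ h₀
  rw [sub_eq_zero.1 hg]
  exact Submodule.sum_mem _ fun χ _ => Submodule.subset_span ⟨χ, _, rfl⟩

/-- If h is orthogonal to the Gaussian profiles of all characters, then all character integrals of
h|y|^(-1/2) exp(-(log|y|)²) vanish. The weight has no zero outside y = 0, so h = 0. -/
theorem IsProfileClass.dense_domain : Dense (Q.domain k μ P : Set (Lp ℂ 2 μ)) := by
  rw [Submodule.dense_iff_topologicalClosure_eq_top, Submodule.topologicalClosure_eq_top_iff,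
    Submodule.eq_bot_iff]
  intro h hh
  set G : ℝ → ℂ := fun s => (Real.exp (-s ^ 2) : ℂ) with hG
  have hint : Integrable (fun y => h y * (wt k y * G (lg k y))) μ := by
    have h1 := (Q.memLp_profile P 1 Q.gaussian).norm.integrable_mul (Lp.memLp h).norm
    refine h1.mono ((Lp.aestronglyMeasurable h).mul ?_) ?_
    · exact ((Complex.measurable_ofReal.comp P.measurable_wt).mul
        ((Q.measurable _ Q.gaussian).comp P.measurable_lg)).aestronglyMeasurable
    · filter_upwards [P.ae_ne_zero] with y hy
      simp only [Pi.mul_apply, norm_mul, profile, norm_extChar _ hy, one_mul, norm_norm]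
      exact (mul_comm _ _).le
  have h0 := P.ae_eq_zero_of_forall_integral_char hint fun χ => by
    have h1 := (Submodule.mem_orthogonal _ _).1 hh _ (Q.profileLp_mem P χ ⟨G, Q.gaussian⟩)
    rw [← h1, L2.inner_def]
    refine integral_congr_ae ?_
    filter_upwards [Q.coeFn_profileLp P χ ⟨G, Q.gaussian⟩] with y hy
    rw [hy]
    change _ = h y * (starRingEnd ℂ) (profile k χ G y)
    rw [profile, map_mul, map_mul, conj_extChar, inv_inv, Complex.conj_ofReal, hG,
      Complex.conj_ofReal]
    ring
  refine Lp.ext ?_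
  filter_upwards [h0, P.ae_ne_zero, Lp.coeFn_zero ℂ 2 μ] with y h2 h3 h4
  rw [h4]
  refine (mul_eq_zero.1 h2).resolve_right (mul_ne_zero ?_ ?_)
  · exact_mod_cast (wt_pos k h3).ne'
  · exact Complex.ofReal_ne_zero.2 (Real.exp_pos _).ne'

end Domain

/-- The restriction of a partially defined operator to a stable subspace. -/
def StableUnder.toEnd {E : Type*} [AddCommGroup E] [Module ℂ E] {D : Submodule ℂ E}
    {T : E →ₗ.[ℂ] E} (h : StableUnder D T) : Module.End ℂ D where
  toFun f := ⟨T ⟨f, (h f f.2).choose⟩, (h f f.2).choose_spec⟩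
  map_add' f g := by
    apply Subtype.ext
    exact LinearPMap.map_add T ⟨f, (h f f.2).choose⟩ ⟨g, (h g g.2).choose⟩
  map_smul' c f := by
    apply Subtype.ext
    exact LinearPMap.map_smul T c ⟨f, (h f f.2).choose⟩

theorem StableUnder.restrictsTo {E : Type*} [AddCommGroup E] [Module ℂ E] {D : Submodule ℂ E}
    {T : E →ₗ.[ℂ] E} (h : StableUnder D T) : RestrictsTo T h.toEnd :=
  fun f => ⟨(h f f.2).choose, rfl⟩

/-- The vectors of the domain that T sends into the span form a subspace, so it suffices to check
generators. -/
theorem stableUnder_span {E : Type*} [AddCommGroup E] [Module ℂ E] {s : Set E}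
    {T : E →ₗ.[ℂ] E} (h : ∀ f ∈ s, ∃ h : f ∈ T.domain, T ⟨f, h⟩ ∈ Submodule.span ℂ s) :
    StableUnder (Submodule.span ℂ s) T := by
  have h1 : Submodule.span ℂ s ≤
      ((Submodule.span ℂ s).comap T.toFun).map T.domain.subtype := by
    refine Submodule.span_le.2 fun f hf => ?_
    obtain ⟨h1, h2⟩ := h f hf
    exact ⟨⟨f, h1⟩, h2, rfl⟩
  intro f hf
  obtain ⟨g, hg, rfl⟩ := h1 hf
  exact ⟨g.2, hg⟩

/-! ### Stability of the domain under F, its inverse, A and B -/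

section Stability

set_option linter.unusedSectionVars false

variable {k : Type*} [NormedField k] {K : Type*} [NormedField K] [NormedAlgebra k K]
  [MeasurableSpace K] {μ : Measure K} {ψ : k → ℂ} {Sch Φ : (ℝ → ℂ) → Prop}
  {F : Lp ℂ 2 μ ≃ₗᵢ[ℂ] Lp ℂ 2 μ} [BorelSpace K] [FiniteDimensional k K]

omit [MeasurableSpace K] [BorelSpace K] in
theorem wt_eq_exp {y : K} (hy : y ≠ 0) : wt k y = Real.exp (-lg k y / 2) := by
  rw [wt, Real.rpow_def_of_pos (absv_pos k hy), lg]
  ring_nf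

theorem absv_eq_of_lg_eq {x y : K} (hx : x ≠ 0) (hy : y ≠ 0) (h : lg k x = lg k y) :
    absv k x = absv k y := by
  rw [← exp_lg k hx, h, exp_lg k hy]

variable (P : IsPlace k K μ ψ)
include P

/-- The factors χ(u) cancel and the powers of |u| combine to |u|⁻¹, so convolution of two profiles
with the same χ reduces to convolution in log|y|. -/
theorem IsPlace.convolution_profile (χ : Kˣ →ₜ* Circle) (κ φ : ℝ → ℂ) {y : K} (hy : y ≠ 0) :
    ∫ u, profile k χ φ u * wt k u * dilate k u (profile k χ κ) y ∂μ
      = profile k χ (logConv k μ κ φ) y := by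
  rw [profile, logConv, ← integral_const_mul]
  refine integral_congr_ae (P.ae_ne_zero.mono fun u hu => ?_)
  have hw : (wt k u : ℂ) ≠ 0 := by exact_mod_cast (wt_pos k hu).ne'
  have he := extChar_inv_mul χ hu
  simp only
  rw [dilate, profile_mul _ _ (inv_ne_zero hu) hy, wt_inv, extChar_inv, inv_inv, lg_inv, ← wt_sq,
    profile, profile, neg_add_eq_sub]
  push_cast
  field_simp
  linear_combination (φ (lg k u) * extChar χ⁻¹ y * wt k y * κ (lg k y - lg k u)) * he

/-- The same cancellation for the inverse dilations, which requires χ⁻¹ in one factor and yields a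
correlation. -/
theorem IsPlace.convolution_profile' (χ : Kˣ →ₜ* Circle) (κ φ : ℝ → ℂ) {y : K} (hy : y ≠ 0) :
    ∫ u, profile k χ φ u * wt k u * dilate k u⁻¹ (profile k χ⁻¹ κ) y ∂μ
      = profile k χ⁻¹ (logCorr k μ κ φ) y := by
  rw [profile, logCorr, ← integral_const_mul]
  refine integral_congr_ae (P.ae_ne_zero.mono fun u hu => ?_)
  have hw : (wt k u : ℂ) ≠ 0 := by exact_mod_cast (wt_pos k hu).ne'
  have he := extChar_inv_mul χ hu
  simp only
  rw [dilate, inv_inv, profile_mul _ _ hu hy, wt_inv, inv_inv, ← wt_sq,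
    profile, profile, add_comm (lg k u), inv_inv]
  push_cast
  field_simp
  linear_combination (φ (lg k u) * extChar χ y * wt k y * κ (lg k y + lg k u)) * he

variable [SecondCountableTopology K] [SFinite μ]

/-- The transform T satisfies T(vx) = χ(v)T(x) when |v| = 1, so it is a profile for χ⁻¹ whose kernel
is read off along the measurable section. The kernel is |x|^(1/2)T(x) up to a phase. The bound of T
by the L¹ norm controls it for |x| ≤ 1, and the O(1/|x|) bound for |x| ≥ 1. -/
theorem IsAdmissible.exists_kernel (hF : IsFourierTransform ψ F) {χ : Kˣ →ₜ* Circle} {κ : ℝ → ℂ}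
    (hκ : IsAdmissible k μ ψ χ κ) : ∃ κ' : ℝ → ℂ, Measurable κ' ∧
      (∃ C : ℝ, ∀ y : K, y ≠ 0 → ‖κ' (lg k y)‖ ≤ C * Real.exp (-|lg k y| / 2)) ∧
      ∃ h : MemLp (profile k χ⁻¹ κ') 2 μ, F hκ.memLp.toLp = h.toLp := by
  obtain ⟨σ, hσ, hσ'⟩ := P.exists_section
  obtain ⟨C, hC⟩ := hκ.decay
  set T : K → ℂ := fun x => ∫ y, profile k χ κ y * addCharTr ψ (-(x * y)) ∂μ with hT
  have hTm : Measurable T := by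
    have : StronglyMeasurable fun z : K × K =>
        profile k χ κ z.2 * addCharTr ψ (-(z.1 * z.2)) :=
      (((P.measurable_profile χ hκ.measurable).comp measurable_snd).mul
        (P.continuous_char.comp (by fun_prop)).measurable).stronglyMeasurable
    exact this.integral_prod_right'.measurable
  have hT1 : ∀ x, ‖T x‖ ≤ ∫ y, ‖profile k χ κ y‖ ∂μ := fun x => by
    refine (norm_integral_le_integral_norm _).trans (le_of_eq ?_)
    simp only [norm_mul, P.norm_char, mul_one]
  set κ' : ℝ → ℂ := fun s => extChar χ⁻¹ (σ s) * ((wt k (σ s))⁻¹ : ℝ) * T (σ s) with hκ'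
  have hprof : ∀ x : K, x ≠ 0 → profile k χ⁻¹ κ' x = T x := by
    intro x hx
    obtain ⟨ha, hal⟩ := hσ' x hx
    set a := σ (lg k x)
    have hu : x * a⁻¹ ≠ 0 := mul_ne_zero hx (inv_ne_zero ha)
    have hu1 : absv k (x * a⁻¹) = 1 := by
      rw [absv_mul, absv_inv, absv_eq_of_lg_eq ha hx hal, mul_inv_cancel₀ (absv_pos k hx).ne']
    have hw1 : wt k (x * a⁻¹) = 1 := by rw [wt, hu1, Real.one_rpow]
    have hl1 : lg k (x * a⁻¹) = 0 := by rw [lg, hu1, Real.log_one]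
    -- x and a have equal absolute value, so v = xa⁻¹ is a unit. Substituting vy in the integral
    -- brings out χ(v).
    have h1 : T x = extChar χ (x * a⁻¹) * T a := by
      have h2 := P.integral_mul_left
        (fun y => profile k χ κ ((x * a⁻¹)⁻¹ * y) * addCharTr ψ (-(a * y))) hu
      rw [hu1, inv_one, Complex.ofReal_one, one_mul] at h2
      have h3 : T x = ∫ y, profile k χ κ ((x * a⁻¹)⁻¹ * (x * a⁻¹ * y))
          * addCharTr ψ (-(a * (x * a⁻¹ * y))) ∂μ := by
        refine integral_congr_ae (Filter.Eventually.of_forall fun y => ?_)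
        simp only
        rw [inv_mul_cancel_left₀ hu]
        congr 3
        field_simp
      rw [h3, h2, hT, ← integral_const_mul]
      refine integral_congr_ae (P.ae_ne_zero.mono fun y hy => ?_)
      simp only
      rw [profile_mul _ _ (inv_ne_zero hu) hy, wt_inv, hw1, lg_inv, hl1, extChar_inv, inv_inv]
      simp only [neg_zero, zero_add, inv_one, Complex.ofReal_one]
      ring
    have hw : (wt k a : ℂ) ≠ 0 := by exact_mod_cast (wt_pos k ha).ne'
    have hwx : wt k x = wt k a := by rw [wt, wt, absv_eq_of_lg_eq ha hx hal]
    have hκa : κ' (lg k x) = extChar χ⁻¹ a * ((wt k a)⁻¹ : ℝ) * T a := rfl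
    rw [h1, profile, inv_inv, hκa, hwx, extChar_mul, extChar_inv]
    push_cast
    field_simp
  have hae : F hκ.memLp.toLp =ᵐ[μ] profile k χ⁻¹ κ' := by
    have hi : Integrable hκ.memLp.toLp μ := hκ.integrable.congr hκ.memLp.coeFn_toLp.symm
    filter_upwards [hF _ hi, P.ae_ne_zero] with x hx hx0
    rw [hx, hprof x hx0, integral_mul_congr hκ.memLp.coeFn_toLp]
  have hmem : MemLp (profile k χ⁻¹ κ') 2 μ := (memLp_congr_ae hae).1 (Lp.memLp _)
  refine ⟨κ', ?_, ⟨max (∫ y, ‖profile k χ κ y‖ ∂μ) C, fun y hy => ?_⟩, hmem, ?_⟩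
  · exact (((measurable_extChar χ⁻¹).comp hσ).mul
      (Complex.measurable_ofReal.comp (P.measurable_wt.comp hσ).inv)).mul (hTm.comp hσ)
  · obtain ⟨ha, hal⟩ := hσ' y hy
    have h1 := hT1 (σ (lg k y))
    have h2 := hC (σ (lg k y))
    change absv k (σ (lg k y)) * ‖T (σ (lg k y))‖ ≤ C at h2
    rw [← exp_lg k ha] at h2
    have h3 : ‖κ' (lg k y)‖ = Real.exp (lg k y / 2) * ‖T (σ (lg k y))‖ := by
      simp only [hκ', norm_mul, norm_extChar _ ha, one_mul, Complex.norm_real]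
      rw [wt_eq_exp ha, hal, ← Real.exp_neg, Real.norm_of_nonneg (Real.exp_pos _).le]
      ring_nf
    rw [h3]
    rw [hal] at h2
    set s := lg k y
    rcases le_total s 0 with hs | hs
    · rw [abs_of_nonpos hs, neg_neg, mul_comm]
      gcongr
      exact h1.trans (le_max_left _ _)
    · rw [abs_of_nonneg hs]
      calc Real.exp (s / 2) * ‖T (σ s)‖
          = Real.exp (-s / 2) * (Real.exp s * ‖T (σ s)‖) := by
            rw [← mul_assoc, ← Real.exp_add]
            ring_nf
        _ ≤ Real.exp (-s / 2) * max (∫ y, ‖profile k χ κ y‖ ∂μ) C := by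
            gcongr
            exact h2.trans (le_max_right _ _)
        _ = _ := mul_comm _ _
  · refine Lp.ext (hae.trans hmem.coeFn_toLp.symm)

variable (Q : IsProfileClass k μ ψ Sch Φ)
include Q

/-- F turns convolution of the κ-profile by the φ-profile into the same superposition of inverse
dilates of the κ'-profile, that is, into the correlation of κ' with φ. -/
theorem IsProfileClass.fourier_logConv (hF : IsFourierTransform ψ F) {χ : Kˣ →ₜ* Circle}
    {κ φ : ℝ → ℂ} (hκ : IsAdmissible k μ ψ χ κ) (hφ : Φ φ) :
    ∃ h : MemLp (profile k χ (logConv k μ κ φ)) 2 μ, ∃ φ' : {φ // Φ φ},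
      F h.toLp = Q.profileLp k μ P χ⁻¹ φ' := by
  obtain ⟨κ', hm, hd, h2, hFκ⟩ := hκ.exists_kernel P hF
  obtain ⟨h3, h4, h5⟩ := P.fourier_convolution hF (P.measurable_profile χ hκ.measurable)
    (P.measurable_profile χ⁻¹ hm) hκ.memLp h2 hFκ (Q.integrable_profile_wt P χ hφ)
  have h6 : (fun y => ∫ u, profile k χ φ u * wt k u * dilate k u (profile k χ κ) y ∂μ)
      =ᵐ[μ] profile k χ (logConv k μ κ φ) :=
    P.ae_ne_zero.mono fun y hy => P.convolution_profile χ κ φ hy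
  have h7 : (fun y => ∫ u, profile k χ φ u * wt k u * dilate k u⁻¹ (profile k χ⁻¹ κ') y ∂μ)
      =ᵐ[μ] profile k χ⁻¹ (logCorr k μ κ' φ) :=
    P.ae_ne_zero.mono fun y hy => P.convolution_profile' χ κ' φ hy
  have h8 : MemLp (profile k χ (logConv k μ κ φ)) 2 μ := (memLp_congr_ae h6).1 h3
  refine ⟨h8, ⟨_, Q.correlation κ' φ hφ hm hd⟩, ?_⟩
  rw [← MemLp.toLp_congr h3 h8 h6, h5]
  exact MemLp.toLp_congr _ _ h7

variable [CompleteSpace K]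

/-- Each generating profile is a sum of two convolutions with admissible kernels, to which
`IsProfileClass.fourier_logConv` applies. -/
theorem IsProfileClass.fourier_mem (hF : IsFourierTransform ψ F) {f : Lp ℂ 2 μ}
    (hf : f ∈ Q.domain k μ P) : F f ∈ Q.domain k μ P := by
  rw [Q.domain_eq_span P] at hf
  have h : Submodule.span ℂ {f | ∃ χ φ, f = Q.profileLp k μ P χ φ} ≤
      (Q.domain k μ P).comap F.toLinearEquiv.toLinearMap := by
    refine Submodule.span_le.2 ?_
    rintro _ ⟨χ, φ, rfl⟩
    obtain ⟨κ₁, φ₁, κ₂, φ₂, ⟨h1, h2⟩, ⟨h3, h4⟩, h5⟩ := Q.exists_decomposition φ.1 χ φ.2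
    obtain ⟨h6, φ₁', h7⟩ := Q.fourier_logConv P hF h1 h2
    obtain ⟨h8, φ₂', h9⟩ := Q.fourier_logConv P hF h3 h4
    have h10 : Q.profileLp k μ P χ φ = h6.toLp + h8.toLp := by
      refine Lp.ext ?_
      filter_upwards [Q.coeFn_profileLp P χ φ, Lp.coeFn_add h6.toLp h8.toLp, h6.coeFn_toLp,
        h8.coeFn_toLp, P.ae_ne_zero] with y e1 e2 e3 e4 hy
      rw [e1, e2, Pi.add_apply, e3, e4, profile, profile, profile, h5 y hy]
      ring
    change F _ ∈ Q.domain k μ P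
    rw [h10, map_add, h7, h9]
    exact add_mem (Q.profileLp_mem P _ _) (Q.profileLp_mem P _ _)
  exact h hf

/-- Conjugation sends the χ-profile of φ to the χ⁻¹-profile of its conjugate. This carries stability
from F to its inverse. -/
theorem IsProfileClass.star_mem {f : Lp ℂ 2 μ} (hf : f ∈ Q.domain k μ P) :
    star f ∈ Q.domain k μ P := by
  rw [Q.domain_eq_span P] at hf
  induction hf using Submodule.span_induction with
  | mem f hf =>
    obtain ⟨χ, φ, rfl⟩ := hf
    have : star (Q.profileLp k μ P χ φ) = Q.profileLp k μ P χ⁻¹ ⟨_, Q.conj φ.1 φ.2⟩ := by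
      refine Lp.ext ?_
      filter_upwards [Lp.coeFn_star (Q.profileLp k μ P χ φ), Q.coeFn_profileLp P χ φ,
        Q.coeFn_profileLp P χ⁻¹ ⟨_, Q.conj φ.1 φ.2⟩] with y e1 e2 e3
      rw [e1, e3, Pi.star_apply, e2]
      change (starRingEnd ℂ) _ = _
      rw [profile, profile, map_mul, map_mul, conj_extChar, Complex.conj_ofReal]
    rw [this]
    exact Q.profileLp_mem P _ _
  | zero =>
    have : star (0 : Lp ℂ 2 μ) = 0 := by
      refine Lp.ext ?_
      filter_upwards [Lp.coeFn_star (0 : Lp ℂ 2 μ), Lp.coeFn_zero ℂ 2 μ] with y e1 e2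
      rw [e1, Pi.star_apply, e2, Pi.zero_apply, star_zero]
    rw [this]
    exact zero_mem _
  | add f g _ _ hf hg =>
    have : star (f + g) = star f + star g := by
      refine Lp.ext ?_
      filter_upwards [Lp.coeFn_star (f + g), Lp.coeFn_star f, Lp.coeFn_star g,
        Lp.coeFn_add f g, Lp.coeFn_add (star f) (star g)] with y e1 e2 e3 e4 e5
      rw [e1, e5, Pi.star_apply, e4, Pi.add_apply, Pi.add_apply, e2, e3, star_add]
      rfl
    rw [this]
    exact add_mem hf hg
  | smul c f _ hf =>
    have : star (c • f) = star c • star f := by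
      refine Lp.ext ?_
      filter_upwards [Lp.coeFn_star (c • f), Lp.coeFn_star f,
        Lp.coeFn_smul c f, Lp.coeFn_smul (star c) (star f)] with y e1 e2 e3 e4
      rw [e1, e4, Pi.star_apply, e3, Pi.smul_apply, Pi.smul_apply, e2, star_smul]
      rfl
    rw [this]
    exact Submodule.smul_mem _ _ hf

theorem IsProfileClass.fourier_symm_mem (hF : IsFourierTransform ψ F) {f : Lp ℂ 2 μ}
    (hf : f ∈ Q.domain k μ P) : F.symm f ∈ Q.domain k μ P := by
  rw [P.fourier_symm_apply hF]
  exact Q.star_mem P (Q.fourier_mem P hF (Q.star_mem P hf))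

theorem IsProfileClass.stableUnder_opA : StableUnder (Q.domain k μ P) (opA k μ) := by
  rw [Q.domain_eq_span P]
  refine stableUnder_span ?_
  rintro _ ⟨χ, φ, rfl⟩
  have h : (fun y => (Real.log (absv k y) : ℂ) * Q.profileLp k μ P χ φ y)
      =ᵐ[μ] profile k χ fun s => s * φ.1 s := by
    filter_upwards [Q.coeFn_profileLp P χ φ] with y hy
    rw [hy, profile, profile, lg]
    ring
  have h1 := Q.memLp_profile P χ (Q.id_mul φ.1 φ.2)
  have h2 := (memLp_congr_ae h).2 h1
  refine ⟨h2, Submodule.subset_span ⟨χ, ⟨_, Q.id_mul φ.1 φ.2⟩, ?_⟩⟩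
  exact MemLp.toLp_congr h2 h1 h

theorem IsProfileClass.stableUnder_opB (hF : IsFourierTransform ψ F) :
    StableUnder (Q.domain k μ P) (opB k F) := by
  intro f hf
  obtain ⟨h1, h2⟩ := Q.stableUnder_opA P _ (Q.fourier_mem P hF hf)
  exact ⟨h1, Q.fourier_symm_mem P hF h2⟩

end Stability

/-! ### Multipliers of the convolution algebra -/

section Multiplier

variable {V X : Type*} [AddCommGroup V] [Module ℂ V] (M : V →ₗ[ℂ] (X → ℝ → ℂ))

/-- An endomorphism that commutes with convolutions, where `M` is the Mellin transform. -/
def IsMultiplier (T : Module.End ℂ V) : Prop :=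
  ∀ f g c : V, (∀ χ τ, M c χ τ = M f χ τ * M g χ τ) →
    ∀ χ τ, M (T c) χ τ = M (T f) χ τ * M g χ τ

variable {M} (hinj : ∀ f, (∀ χ τ, M f χ τ = 0) → f = 0)
  (hconv : ∀ f g, ∃ c, ∀ χ τ, M c χ τ = M f χ τ * M g χ τ)

include hinj

theorem ext_of_mellin {f g : V} (h : ∀ χ τ, M f χ τ = M g χ τ) : f = g := by
  rw [← sub_eq_zero]
  refine hinj _ fun χ τ => ?_
  rw [map_sub, Pi.sub_apply, Pi.sub_apply, h, sub_self]

include hconv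

/-- For a convolution c = f*g, STc equals both STf*g and Sf*Tg, and TSc equals both TSf*g and Sf*Tg.
Hence STf and TSf agree after multiplication by ĝ, and g can be chosen with ĝ ≠ 0 at any given
point. -/
theorem IsMultiplier.commute (hne : ∀ χ τ, ∃ g, M g χ τ ≠ 0) {S T : Module.End ℂ V}
    (hS : IsMultiplier M S) (hT : IsMultiplier M T) : Commute S T := by
  refine LinearMap.ext fun f => ext_of_mellin hinj fun χ τ => ?_
  obtain ⟨g, hg⟩ := hne χ τ
  obtain ⟨c, hc⟩ := hconv f g
  refine mul_right_cancel₀ hg ?_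
  have hc' : ∀ χ τ, M c χ τ = M g χ τ * M f χ τ := fun χ τ => (hc χ τ).trans (mul_comm _ _)
  have h1 := hS (T f) g (T c) (hT f g c hc) χ τ
  have h2 := hT (S f) g (S c) (hS f g c hc) χ τ
  have h3 := hS f (T g) (T c) (fun χ τ => by rw [hT g f c hc' χ τ, mul_comm]) χ τ
  have h4 := hT g (S f) (S c) (fun χ τ => by rw [hS f g c hc χ τ, mul_comm]) χ τ
  rw [Module.End.mul_apply, Module.End.mul_apply, ← h1, ← h2, h3, h4, mul_comm]

variable {A : Module.End ℂ V}
  (hA : ∀ f χ τ, HasDerivAt (M f χ) (Complex.I * M (A f) χ τ) τ)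
include hA

omit hinj hconv in
-- Leibniz' rule: in the Mellin picture A is -i d/dτ.
theorem mellin_derivation {f g c : V} (hc : ∀ χ τ, M c χ τ = M f χ τ * M g χ τ) (χ : X) (τ : ℝ) :
    M (A c) χ τ = M (A f) χ τ * M g χ τ + M f χ τ * M (A g) χ τ := by
  have h1 := (hA f χ τ).mul (hA g χ τ)
  rw [show M f χ * M g χ = M c χ from funext fun τ => (hc χ τ).symm] at h1
  refine mul_left_cancel₀ Complex.I_ne_zero ((h1.unique (hA c χ τ)).symm.trans ?_)
  ring

/-- A(Tf*g) = ATf*g + Tf*Ag and T(Af*g + f*Ag) = TAf*g + Tf*Ag. The terms with Ag cancel in the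
difference. -/
theorem IsMultiplier.commutator {T : Module.End ℂ V} (hT : IsMultiplier M T) :
    IsMultiplier M (A * T - T * A) := by
  intro f g c hc χ τ
  obtain ⟨c₁, h1⟩ := hconv (A f) g
  obtain ⟨c₂, h2⟩ := hconv f (A g)
  have h3 : A c = c₁ + c₂ := ext_of_mellin hinj fun χ τ => by
    rw [mellin_derivation hA hc, map_add, Pi.add_apply, Pi.add_apply, h1, h2]
  have h4 := mellin_derivation hA (hT f g c hc) χ τ
  simp only [LinearMap.sub_apply, Module.End.mul_apply, map_sub, Pi.sub_apply, h3, map_add,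
    Pi.add_apply, h4, hT _ _ _ h1 χ τ, hT _ _ _ h2 χ τ]
  ring

/-- A + B is a multiplier because the failures of A and of B to commute with convolution by g are
f*Ag and -f*Ag. Repeated brackets with A stay among the multipliers, which commute. -/
theorem commute_ringHigherComm {B F : Module.End ℂ V} {inv : X → X}
    (hne : ∀ χ τ, ∃ g, M g χ τ ≠ 0) (hF : Function.Injective F) (hFB : F * B = A * F)
    (hconvF : ∀ f g, ∃ c, (∀ χ τ, M c χ τ = M f χ τ * M g χ τ) ∧
      ∀ χ τ, M (F c) χ τ = M (F f) χ τ * M g (inv χ) (-τ)) (m n : ℕ) :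
    Commute (ringHigherComm A (A + B) m) (ringHigherComm A (A + B) n) := by
  -- Differentiating the Mellin dual of F c applies A to F c = F B⁻-conjugated data: the first
  -- factor gives F(Bf), and the reflection τ ↦ -τ in the second gives the minus sign. Injectivity
  -- of F returns the identity to c.
  have hB : ∀ {f g c : V}, (∀ χ τ, M c χ τ = M f χ τ * M g χ τ) → ∀ χ τ,
      M (B c) χ τ = M (B f) χ τ * M g χ τ - M f χ τ * M (A g) χ τ := by
    intro f g c hc χ τ
    obtain ⟨c', h1, h2⟩ := hconvF f g
    obtain rfl : c = c' := ext_of_mellin hinj fun χ τ => by rw [hc, h1]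
    obtain ⟨c₁, h3, h4⟩ := hconvF (B f) g
    obtain ⟨c₂, h5, h6⟩ := hconvF f (A g)
    have hFB' : ∀ x, F (B x) = A (F x) := fun x => LinearMap.congr_fun hFB x
    have h7 : B c = c₁ - c₂ := hF <| ext_of_mellin hinj fun χ τ => by
      have h8 := (hA (F f) χ τ).mul ((hA g (inv χ) (-τ)).scomp τ (hasDerivAt_neg τ))
      have h9 : M (F f) χ * (M g (inv χ) ∘ Neg.neg) = M (F c) χ := funext fun τ => (h2 χ τ).symm
      rw [h9] at h8
      refine mul_left_cancel₀ Complex.I_ne_zero ?_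
      rw [hFB', h8.unique (hA (F c) χ τ) |>.symm, map_sub, map_sub, Pi.sub_apply, Pi.sub_apply,
        h4, h6, hFB', Function.comp_apply, neg_one_smul]
      ring
    rw [h7, map_sub, Pi.sub_apply, Pi.sub_apply, h3, h5]
  have h : ∀ m, IsMultiplier M (ringHigherComm A (A + B) m) := by
    intro m
    induction m with
    | zero =>
      intro f g c hc χ τ
      simp only [ringHigherComm, LinearMap.add_apply, map_add, Pi.add_apply,
        mellin_derivation hA hc, hB hc]
      ring
    | succ m ih => exact ih.commutator hinj hconv hA
  exact (h m).commute hinj hconv hne (h n)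

end Multiplier

/-! ### Convolution in the domain and the theorem under the abstract hypotheses -/

section Core

set_option linter.unusedSectionVars false

variable {k : Type*} [NormedField k] {K : Type*} [NormedField K] [NormedAlgebra k K]
  [MeasurableSpace K] {μ : Measure K} {ψ : k → ℂ} {Sch Φ : (ℝ → ℂ) → Prop}
  {F : Lp ℂ 2 μ ≃ₗᵢ[ℂ] Lp ℂ 2 μ} [BorelSpace K] [FiniteDimensional k K]
  [SecondCountableTopology K] [SFinite μ] (P : IsPlace k K μ ψ)
include P

/-- Fubini and the scaling of the measure. Taking a(u) = u handles the convolution of f and g,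
taking a(u) = u⁻¹ handles its Fourier transform. -/
theorem IsPlace.integral_convolution_extChar {f h : K → ℂ} {a : K → K} (ha : Measurable a)
    (ha0 : ∀ u, u ≠ 0 → a u ≠ 0) (hfm : Measurable f) (hf : Integrable f μ) (hh : Integrable h μ) :
    Integrable (fun y => ∫ u, h u * (((absv k (a u))⁻¹ : ℝ) * f ((a u)⁻¹ * y)) ∂μ) μ ∧
    ∀ χ : Kˣ →ₜ* Circle,
      ∫ y, (∫ u, h u * (((absv k (a u))⁻¹ : ℝ) * f ((a u)⁻¹ * y)) ∂μ) * extChar χ y ∂μ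
        = (∫ y, f y * extChar χ y ∂μ) * ∫ u, h u * extChar χ (a u) ∂μ := by
  have hm : AEStronglyMeasurable
      (fun z : K × K => h z.2 * (((absv k (a z.2))⁻¹ : ℝ) * f ((a z.2)⁻¹ * z.1))) (μ.prod μ) := by
    refine hh.1.comp_snd.mul (Measurable.aestronglyMeasurable ?_)
    refine (Complex.measurable_ofReal.comp ?_).mul (hfm.comp ?_)
    · exact (P.measurable_absv.comp (ha.comp measurable_snd)).inv
    · exact (ha.comp measurable_snd).inv.mul measurable_fst
  have hint : Integrable
      (fun z : K × K => h z.2 * (((absv k (a z.2))⁻¹ : ℝ) * f ((a z.2)⁻¹ * z.1))) (μ.prod μ) := by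
    refine ⟨hm, ?_⟩
    rw [HasFiniteIntegral, lintegral_prod_symm _ hm.enorm]
    calc ∫⁻ u, ∫⁻ y, ‖h u * (((absv k (a u))⁻¹ : ℝ) * f ((a u)⁻¹ * y))‖ₑ ∂μ ∂μ
        = ∫⁻ u, ‖h u‖ₑ * ∫⁻ y, ‖f y‖ₑ ∂μ ∂μ := by
          refine lintegral_congr_ae (P.ae_ne_zero.mono fun u hu => ?_)
          have h1 := absv_pos k (ha0 u hu)
          have h2 : ‖(((absv k (a u))⁻¹ : ℝ) : ℂ)‖ₑ = ENNReal.ofReal (absv k (a u))⁻¹ := by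
            rw [← ofReal_norm, Complex.norm_real, Real.norm_of_nonneg (inv_nonneg.2 h1.le)]
          simp only [enorm_mul]
          rw [lintegral_const_mul' _ _ enorm_ne_top, lintegral_const_mul' _ _ enorm_ne_top,
            P.lintegral_mul_left (fun y => ‖f y‖ₑ) (inv_ne_zero (ha0 u hu)), absv_inv, inv_inv, h2,
            ← mul_assoc (ENNReal.ofReal _), ← ENNReal.ofReal_mul (inv_nonneg.2 h1.le),
            inv_mul_cancel₀ h1.ne', ENNReal.ofReal_one, one_mul]
      _ < ⊤ := by
          have h1 : ∫⁻ u, ‖h u‖ₑ ∂μ < ⊤ := hh.2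
          have h2 : ∫⁻ u, ‖f u‖ₑ ∂μ < ⊤ := hf.2
          rw [lintegral_mul_const' _ _ h2.ne]
          finiteness
  refine ⟨hint.integral_prod_left, fun χ => ?_⟩
  have hint2 : Integrable (fun z : K × K => h z.2 * (((absv k (a z.2))⁻¹ : ℝ) *
      f ((a z.2)⁻¹ * z.1)) * extChar χ z.1) (μ.prod μ) :=
    hint.mul_bdd (c := 1) ((measurable_extChar χ).comp measurable_fst).aestronglyMeasurable
      (Filter.Eventually.of_forall fun z => norm_extChar_le χ _)
  conv_lhs => simp only [← integral_mul_const]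
  rw [integral_integral_swap hint2, ← integral_const_mul]
  refine integral_congr_ae (P.ae_ne_zero.mono fun u hu => ?_)
  have h1 := (absv_pos k (ha0 u hu)).ne'
  have h2 := P.integral_mul_left (fun y => f y * extChar χ y) (inv_ne_zero (ha0 u hu))
  rw [absv_inv, inv_inv] at h2
  have h3 : ((absv k (a u) : ℝ) : ℂ) ≠ 0 := by exact_mod_cast h1
  have h4 := extChar_inv_mul χ (ha0 u hu)
  calc ∫ y, h u * (((absv k (a u))⁻¹ : ℝ) * f ((a u)⁻¹ * y)) * extChar χ y ∂μ
      = ∫ y, h u * ((absv k (a u))⁻¹ : ℝ) * extChar χ (a u) *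
          (f ((a u)⁻¹ * y) * extChar χ ((a u)⁻¹ * y)) ∂μ := by
        refine integral_congr_ae (Filter.Eventually.of_forall fun y => ?_)
        simp only
        rw [extChar_mul, extChar_inv]
        linear_combination -(h u * (((absv k (a u))⁻¹ : ℝ) * f ((a u)⁻¹ * y)) * extChar χ y) * h4
    _ = _ := by
        rw [integral_const_mul, h2]
        push_cast
        field_simp

theorem IsPlace.twist_inv (χ : Kˣ →ₜ* Circle) (τ : ℝ) :
    (twist k P.continuous_absv χ τ)⁻¹ = twist k P.continuous_absv χ⁻¹ (-τ) := by
  ext u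
  change (((χ u * Circle.exp (τ * lg k (u : K)))⁻¹ : Circle) : ℂ)
    = (((χ u)⁻¹ * Circle.exp (-τ * lg k (u : K)) : Circle) : ℂ)
  rw [mul_inv, neg_mul, Circle.exp_neg]

theorem IsPlace.mellin_eq_mellin_twist (f : Lp ℂ 2 μ) (χ : Kˣ →ₜ* Circle) (τ : ℝ) :
    mellin k f χ τ = ∫ y, f y * wt k y * extChar (twist k P.continuous_absv χ τ) y ∂μ := by
  rw [mellin_eq_integral]
  simp only [extChar_twist]

variable (Q : IsProfileClass k μ ψ Sch Φ) [CompleteSpace K]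
include Q

/-- Convolutions of functions with Schwartz Mellin dual. -/
theorem IsProfileClass.exists_convolution (hF : IsFourierTransform ψ F) {f g : Lp ℂ 2 μ}
    (hf : f ∈ Q.domain k μ P) (hg : g ∈ Q.domain k μ P) : ∃ c ∈ Q.domain k μ P,
      (∀ χ τ, mellin k c χ τ = mellin k f χ τ * mellin k g χ τ) ∧
      ∀ χ τ, mellin k (F c) χ τ = mellin k (F f) χ τ * mellin k g χ⁻¹ (-τ) := by
  have hFf := Q.fourier_mem P hF hf
  obtain ⟨hf1, hf2, S, hS⟩ := hf
  obtain ⟨hg1, hg2, -⟩ := hg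
  have hfm := (Lp.stronglyMeasurable f).measurable
  have hFm := (Lp.stronglyMeasurable (F f)).measurable
  have hwm := Complex.measurable_ofReal.comp P.measurable_wt
  -- In terms of g(u)|u|^(1/2) and du/|u|, convolution by g is superposition of dilates with density
  -- g(u)|u|^(-1/2) du, integrable by the definition of the domain.
  obtain ⟨h1, h2, h3⟩ := P.fourier_convolution hF hfm hFm (Lp.memLp f) (Lp.memLp (F f))
    (by rw [Lp.toLp_coeFn, Lp.toLp_coeFn]) hg1
  have hw : ∀ u : K, u ≠ 0 → (wt k u : ℂ) ≠ 0 := fun u hu => by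
    exact_mod_cast (wt_pos k hu).ne'
  obtain ⟨i1, m1⟩ := P.integral_convolution_extChar measurable_id (fun u hu => hu)
    (hfm.mul hwm) hf1 hg1
  obtain ⟨i2, m2⟩ := P.integral_convolution_extChar measurable_inv (fun u hu => inv_ne_zero hu)
    (hFm.mul hwm) hFf.1 hg1
  have e1 : (fun y => (h1.toLp : Lp ℂ 2 μ) y * (wt k y : ℂ)) =ᵐ[μ] fun y => ∫ u, g u * (wt k u : ℂ) *
      (((absv k (id u))⁻¹ : ℝ) * (f ((id u)⁻¹ * y) * (wt k ((id u)⁻¹ * y) : ℂ))) ∂μ := by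
    filter_upwards [h1.coeFn_toLp] with y hy
    rw [hy, ← integral_mul_const]
    refine integral_congr_ae (P.ae_ne_zero.mono fun u hu => ?_)
    have := hw u hu
    change g u * (wt k u : ℂ) * _ * _ = _
    simp only [id, dilate]
    rw [wt_mul, wt_inv, ← wt_sq]
    push_cast
    field_simp
  have e2 : (fun y => (h2.toLp : Lp ℂ 2 μ) y * (wt k y : ℂ)) =ᵐ[μ] fun y => ∫ u, g u * (wt k u : ℂ) *
      (((absv k u⁻¹)⁻¹ : ℝ) * (F f (u⁻¹⁻¹ * y) * (wt k (u⁻¹⁻¹ * y) : ℂ))) ∂μ := by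
    filter_upwards [h2.coeFn_toLp] with y hy
    rw [hy, ← integral_mul_const]
    refine integral_congr_ae (P.ae_ne_zero.mono fun u hu => ?_)
    have := hw u hu
    change g u * (wt k u : ℂ) * _ * _ = _
    simp only [dilate]
    rw [← wt_sq, wt_mul, wt_inv, inv_inv]
    push_cast
    field_simp
  have M1 : ∀ χ τ, mellin k h1.toLp χ τ = mellin k f χ τ * mellin k g χ τ := fun χ τ => by
    rw [P.mellin_eq_mellin_twist, P.mellin_eq_mellin_twist, P.mellin_eq_mellin_twist,
      integral_mul_congr e1]
    exact m1 _
  have M2 : ∀ χ τ, mellin k h2.toLp χ τ = mellin k (F f) χ τ * mellin k g χ⁻¹ (-τ) :=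
    fun χ τ => by
    rw [P.mellin_eq_mellin_twist, P.mellin_eq_mellin_twist, P.mellin_eq_mellin_twist,
      integral_mul_congr e2, ← P.twist_inv]
    simp only [← extChar_inv]
    exact m2 _
  refine ⟨h1.toLp, ⟨i1.congr e1.symm, fun χ => ?_, S, fun χ h τ => ?_⟩, M1, h3 ▸ M2⟩
  -- The product stays in the class, and it vanishes on every component where the dual of f does.
  · rw [show mellin k h1.toLp χ = mellin k f χ * mellin k g χ from funext (M1 χ)]
    exact Q.sch_mul _ _ (hf2 χ) (hg2 χ)
  · rw [M1, hS χ h τ, zero_mul]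

/-- Differentiation under the integral sign, dominated by |log|y| f(y)| |y|^(-1/2). This bound is
integrable because A f lies in the domain. -/
theorem IsProfileClass.hasDerivAt_mellin {f : Lp ℂ 2 μ} (hf : f ∈ Q.domain k μ P)
    (χ : Kˣ →ₜ* Circle) (τ : ℝ) : HasDerivAt (mellin k f χ)
      (Complex.I * mellin k ((Q.stableUnder_opA P).toEnd ⟨f, hf⟩ : Lp ℂ 2 μ) χ τ) τ := by
  obtain ⟨h1, h2⟩ := (Q.stableUnder_opA P).restrictsTo ⟨f, hf⟩
  have hg := ((Q.stableUnder_opA P).toEnd ⟨f, hf⟩).2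
  rw [← h2] at hg ⊢
  have hae : opA k μ ⟨f, h1⟩ =ᵐ[μ] fun y => (lg k y : ℂ) * f y := MemLp.coeFn_toLp h1
  have hint : Integrable (fun y => (lg k y : ℂ) * f y * (wt k y : ℂ)) μ :=
    hg.1.congr (hae.mono fun y hy => by simp only [hy]; rfl)
  have hd := (hasDerivAt_integral_of_dominated_loc_of_deriv_le (μ := μ) (x₀ := τ) (s := Set.univ)
    (F := fun (τ : ℝ) y => f y * wt k y * (extChar χ y * Complex.exp (τ * lg k y * Complex.I)))
    (F' := fun (τ : ℝ) y => f y * wt k y * (extChar χ y * (Complex.exp (τ * lg k y * Complex.I) *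
      (lg k y * Complex.I))))
    (bound := fun y => ‖(lg k y : ℂ) * f y * (wt k y : ℂ)‖) Filter.univ_mem
    (Filter.Eventually.of_forall fun τ => (P.integrable_mellin hf.1 χ τ).1)
    (P.integrable_mellin hf.1 χ τ) ?_ ?_ hint.norm ?_).2
  · rw [show mellin k f χ = fun τ : ℝ => ∫ y, f y * wt k y *
      (extChar χ y * Complex.exp (τ * lg k y * Complex.I)) ∂μ from
      funext fun τ => mellin_eq_integral k f χ τ]
    refine hd.congr_deriv ?_
    rw [mellin_eq_integral, ← integral_const_mul]
    refine integral_congr_ae ?_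
    filter_upwards [hae] with y hy
    rw [hy]
    ring
  · have := (P.integrable_mellin (f := fun y => (lg k y : ℂ) * f y) hint χ τ).1.mul_const
      Complex.I
    refine this.congr (Filter.Eventually.of_forall fun y => ?_)
    simp only
    ring
  · refine Filter.Eventually.of_forall fun y τ' _ => ?_
    simp only [norm_mul, Complex.norm_I, mul_one]
    rw [← Complex.ofReal_mul, Complex.norm_exp_ofReal_mul_I, one_mul]
    have := norm_extChar_le χ y
    calc ‖f y‖ * ‖(wt k y : ℂ)‖ * (‖extChar χ y‖ * ‖(lg k y : ℂ)‖)
        ≤ ‖f y‖ * ‖(wt k y : ℂ)‖ * (1 * ‖(lg k y : ℂ)‖) := by gcongr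
      _ = _ := by ring
  · refine Filter.Eventually.of_forall fun y τ' _ => ?_
    have h3 : HasDerivAt (fun τ : ℝ => (τ : ℂ) * lg k y * Complex.I) (lg k y * Complex.I) τ' := by
      have := ((Complex.ofRealCLM.hasDerivAt (x := τ')).mul_const (lg k y : ℂ)).mul_const Complex.I
      simpa using this
    exact (h3.cexp.const_mul _).const_mul _

/-- Modulating the Gaussian by exp(-iτs) cancels the oscillation at the chosen point, leaving the
integral of a positive function. -/
theorem IsProfileClass.exists_mellin_ne_zero (hμ : μ ≠ 0) (χ : Kˣ →ₜ* Circle) (τ : ℝ) :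
    ∃ g ∈ Q.domain k μ P, mellin k g χ τ ≠ 0 := by
  have hg := Q.exp_mul (-τ) _ Q.gaussian
  refine ⟨_, Q.profileLp_mem P χ ⟨_, hg⟩, ?_⟩
  have h1 : mellin k (Q.profileLp k μ P χ ⟨_, hg⟩ : Lp ℂ 2 μ) χ τ
      = ((∫ y : K, Real.exp (-(lg k y) ^ 2) * (absv k y)⁻¹ ∂μ : ℝ) : ℂ) := by
    have h2 := P.mellin_profile_twist (χ := χ) (Q.memLp_profile P χ hg) 0 τ
    rw [P.mellin_twist, add_zero] at h2
    refine h2.trans ?_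
    rw [logMellin, ← integral_complex_ofReal]
    refine integral_congr_ae (Filter.Eventually.of_forall fun y => ?_)
    simp only
    have h3 : Complex.exp (((-τ : ℝ) : ℂ) * lg k y * Complex.I) *
        Complex.exp (τ * lg k y * Complex.I) = 1 := by
      rw [← Complex.exp_add, ← Complex.exp_zero]
      push_cast
      ring_nf
    rw [Complex.ofReal_mul]
    linear_combination ((Real.exp (-lg k y ^ 2) : ℝ) : ℂ) * ((absv k y)⁻¹ : ℝ) * h3
  rw [h1]
  have hi : Integrable (fun y : K => Real.exp (-(lg k y) ^ 2) * (absv k y)⁻¹) μ := by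
    have := (Q.integrable _ Q.gaussian).re
    refine this.congr (Filter.Eventually.of_forall fun y => ?_)
    simp only [← Complex.ofReal_mul]
    exact Complex.ofReal_re _
  have hnn : 0 ≤ fun y : K => Real.exp (-(lg k y) ^ 2) * (absv k y)⁻¹ := fun y =>
    mul_nonneg (Real.exp_pos _).le (inv_nonneg.2 (absv_nonneg k y))
  have hpos := (integral_pos_iff_support_of_nonneg hnn hi).2 ?_
  · exact_mod_cast hpos.ne'
  · rw [pos_iff_ne_zero]
    intro h0
    refine hμ (Measure.measure_univ_eq_zero.1 (measure_mono_null (t := {0} ∪ Function.support _)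
      (fun y _ => ?_) (measure_union_null P.measure_zero h0)))
    rcases eq_or_ne y 0 with rfl | hy
    · exact Or.inl rfl
    · exact Or.inr (mul_pos (Real.exp_pos _) (inv_pos.2 (absv_pos k hy))).ne'

theorem IsProfileClass.hasStableDomain (hμ : μ ≠ 0) (hF : IsFourierTransform ψ F) :
    HasStableDomain ψ Sch μ := by
  set D := Q.domain k μ P with hD
  have sA := Q.stableUnder_opA P
  have sB := Q.stableUnder_opB P hF
  have rA : RestrictsTo (opA k μ) sA.toEnd := sA.restrictsTo
  have rB : RestrictsTo (opB k F) sB.toEnd := sB.restrictsTo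
  let F' : Module.End ℂ D := F.toLinearEquiv.toLinearMap.restrict fun f hf => Q.fourier_mem P hF hf
  let M : D →ₗ[ℂ] ((Kˣ →ₜ* Circle) → ℝ → ℂ) :=
    { toFun := fun f χ => mellin k (f : Lp ℂ 2 μ) χ
      map_add' := fun f g => funext fun χ => P.mellin_add f.2.1 g.2.1 χ
      map_smul' := fun c f => funext fun χ => P.mellin_smul c f χ }
  have hFB : F' * sB.toEnd = sA.toEnd * F' := by
    refine LinearMap.ext fun f => Subtype.ext ?_
    obtain ⟨h1, h2⟩ := rB f
    obtain ⟨h3, h4⟩ := rA (F' f)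
    change F (sB.toEnd f : Lp ℂ 2 μ) = (sA.toEnd (F' f) : Lp ℂ 2 μ)
    rw [← h2, ← h4]
    exact F.apply_symm_apply _
  have hcomm := commute_ringHigherComm (M := M) (A := sA.toEnd) (B := sB.toEnd) (F := F')
    (inv := fun χ => χ⁻¹)
    (fun f h => Subtype.ext (P.eq_zero_of_mellin f.2.1 h))
    (fun f g => by
      obtain ⟨c, hc, h1, -⟩ := Q.exists_convolution P hF f.2 g.2
      exact ⟨⟨c, hc⟩, h1⟩)
    (fun f χ τ => Q.hasDerivAt_mellin P f.2 χ τ)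
    (fun χ τ => by
      obtain ⟨g, hg, h⟩ := Q.exists_mellin_ne_zero P hμ χ τ
      exact ⟨⟨g, hg⟩, h⟩)
    (fun f g h => Subtype.ext (F.injective (congrArg Subtype.val h))) hFB
    (fun f g => by
      obtain ⟨c, hc, h1, h2⟩ := Q.exists_convolution P hF f.2 g.2
      exact ⟨⟨c, hc⟩, h1, h2⟩)
  have rH : RestrictsTo (opH k F) (sA.toEnd + sB.toEnd) := rA.add rB
  have rN := fun N => RestrictsTo.higherComm rA rH N
  have rw' := fun w => RestrictsTo.eval rA rB w
  refine ⟨F, hF, D, fun f => Iff.rfl, Q.dense_domain P, fun f hf => Q.fourier_mem P hF hf, sA, sB,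
    rH.stableUnder, ((rB.opComm rA).smul Complex.I).stableUnder, fun N _ => (rN N).stableUnder,
    fun w hw => ⟨(rw' w).stableUnder, ?_⟩⟩
  rcases CommWord.ringEval_eq hcomm w with rfl | rfl | ⟨-, ε, hε, h⟩
  · exact absurd hw (by decide)
  · exact absurd hw (by decide)
  · refine ⟨ε, hε, fun f hf => ?_⟩
    obtain ⟨h1, h2⟩ := rw' w ⟨f, hf⟩
    obtain ⟨h3, h4⟩ := rN (w.weight - 1) ⟨f, hf⟩
    refine ⟨h1, h3, h2.trans ?_⟩
    rw [h]
    exact congrArg (fun x => ε • x) h4.symm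

end Core

/-! ### The Fourier transform at the archimedean places -/

section ArchimedeanFourier

open FourierTransform SchwartzMap

variable {V : Type*} [NormedAddCommGroup V] [InnerProductSpace ℝ V] [FiniteDimensional ℝ V]
  [MeasurableSpace V] [BorelSpace V]

/-- The L² transform is defined by extension, so it is compared with the integral as a tempered
distribution: both have the same pairing with smooth functions of compact support. -/
theorem coeFn_fourierInv_ae_eq (f : Lp ℂ 2 (volume : Measure V)) (hf : Integrable f) :
    (𝓕⁻ f : Lp ℂ 2 (volume : Measure V)) =ᵐ[volume] (𝓕⁻ (f : V → ℂ) : V → ℂ) := by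
  have hL : Continuous fun p : V × V => (-innerₗ V) p.1 p.2 := by
    exact (continuous_inner (𝕜 := ℝ) (E := V)).neg
  have hc : Continuous (𝓕⁻ (f : V → ℂ) : V → ℂ) :=
    VectorFourier.fourierIntegral_continuous Real.continuous_fourierChar hL hf
  refine ae_eq_of_integral_contDiff_smul_eq
    ((Lp.memLp _).locallyIntegrable one_le_two) hc.locallyIntegrable fun g hg hgc => ?_
  have hg' : ContDiff ℝ ∞ fun x => (g x : ℂ) := Complex.ofRealCLM.contDiff.comp hg
  have hgc' : HasCompactSupport fun x => (g x : ℂ) :=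
    hgc.comp_left (g := fun x : ℝ => (x : ℂ)) Complex.ofReal_zero
  set G : 𝓢(V, ℂ) := hgc'.toSchwartzMap hg' with hG
  have hGx : ∀ x, G x = g x := fun x => rfl
  have h1 := congrArg (fun T : TemperedDistribution V ℂ => T G)
    (Lp.fourierInv_toTemperedDistribution_eq f)
  simp only [TemperedDistribution.fourierInv_apply, Lp.toTemperedDistribution_apply, hGx] at h1
  simp only [← Complex.coe_smul]
  rw [← h1]
  have h2 := VectorFourier.integral_fourierIntegral_smul_eq_flip (L := -innerₗ V)
    Real.continuous_fourierChar hL (G.integrable (μ := volume)) hf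
  -- Symmetry of the pairing makes the transform its own transpose.
  have h3 : (-innerₗ V).flip = -innerₗ V := by
    ext x y
    simp [real_inner_comm]
  rw [h3] at h2
  rw [fourierInv_coe]
  exact h2

/-- With λ(x) = exp(-2πix) the kernel λ(-xy) is exp(2πixy), so the operator is the inverse of the
usual transform. -/
theorem isFourierTransform_real :
    IsFourierTransform realChar (Lp.fourierTransformₗᵢ ℝ ℂ).symm := by
  intro f hf
  refine (coeFn_fourierInv_ae_eq f hf).trans (Filter.Eventually.of_forall fun x => ?_)
  simp only [Real.fourierInv_eq']
  refine integral_congr_ae (Filter.Eventually.of_forall fun y => ?_)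
  simp only [addCharTr, realChar, Algebra.trace_self_apply, smul_eq_mul, RCLike.inner_apply,
    conj_trivial]
  rw [mul_comm]
  congr 2
  push_cast
  ring

/-- Composition with a measure preserving equivalence, as a unitary operator. -/
def compMeasurableEquiv {α β : Type*} [MeasurableSpace α] [MeasurableSpace β] {μ : Measure α}
    {ν : Measure β} (e : α ≃ᵐ β) (he : MeasurePreserving e μ ν) : Lp ℂ 2 ν ≃ₗᵢ[ℂ] Lp ℂ 2 μ :=
  LinearIsometryEquiv.ofSurjective (Lp.compMeasurePreservingₗᵢ ℂ e he) fun g =>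
    ⟨Lp.compMeasurePreservingₗᵢ ℂ e.symm (he.symm e) g, by
      refine Lp.ext ?_
      have h1 := Lp.coeFn_compMeasurePreserving g (he.symm e)
      have h2 := Lp.coeFn_compMeasurePreserving (Lp.compMeasurePreserving e.symm (he.symm e) g) he
      filter_upwards [h2, he.quasiMeasurePreserving.ae h1] with x hx hx'
      refine hx.trans (hx'.trans ?_)
      simp⟩

theorem coeFn_compMeasurableEquiv {α β : Type*} [MeasurableSpace α] [MeasurableSpace β]
    {μ : Measure α} {ν : Measure β} (e : α ≃ᵐ β) (he : MeasurePreserving e μ ν) (f : Lp ℂ 2 ν) :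
    compMeasurableEquiv e he f =ᵐ[μ] f ∘ e :=
  Lp.coeFn_compMeasurePreserving f he

theorem map_smul_volume_complex {c : ℝ} (hc : c ≠ 0) :
    (volume : Measure ℂ).map (fun z => (c : ℂ) * z) = ENNReal.ofReal (c ^ 2)⁻¹ • volume := by
  have h := Measure.map_addHaar_smul (volume : Measure ℂ) hc
  rw [Complex.finrank_real_complex, abs_of_nonneg (by positivity)] at h
  simpa only [Complex.real_smul] using h

/-- Scaling by 2^(-1/2) identifies Lebesgue measure with its double, the self-dual measure for the
trace form of ℂ. -/
theorem measurePreserving_mul_sqrt_two :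
    MeasurePreserving (MeasurableEquiv.mulLeft₀ (((√2)⁻¹ : ℝ) : ℂ) (by simp)) volume
      ((2 : ℝ≥0∞) • volume) := by
  refine ⟨MeasurableEquiv.measurable _, ?_⟩
  rw [MeasurableEquiv.coe_mulLeft₀, map_smul_volume_complex (by simp)]
  congr 1
  rw [inv_pow, inv_inv, Real.sq_sqrt zero_le_two]
  simp

/-- The trace pairing 2Re(xy) becomes the Euclidean inner product after both variables are rescaled
by √2 and one is conjugated. The operator is the Euclidean inverse transform conjugated by these
changes of variable. -/
theorem exists_isFourierTransform_complex :
    ∃ F : Lp ℂ 2 ((2 : ℝ≥0∞) • (volume : Measure ℂ)) ≃ₗᵢ[ℂ] Lp ℂ 2 ((2 : ℝ≥0∞) • volume),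
      IsFourierTransform realChar F := by
  set m := MeasurableEquiv.mulLeft₀ (((√2)⁻¹ : ℝ) : ℂ) (by simp) with hm
  have hpm : MeasurePreserving m volume ((2 : ℝ≥0∞) • volume) := measurePreserving_mul_sqrt_two
  set cj : ℂ ≃ᵐ ℂ := Complex.conjLIE.toHomeomorph.toMeasurableEquiv with hcj
  have hpc : MeasurePreserving (cj.trans m) volume ((2 : ℝ≥0∞) • volume) :=
    hpm.comp Complex.conjLIE.measurePreserving
  refine ⟨((compMeasurableEquiv m hpm).trans (Lp.fourierTransformₗᵢ ℂ ℂ).symm).trans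
    (compMeasurableEquiv (cj.trans m) hpc).symm, fun f hf => ?_⟩
  set h := (compMeasurableEquiv (cj.trans m) hpc).symm
    ((Lp.fourierTransformₗᵢ ℂ ℂ).symm (compMeasurableEquiv m hpm f)) with hh
  have h1 : compMeasurableEquiv (cj.trans m) hpc h
      = (𝓕⁻ (compMeasurableEquiv m hpm f) : Lp ℂ 2 (volume : Measure ℂ)) :=
    LinearIsometryEquiv.apply_symm_apply _ _
  have hfm := coeFn_compMeasurableEquiv m hpm f
  have hi : Integrable (compMeasurableEquiv m hpm f) :=
    ((hpm.integrable_comp_emb m.measurableEmbedding).2 hf).congr hfm.symm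
  have h2 := coeFn_fourierInv_ae_eq _ hi
  rw [← h1] at h2
  have h3 := (coeFn_compMeasurableEquiv (cj.trans m) hpc h).symm.trans h2
  have h4 : ∀ᵐ x ∂((2 : ℝ≥0∞) • (volume : Measure ℂ)),
      h x = 𝓕⁻ (compMeasurableEquiv m hpm f : ℂ → ℂ) ((cj.trans m).symm x) := by
    have := (hpc.symm (cj.trans m)).quasiMeasurePreserving.ae h3
    filter_upwards [this] with x hx
    simpa using hx
  refine h4.mono fun x hx => hx.trans ?_
  beta_reduce
  rw [Real.fourierInv_eq', ← hpm.integral_comp m.measurableEmbedding]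
  refine integral_congr_ae (hfm.mono fun v hv => ?_)
  simp only
  rw [hv, smul_eq_mul, mul_comm]
  have hs : ((√2 : ℝ) : ℂ) * (√2 : ℝ) = 2 := by
    rw [← Complex.ofReal_mul, Real.mul_self_sqrt zero_le_two]
    norm_num
  have h5 : (cj.trans m).symm x = starRingEnd ℂ (√2 * x) := by
    rw [MeasurableEquiv.symm_apply_eq]
    change x = m (starRingEnd ℂ (starRingEnd ℂ (√2 * x)))
    rw [Complex.conj_conj]
    change x = (((√2)⁻¹ : ℝ) : ℂ) * (√2 * x)
    rw [← mul_assoc, ← Complex.ofReal_mul, inv_mul_cancel₀ (by simp)]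
    simp
  have h6 : m v = (((√2)⁻¹ : ℝ) : ℂ) * v := rfl
  rw [h5, addCharTr, realChar, Algebra.trace_complex_apply, Function.comp_apply, h6]
  congr 2
  have h7 : inner ℝ v (starRingEnd ℂ (√2 * x)) = √2 * (v * x).re := by
    rw [Complex.inner]
    simp only [Complex.mul_re, Complex.conj_re, Complex.conj_im, Complex.mul_im, Complex.ofReal_re,
      Complex.ofReal_im]
    ring
  have h8 : (-(x * (((√2)⁻¹ : ℝ) * v))).re = -(√2 / 2 * (v * x).re) := by
    have : ((√2)⁻¹ : ℝ) = √2 / 2 := by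
      rw [inv_eq_one_div, div_eq_div_iff (by simp) two_ne_zero, one_mul, Real.mul_self_sqrt zero_le_two]
    rw [this, ← Complex.re_ofReal_mul, ← Complex.neg_re]
    congr 1
    push_cast
    ring
  rw [h7, h8]
  push_cast
  ring

end ArchimedeanFourier

/-! ### Schwartz functions on the line -/

section SchwartzLine

open SchwartzMap FourierTransform

/-- A class of rapidly decreasing functions that is closed under differentiation consists of
Schwartz functions. -/
theorem schwartzOnLine_of_closed {S : (ℝ → ℂ) → Prop}
    (hd : ∀ φ, S φ → ∃ φ', S φ' ∧ ∀ x, HasDerivAt φ (φ' x) x)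
    (hb : ∀ φ, S φ → ∀ m : ℕ, ∃ C, ∀ x, |x| ^ m * ‖φ x‖ ≤ C) {φ : ℝ → ℂ} (hφ : S φ) :
    SchwartzOnLine φ := by
  have h1 : ∀ n : ℕ, ∀ φ, S φ → S (iteratedDeriv n φ) := by
    intro n
    induction n with
    | zero => intro φ hφ; rwa [iteratedDeriv_zero]
    | succ n ih =>
      intro φ hφ
      obtain ⟨φ', h, h'⟩ := hd φ hφ
      rw [iteratedDeriv_succ', show deriv φ = φ' from funext fun x => (h' x).deriv]
      exact ih φ' h
  have h2 : ContDiff ℝ ∞ φ := contDiff_of_differentiable_iteratedDeriv fun n _ x => by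
    obtain ⟨φ', -, h'⟩ := hd _ (h1 n φ hφ)
    exact (h' x).differentiableAt
  refine ⟨⟨φ, h2, fun m n => ?_⟩, fun x => rfl⟩
  obtain ⟨C, hC⟩ := hb _ (h1 n φ hφ) m
  refine ⟨C, fun x => ?_⟩
  rw [norm_iteratedFDeriv_eq_norm_iteratedDeriv]
  exact hC x

theorem SchwartzOnLine.hasDerivAt {φ : ℝ → ℂ} (h : SchwartzOnLine φ) :
    ∃ φ', SchwartzOnLine φ' ∧ ∀ x, HasDerivAt φ (φ' x) x := by
  obtain ⟨g, hg⟩ := h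
  obtain rfl : φ = g := funext hg
  exact ⟨_, ⟨derivCLM ℂ ℂ g, fun x => rfl⟩, g.hasDerivAt⟩

theorem SchwartzOnLine.decay {φ : ℝ → ℂ} (h : SchwartzOnLine φ) (m : ℕ) :
    ∃ C, ∀ x, |x| ^ m * ‖φ x‖ ≤ C := by
  obtain ⟨g, hg⟩ := h
  obtain rfl : φ = g := funext hg
  obtain ⟨C, -, hC⟩ := g.decay m 0
  refine ⟨C, fun x => ?_⟩
  simpa using hC x

theorem SchwartzOnLine.continuous {φ : ℝ → ℂ} (h : SchwartzOnLine φ) : Continuous φ := by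
  obtain ⟨g, hg⟩ := h
  obtain rfl : φ = g := funext hg
  exact g.continuous

theorem SchwartzOnLine.integrable {φ : ℝ → ℂ} (h : SchwartzOnLine φ) : Integrable φ := by
  obtain ⟨g, hg⟩ := h
  obtain rfl : φ = g := funext hg
  exact g.integrable

theorem SchwartzOnLine.add {φ φ' : ℝ → ℂ} (h : SchwartzOnLine φ) (h' : SchwartzOnLine φ') :
    SchwartzOnLine (φ + φ') := by
  obtain ⟨g, hg⟩ := h
  obtain ⟨g', hg'⟩ := h'
  exact ⟨g + g', fun x => by simp [hg, hg']⟩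

theorem SchwartzOnLine.smul {φ : ℝ → ℂ} (c : ℂ) (h : SchwartzOnLine φ) :
    SchwartzOnLine (c • φ) := by
  obtain ⟨g, hg⟩ := h
  exact ⟨c • g, fun x => by simp [hg]⟩

theorem SchwartzOnLine.mul {φ φ' : ℝ → ℂ} (h : SchwartzOnLine φ) (h' : SchwartzOnLine φ') :
    SchwartzOnLine (φ * φ') := by
  obtain ⟨g, hg⟩ := h
  obtain ⟨g', hg'⟩ := h'
  exact ⟨SchwartzMap.pairing (ContinuousLinearMap.mul ℂ ℂ) g g', fun x => by
    simp [hg, hg', SchwartzMap.pairing_apply_apply]⟩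

theorem SchwartzOnLine.conj {φ : ℝ → ℂ} (h : SchwartzOnLine φ) :
    SchwartzOnLine fun s => (starRingEnd ℂ) (φ s) := by
  obtain ⟨g, hg⟩ := h
  exact ⟨g.postcompCLM Complex.conjCLE.toContinuousLinearMap, fun x => by
    simp [hg]⟩

theorem SchwartzOnLine.id_mul {φ : ℝ → ℂ} (h : SchwartzOnLine φ) :
    SchwartzOnLine fun s => s * φ s := by
  obtain ⟨g, hg⟩ := h
  exact ⟨smulLeftCLM ℂ (fun s : ℝ => (s : ℂ)) g, fun x => by
    rw [smulLeftCLM_apply_apply (by fun_prop), ← hg, smul_eq_mul]⟩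

theorem SchwartzOnLine.comp_mul {φ : ℝ → ℂ} (h : SchwartzOnLine φ) {c : ℝ} (hc : c ≠ 0) :
    SchwartzOnLine fun s => φ (c * s) := by
  obtain ⟨g, hg⟩ := h
  exact ⟨compCLMOfContinuousLinearEquiv ℂ (ContinuousLinearEquiv.smulLeft (Units.mk0 c hc)) g,
    fun x => by simp [hg, Units.smul_def]⟩

/-- The products exp(its)g(s) form a class closed under differentiation, with g replaced by g' +
itg. -/
theorem SchwartzOnLine.exp_mul {φ : ℝ → ℂ} (h : SchwartzOnLine φ) (t : ℝ) :
    SchwartzOnLine fun s => Complex.exp (t * s * Complex.I) * φ s := by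
  refine schwartzOnLine_of_closed
    (S := fun φ => ∃ g, SchwartzOnLine g ∧ φ = fun s : ℝ => Complex.exp (t * s * Complex.I) * g s)
    ?_ ?_ ⟨φ, h, rfl⟩
  · rintro _ ⟨g, hg, rfl⟩
    obtain ⟨g', hg', hd⟩ := hg.hasDerivAt
    refine ⟨_, ⟨_, hg'.add (hg.smul (t * Complex.I)), rfl⟩, fun x => ?_⟩
    have h3 : HasDerivAt (fun s : ℝ => (t : ℂ) * s * Complex.I) (t * Complex.I) x := by
      have := ((Complex.ofRealCLM.hasDerivAt (x := x)).const_mul (t : ℂ)).mul_const Complex.I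
      simpa using this
    refine (h3.cexp.mul (hd x)).congr_deriv ?_
    simp only [Pi.add_apply, Pi.smul_apply, smul_eq_mul]
    ring
  · rintro _ ⟨g, hg, rfl⟩ m
    obtain ⟨C, hC⟩ := hg.decay m
    refine ⟨C, fun x => ?_⟩
    rw [norm_mul, ← Complex.ofReal_mul, Complex.norm_exp_ofReal_mul_I, one_mul]
    exact hC x

/-- The polynomial multiples of the Gaussian are closed under differentiation and decrease rapidly.
-/
theorem schwartzOnLine_gaussian : SchwartzOnLine fun s => (Real.exp (-s ^ 2) : ℂ) := by
  -- From |x|^m ≤ 1 + x^(2m) and x^(2m) ≤ m! exp(x²).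
  have hpow : ∀ (m : ℕ) (x : ℝ), |x| ^ m * Real.exp (-x ^ 2) ≤ 1 + m.factorial := by
    intro m x
    have h1 := Real.pow_div_factorial_le_exp (x ^ 2) (sq_nonneg x) m
    rw [div_le_iff₀ (by positivity)] at h1
    have h2 : |x| ^ m ≤ 1 + (x ^ 2) ^ m := by
      rw [← sq_abs x, ← pow_mul, mul_comm, pow_mul]
      nlinarith [sq_nonneg (|x| ^ m - 1)]
    have h3 : Real.exp (-x ^ 2) ≤ 1 := Real.exp_le_one_iff.2 (by nlinarith)
    have h4 : Real.exp (x ^ 2) * Real.exp (-x ^ 2) = 1 := by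
      rw [← Real.exp_add, add_neg_cancel, Real.exp_zero]
    have h5 := Real.exp_pos (-x ^ 2)
    calc |x| ^ m * Real.exp (-x ^ 2)
        ≤ (1 + Real.exp (x ^ 2) * m.factorial) * Real.exp (-x ^ 2) := by gcongr; linarith
      _ = Real.exp (-x ^ 2) + (Real.exp (x ^ 2) * Real.exp (-x ^ 2)) * m.factorial := by ring
      _ ≤ _ := by rw [h4]; linarith
  refine schwartzOnLine_of_closed (S := fun φ => ∃ p : Polynomial ℝ, φ = fun s =>
    ((p.eval s * Real.exp (-s ^ 2) : ℝ) : ℂ)) ?_ ?_ ⟨1, by simp⟩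
  · rintro _ ⟨p, rfl⟩
    refine ⟨_, ⟨p.derivative + p * (-2 * Polynomial.X), rfl⟩, fun x => ?_⟩
    refine HasDerivAt.ofReal_comp ?_
    refine ((p.hasDerivAt x).mul (((hasDerivAt_pow 2 x).neg).exp)).congr_deriv ?_
    simp only [Polynomial.eval_add, Polynomial.eval_mul, Polynomial.eval_neg, Polynomial.eval_ofNat,
      Polynomial.eval_X, Pi.neg_apply]
    push_cast
    ring
  · rintro _ ⟨p, rfl⟩ m
    suffices H : ∃ C, ∀ x, |x| ^ m * |p.eval x| * Real.exp (-x ^ 2) ≤ C by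
      obtain ⟨C, hC⟩ := H
      refine ⟨C, fun x => ?_⟩
      rw [Complex.norm_real, norm_mul, Real.norm_eq_abs, Real.norm_of_nonneg (Real.exp_pos _).le,
        ← mul_assoc]
      exact hC x
    induction p using Polynomial.induction_on' with
    | add p q hp hq =>
      obtain ⟨C, hC⟩ := hp
      obtain ⟨C', hC'⟩ := hq
      refine ⟨C + C', fun x => ?_⟩
      calc |x| ^ m * |(p + q).eval x| * Real.exp (-x ^ 2)
          ≤ |x| ^ m * (|p.eval x| + |q.eval x|) * Real.exp (-x ^ 2) := by
            rw [Polynomial.eval_add]; gcongr; exact abs_add_le _ _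
        _ ≤ _ := by linarith [hC x, hC' x]
    | monomial n a =>
      refine ⟨|a| * (1 + (m + n).factorial), fun x => ?_⟩
      rw [Polynomial.eval_monomial, abs_mul, abs_pow]
      calc |x| ^ m * (|a| * |x| ^ n) * Real.exp (-x ^ 2)
          = |a| * (|x| ^ (m + n) * Real.exp (-x ^ 2)) := by ring
        _ ≤ _ := by gcongr; exact hpow _ x

/-- The function is compared with 1/(1 + x²), using |x|^m exp(-|x|/2) ≤ 2^m m!. -/
theorem integrable_pow_mul_of_exp_bound {κ : ℝ → ℂ} (hκ : Measurable κ) {C : ℝ}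
    (hC : ∀ s, ‖κ s‖ ≤ C * Real.exp (-|s| / 2)) (m : ℕ) :
    Integrable fun u => |u| ^ m * ‖κ u‖ := by
  have hpow : ∀ (m : ℕ) (x : ℝ), |x| ^ m * Real.exp (-|x| / 2) ≤ 2 ^ m * m.factorial := by
    intro m x
    have h1 := Real.pow_div_factorial_le_exp (|x| / 2) (by positivity) m
    rw [div_le_iff₀ (by positivity), div_pow, div_le_iff₀ (by positivity)] at h1
    have h4 : Real.exp (|x| / 2) * Real.exp (-|x| / 2) = 1 := by
      rw [← Real.exp_add, neg_div, add_neg_cancel, Real.exp_zero]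
    calc |x| ^ m * Real.exp (-|x| / 2)
        ≤ Real.exp (|x| / 2) * m.factorial * 2 ^ m * Real.exp (-|x| / 2) := by gcongr
      _ = (Real.exp (|x| / 2) * Real.exp (-|x| / 2)) * (2 ^ m * m.factorial) := by ring
      _ = _ := by rw [h4, one_mul]
  have hC0 : 0 ≤ C := by
    have := (norm_nonneg _).trans (hC 0)
    simpa using this
  refine Integrable.mono' (integrable_inv_one_add_sq.const_mul
    (C * (2 ^ m * m.factorial + 2 ^ (m + 2) * (m + 2).factorial)))
    ((measurable_id.abs.pow_const m).mul hκ.norm).aestronglyMeasurable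
    (Filter.Eventually.of_forall fun x => ?_)
  rw [Real.norm_of_nonneg (by positivity), ← div_eq_mul_inv, le_div_iff₀ (by positivity)]
  calc |x| ^ m * ‖κ x‖ * (1 + x ^ 2)
      ≤ |x| ^ m * (C * Real.exp (-|x| / 2)) * (1 + x ^ 2) := by gcongr; exact hC x
    _ = C * (|x| ^ m * Real.exp (-|x| / 2) + |x| ^ (m + 2) * Real.exp (-|x| / 2)) := by
        rw [← sq_abs x]; ring
    _ ≤ _ := mul_le_mul_of_nonneg_left (add_le_add (hpow _ x) (hpow _ x)) hC0

/-- Derivatives fall on φ alone, so κ need not be smooth. For the decay, |s| ≤ |u| + |u - s|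
distributes powers of s between the exponential decay of κ and the rapid decay of φ. -/
theorem SchwartzOnLine.correlation {κ φ : ℝ → ℂ} (hφ : SchwartzOnLine φ) (hκ : Measurable κ)
    {C : ℝ} (hC : ∀ s, ‖κ s‖ ≤ C * Real.exp (-|s| / 2)) :
    SchwartzOnLine fun s => ∫ u, κ u * φ (u - s) := by
  have hi := integrable_pow_mul_of_exp_bound hκ hC
  have hκi : Integrable fun u => ‖κ u‖ := by simpa using hi 0
  have hint : ∀ g, SchwartzOnLine g → ∀ s, Integrable fun u => κ u * g (u - s) := by
    intro g hg s
    obtain ⟨B, hB⟩ := hg.decay 0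
    exact ((integrable_norm_iff hκ.aestronglyMeasurable).1 hκi).mul_bdd (c := B)
      (hg.continuous.comp (by fun_prop)).aestronglyMeasurable
      (Filter.Eventually.of_forall fun u => by simpa using hB (u - s))
  refine schwartzOnLine_of_closed
    (S := fun φ => ∃ g, SchwartzOnLine g ∧ φ = fun s => ∫ u, κ u * g (u - s)) ?_ ?_ ⟨φ, hφ, rfl⟩
  · rintro _ ⟨g, hg, rfl⟩
    obtain ⟨g', hg', hd⟩ := hg.hasDerivAt
    obtain ⟨B, hB⟩ := hg'.decay 0
    refine ⟨_, ⟨(-1 : ℂ) • g', hg'.smul _, rfl⟩, fun s => ?_⟩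
    refine (hasDerivAt_integral_of_dominated_loc_of_deriv_le (s := Set.univ)
      (F := fun s u => κ u * g (u - s)) (F' := fun s u => κ u * ((-1 : ℂ) • g') (u - s))
      (bound := fun u => ‖κ u‖ * B) Filter.univ_mem
      (Filter.Eventually.of_forall fun s => (hint g hg s).1) (hint g hg s)
      (hint _ (hg'.smul _) s).1 (Filter.Eventually.of_forall fun u s' _ => ?_)
      (hκi.mul_const B) (Filter.Eventually.of_forall fun u s' _ => ?_)).2
    · rw [norm_mul]
      gcongr
      simpa using hB (u - s')
    · have h := (hd (u - s')).scomp s' ((hasDerivAt_id s').const_sub u)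
      exact (h.congr_deriv (by simp)).const_mul (κ u)
  · rintro _ ⟨g, hg, rfl⟩ m
    obtain ⟨B, hB⟩ := hg.decay 0
    obtain ⟨B', hB'⟩ := hg.decay m
    refine ⟨∫ u, 2 ^ m * (|u| ^ m * ‖κ u‖ * B + ‖κ u‖ * B'), fun s => ?_⟩
    have hbi : Integrable fun u => 2 ^ m * (|u| ^ m * ‖κ u‖ * B + ‖κ u‖ * B') :=
      (((hi m).mul_const B).add (hκi.mul_const B')).const_mul _
    rw [← Real.norm_of_nonneg (by positivity : 0 ≤ |s| ^ m), ← norm_smul, ← integral_smul]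
    refine norm_integral_le_of_norm_le hbi (Filter.Eventually.of_forall fun u => ?_)
    rw [norm_smul, Real.norm_of_nonneg (by positivity), norm_mul]
    have h1 : |s| ^ m ≤ 2 ^ m * (|u| ^ m + |u - s| ^ m) := by
      have h2 : |s| ≤ |u| + |u - s| := by
        have := abs_sub u (u - s)
        simpa using this
      refine (pow_le_pow_left₀ (abs_nonneg _) h2 m).trans ?_
      refine (add_pow_le (abs_nonneg _) (abs_nonneg _) m).trans ?_
      gcongr
      · norm_num
      · omega
    have h3 := hB (u - s)
    rw [pow_zero, one_mul] at h3
    calc |s| ^ m * (‖κ u‖ * ‖g (u - s)‖)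
        ≤ 2 ^ m * (|u| ^ m + |u - s| ^ m) * (‖κ u‖ * ‖g (u - s)‖) := by gcongr
      _ = 2 ^ m * (|u| ^ m * ‖κ u‖ * ‖g (u - s)‖ + ‖κ u‖ * (|u - s| ^ m * ‖g (u - s)‖)) := by ring
      _ ≤ _ := by gcongr; exact hB' _

/-- The Fourier transform of Schwartz functions, with the frequency `τ / 2π`. -/
theorem SchwartzOnLine.integral_mul_exp {φ : ℝ → ℂ} (h : SchwartzOnLine φ) :
    SchwartzOnLine fun τ => ∫ s, φ s * Complex.exp (τ * s * Complex.I) := by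
  obtain ⟨g, hg⟩ := h
  obtain rfl : φ = g := funext hg
  have h1 : SchwartzOnLine (𝓕⁻ g : 𝓢(ℝ, ℂ)) := ⟨𝓕⁻ g, fun x => rfl⟩
  have h2 := h1.comp_mul (c := (2 * Real.pi)⁻¹) (by positivity)
  suffices h3 : (fun τ : ℝ => ∫ s : ℝ, g s * Complex.exp (τ * s * Complex.I))
      = fun τ => (𝓕⁻ g : 𝓢(ℝ, ℂ)) ((2 * Real.pi)⁻¹ * τ) by
    rwa [h3]
  funext τ
  rw [fourierInv_coe, Real.fourierInv_eq']
  refine integral_congr_ae (Filter.Eventually.of_forall fun s => ?_)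
  simp only [smul_eq_mul, RCLike.inner_apply, conj_trivial]
  rw [mul_comm]
  congr 2
  push_cast
  field_simp

theorem SchwartzOnLine.exists_integral_mul_exp_eq {f : ℝ → ℂ} (h : SchwartzOnLine f) :
    ∃ φ, SchwartzOnLine φ ∧ ∀ τ : ℝ, f τ = ∫ s, φ s * Complex.exp (τ * s * Complex.I) := by
  obtain ⟨g, hg⟩ := h.comp_mul (c := 2 * Real.pi) (by positivity)
  refine ⟨(𝓕 g : 𝓢(ℝ, ℂ)), ⟨𝓕 g, fun x => rfl⟩, fun τ => ?_⟩
  have h1 : f τ = g ((2 * Real.pi)⁻¹ * τ) := by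
    rw [← hg]
    beta_reduce
    rw [mul_inv_cancel_left₀ (by positivity)]
  rw [h1]
  rw [show g = 𝓕⁻ (𝓕 g) from (FourierTransform.fourierInv_fourier_eq g).symm]
  rw [fourierInv_coe, Real.fourierInv_eq']
  refine integral_congr_ae (Filter.Eventually.of_forall fun s => ?_)
  simp only [smul_eq_mul, RCLike.inner_apply, conj_trivial]
  rw [mul_comm]
  congr 2
  · rw [FourierTransform.fourierInv_fourier_eq g]
  · push_cast
    field_simp

end SchwartzLine

/-! ### A parametrix of the fourth derivative -/

section Parametrix

open Filter Topology

theorem hasDerivAt_max_zero_pow (n : ℕ) (x : ℝ) :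
    HasDerivAt (fun u : ℝ => max u 0 ^ (n + 2)) ((n + 2) * max x 0 ^ (n + 1)) x := by
  rcases lt_trichotomy x 0 with hx | rfl | hx
  · rw [max_eq_right hx.le, zero_pow n.succ_ne_zero, mul_zero]
    refine (hasDerivAt_const x (0 : ℝ)).congr_of_eventuallyEq ?_
    filter_upwards [eventually_lt_nhds hx] with u hu
    rw [max_eq_right hu.le, zero_pow (by omega)]
  · rw [max_self, zero_pow n.succ_ne_zero, mul_zero, hasDerivAt_iff_isLittleO_nhds_zero]
    have h1 : (fun h : ℝ => max h 0 ^ (n + 2)) =O[𝓝 0] fun h : ℝ => h ^ (n + 2) :=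
      Asymptotics.isBigO_of_le _ fun h => by
        rw [norm_pow, norm_pow, Real.norm_of_nonneg (le_max_right _ _), Real.norm_eq_abs]
        exact pow_le_pow_left₀ (le_max_right _ _) (max_le (le_abs_self h) (abs_nonneg h)) _
    have h2 : (fun h : ℝ => h ^ (n + 2)) =o[𝓝 0] fun h : ℝ => h := by
      simpa using Asymptotics.isLittleO_pow_pow (𝕜 := ℝ) (show 1 < n + 2 by omega)
    simpa using h1.trans_isLittleO h2
  · rw [max_eq_left hx.le]
    have h := hasDerivAt_pow (n + 2) x
    refine (h.congr_deriv (by push_cast; simp)).congr_of_eventuallyEq ?_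
    filter_upwards [eventually_gt_nhds hx] with u hu
    rw [max_eq_left hu.le]

theorem contDiff_two_max_zero_cube : ContDiff ℝ 2 fun u : ℝ => max u 0 ^ 3 := by
  have h1 : ContDiff ℝ 1 fun u : ℝ => max u 0 ^ 2 := by
    rw [contDiff_one_iff_deriv]
    refine ⟨fun x => (hasDerivAt_max_zero_pow 0 x).differentiableAt, ?_⟩
    rw [show (deriv fun u : ℝ => max u 0 ^ 2) = _ from
      funext fun x => (hasDerivAt_max_zero_pow 0 x).deriv]
    fun_prop
  rw [show (2 : WithTop ℕ∞) = 1 + 1 by norm_num, contDiff_succ_iff_deriv]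
  refine ⟨fun x => (hasDerivAt_max_zero_pow 1 x).differentiableAt, by simp, ?_⟩
  rw [show (deriv fun u : ℝ => max u 0 ^ 3) = _ from
    funext fun x => (hasDerivAt_max_zero_pow 1 x).deriv]
  exact contDiff_const.mul h1

/-- The function u₊³/6 is the fundamental solution of the fourth derivative. Cut off by a bump, it
gives κ with fourth derivative δ + θ, where θ is smooth and vanishes near 0. Order four is chosen so
that κ is twice differentiable: two derivatives give decay ‖x‖⁻² of the transform, which is exactly
O(1/|x|) at the complex place. -/
theorem exists_parametrix : ∃ κ θ : ℝ → ℂ, ContDiff ℝ 2 κ ∧ HasCompactSupport κ ∧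
    ContDiff ℝ 2 θ ∧ HasCompactSupport θ ∧ ∀ φ φ₁ φ₂ φ₃ φ₄ : ℝ → ℂ,
      (∀ x, HasDerivAt φ (φ₁ x) x) → (∀ x, HasDerivAt φ₁ (φ₂ x) x) →
      (∀ x, HasDerivAt φ₂ (φ₃ x) x) → (∀ x, HasDerivAt φ₃ (φ₄ x) x) → Continuous φ₄ →
      ∀ s, φ s = (∫ u, κ u * φ₄ (s - u)) - ∫ u, θ u * φ (s - u) := by
  let η : ContDiffBump (0 : ℝ) := ⟨1, 2, one_pos, one_lt_two⟩
  set E : ℝ → ℝ := fun u => η u * (u ^ 3 / 6) with hE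
  have hEs : ContDiff ℝ ∞ E := η.contDiff.mul (by fun_prop)
  have hd : ∀ n u, HasDerivAt (iteratedDeriv n E) (iteratedDeriv (n + 1) E u) u := fun n u => by
    rw [iteratedDeriv_succ]
    refine (hEs.differentiable_iteratedDeriv n ?_ u).hasDerivAt
    exact_mod_cast WithTop.coe_lt_top _
  have hcube : ∀ u : ℝ, |u| < 1 → ∀ n,
      iteratedDeriv n E u = iteratedDeriv n (fun x : ℝ => x ^ 3 / 6) u := fun u hu n => by
    refine Filter.EventuallyEq.iteratedDeriv_eq n ?_
    filter_upwards [(continuous_abs.tendsto u).eventually_lt_const hu] with v hv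
    rw [hE]
    beta_reduce
    rw [η.one_of_mem_closedBall (by simpa using hv.le), one_mul]
  have d1 : (deriv fun x : ℝ => x ^ 3 / 6) = fun x => x ^ 2 / 2 := funext fun x =>
    (((hasDerivAt_pow 3 x).div_const 6).congr_deriv (by push_cast; ring)).deriv
  have d2 : (deriv fun x : ℝ => x ^ 2 / 2) = fun x => x := funext fun x =>
    (((hasDerivAt_pow 2 x).div_const 2).congr_deriv (by push_cast; ring)).deriv
  have d3 : (deriv fun x : ℝ => x) = fun _ => 1 := funext fun x => (hasDerivAt_id x).deriv
  have hfar : ∀ u : ℝ, 2 < |u| → ∀ n, iteratedDeriv n E u = 0 := fun u hu n => by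
    have h : E =ᶠ[𝓝 u] fun _ => 0 := by
      filter_upwards [(continuous_abs.tendsto u).eventually_const_lt hu] with v hv
      rw [hE]
      beta_reduce
      rw [η.zero_of_le_dist (by simpa using hv.le), zero_mul]
    rw [h.iteratedDeriv_eq n]
    simp
  have hcont : ∀ n, Continuous (iteratedDeriv n E) := fun n =>
    continuous_iff_continuousAt.2 fun u => (hd n u).continuousAt
  set κ : ℝ → ℝ := fun u => η u * (max u 0 ^ 3 / 6) with hκ
  set θ : ℝ → ℝ := fun u => if 0 < u then iteratedDeriv 4 E u else 0 with hθ
  have hκs : HasCompactSupport κ := η.hasCompactSupport.mul_right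
  -- E is the cubic u³/6 there, killed by four derivatives. Hence truncating the fourth derivative
  -- to u > 0 creates no singularity at 0.
  have h4 : ∀ u : ℝ, |u| < 1 → iteratedDeriv 4 E u = 0 := fun u hu => by
    rw [hcube u hu, iteratedDeriv_succ', d1, iteratedDeriv_succ', d2, iteratedDeriv_succ', d3,
      iteratedDeriv_one]
    simp
  have hθsm : ContDiff ℝ 2 θ := by
    rw [contDiff_iff_contDiffAt]
    intro u
    rcases lt_or_ge 0 u with hu | hu
    · have h5 : ContDiff ℝ 2 (iteratedDeriv 4 E) := by
        rw [iteratedDeriv_eq_iterate]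
        exact contDiff_infty.1 (ContDiff.iterate_deriv 4 hEs) 2
      refine h5.contDiffAt.congr_of_eventuallyEq ?_
      filter_upwards [eventually_gt_nhds hu] with v hv
      exact if_pos hv
    · refine (contDiffAt_const (c := (0 : ℝ))).congr_of_eventuallyEq ?_
      filter_upwards [eventually_lt_nhds (show u < 1 by linarith)] with v hv
      rw [hθ]
      beta_reduce
      split_ifs with h0
      · exact h4 v (by rw [abs_of_pos h0]; exact hv)
      · rfl
  have hθs : HasCompactSupport θ := by
    refine HasCompactSupport.intro (isCompact_closedBall (0 : ℝ) 2) fun u hu => ?_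
    rw [mem_closedBall_zero_iff, Real.norm_eq_abs, not_le] at hu
    rw [hθ]
    beta_reduce
    rw [hfar u hu, ite_self]
  refine ⟨fun u => (κ u : ℂ), fun u => (θ u : ℂ), Complex.ofRealCLM.contDiff.comp
      (η.contDiff.mul (contDiff_two_max_zero_cube.div_const 6)),
    hκs.comp_left (g := fun x : ℝ => (x : ℂ)) Complex.ofReal_zero,
    Complex.ofRealCLM.contDiff.comp hθsm,
    hθs.comp_left (g := fun x : ℝ => (x : ℂ)) Complex.ofReal_zero, ?_⟩
  intro φ φ₁ φ₂ φ₃ φ₄ h1 h2 h3 h4' hc s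
  -- Both integrands vanish for u ≤ 0 and beyond the bump radius 2. The endpoint 3 leaves room for
  -- all boundary terms there to vanish.
  have hset : ∀ (f g : ℝ → ℂ), (∀ u, 0 < u → f u = g u) → (∀ u, u ≤ 0 → f u = 0) →
      (∀ u, 3 < u → f u = 0) → ∫ u, f u = ∫ u in (0 : ℝ)..3, g u := by
    intro f g hfg hf hf'
    rw [intervalIntegral.integral_of_le (by norm_num), ← setIntegral_congr_fun measurableSet_Ioc
      (fun u hu => hfg u hu.1), setIntegral_eq_integral_of_forall_compl_eq_zero]
    intro u hu
    rw [Set.mem_Ioc, not_and_or, not_lt, not_le] at hu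
    exact hu.elim (hf u) (hf' u)
  have habs : ∀ u : ℝ, 3 < u → 2 < |u| := fun u hu => by
    rw [abs_of_pos (by linarith)]; linarith
  have e1 : ∫ u, (κ u : ℂ) * φ₄ (s - u) = ∫ u in (0 : ℝ)..3, (E u : ℂ) * φ₄ (s - u) := by
    refine hset _ _ (fun u hu => ?_) (fun u hu => ?_) fun u hu => ?_
    · simp only [hκ, hE, max_eq_left hu.le]
    · simp [hκ, max_eq_right hu]
    · have := hfar u (habs u hu) 0
      rw [iteratedDeriv_zero] at this
      simp only [hκ, max_eq_left (by linarith : 0 ≤ u)]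
      rw [show η u * (u ^ 3 / 6) = 0 from this, Complex.ofReal_zero, zero_mul]
  have e2 : ∫ u, (θ u : ℂ) * φ (s - u)
      = ∫ u in (0 : ℝ)..3, ((iteratedDeriv 4 E u : ℝ) : ℂ) * φ (s - u) := by
    refine hset _ _ (fun u hu => ?_) (fun u hu => ?_) fun u hu => ?_
    · simp only [hθ, if_pos hu]
    · simp only [hθ, if_neg hu.not_gt, Complex.ofReal_zero, zero_mul]
    · simp only [hθ, hfar u (habs u hu), ite_self, Complex.ofReal_zero, zero_mul]
  rw [e1, e2]
  have hcφ : ∀ {f f' : ℝ → ℂ}, (∀ x, HasDerivAt f (f' x) x) → Continuous f := fun h =>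
    continuous_iff_continuousAt.2 fun u => (h u).continuousAt
  have hEc : Continuous fun u => (E u : ℂ) :=
    Complex.continuous_ofReal.comp (by simpa using hcont 0)
  have hE4c : Continuous fun u => ((iteratedDeriv 4 E u : ℝ) : ℂ) :=
    Complex.continuous_ofReal.comp (hcont 4)
  have hφc := hcφ h1
  rw [← intervalIntegral.integral_sub (by apply Continuous.intervalIntegrable; fun_prop)
    (by apply Continuous.intervalIntegrable; fun_prop)]
  have hrev : ∀ {f f' : ℝ → ℂ}, (∀ x, HasDerivAt f (f' x) x) → ∀ u,
      HasDerivAt (fun u => f (s - u)) (-f' (s - u)) u := fun h u =>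
    ((h (s - u)).scomp u ((hasDerivAt_id u).const_sub s)).congr_deriv (by simp)
  -- Four integrations by parts at once. At 0 the only surviving boundary term has the third
  -- derivative of the cubic, equal to 1, as coefficient and gives φ(s).
  have hG : ∀ u ∈ Set.uIcc (0 : ℝ) 3, HasDerivAt (fun u => -(((iteratedDeriv 0 E u : ℝ) : ℂ) * φ₃ (s - u) +
      ((iteratedDeriv 1 E u : ℝ) : ℂ) * φ₂ (s - u) + ((iteratedDeriv 2 E u : ℝ) : ℂ) * φ₁ (s - u) +
      ((iteratedDeriv 3 E u : ℝ) : ℂ) * φ (s - u)))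
      ((E u : ℂ) * φ₄ (s - u) - ((iteratedDeriv 4 E u : ℝ) : ℂ) * φ (s - u)) u := fun u _ => by
    refine (((((hd 0 u).ofReal_comp.mul (hrev h4' u)).add
      ((hd 1 u).ofReal_comp.mul (hrev h3 u))).add
      ((hd 2 u).ofReal_comp.mul (hrev h2 u))).add
      ((hd 3 u).ofReal_comp.mul (hrev h1 u))).neg.congr_deriv ?_
    simp only [iteratedDeriv_zero]
    ring
  rw [intervalIntegral.integral_eq_sub_of_hasDerivAt hG
    (by apply Continuous.intervalIntegrable; fun_prop)]
  have h0 : |(0 : ℝ)| < 1 := by simp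
  have h30 : (2 : ℝ) < |3| := by rw [abs_of_pos (by norm_num)]; norm_num
  simp only [hfar 3 h30]
  have c1 : iteratedDeriv 1 (fun x : ℝ => x ^ 3 / 6) 0 = 0 := by
    rw [iteratedDeriv_one, d1]
    norm_num
  have c2 : iteratedDeriv 2 (fun x : ℝ => x ^ 3 / 6) 0 = 0 := by
    rw [iteratedDeriv_succ', d1, iteratedDeriv_one, d2]
  have c3 : iteratedDeriv 3 (fun x : ℝ => x ^ 3 / 6) 0 = 1 := by
    rw [iteratedDeriv_succ', d1, iteratedDeriv_succ', d2, iteratedDeriv_one, d3]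
  simp only [hcube 0 h0, c1, c2, c3, iteratedDeriv_zero]
  simp

end Parametrix

/-! ### The profile class of an archimedean place -/

section ArchimedeanProfile

variable {K : Type*} [NormedField K] [NormedAlgebra ℝ K] [FiniteDimensional ℝ K]

theorem exists_lg_eq (s : ℝ) : ∃ y : K, y ≠ 0 ∧ lg ℝ y = s := by
  have hd : (Module.finrank ℝ K : ℝ) ≠ 0 := by exact_mod_cast Module.finrank_pos.ne'
  refine ⟨algebraMap ℝ K (Real.exp (s / Module.finrank ℝ K)), ?_, ?_⟩
  · rw [Ne, map_eq_zero]
    exact (Real.exp_pos _).ne'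
  · rw [lg, absv, Algebra.norm_algebraMap, norm_pow, Real.norm_of_nonneg (Real.exp_pos _).le,
      ← Real.exp_nat_mul, Real.log_exp, mul_div_cancel₀ _ hd]

variable [MeasurableSpace K] [BorelSpace K] {μ : Measure K} (P : IsPlace ℝ K μ realChar)
include P

/-- dy/|y| is invariant under multiplication and log|·| is onto, so the image is a translation
invariant measure, finite on compact sets. It is thus a multiple of Lebesgue measure. -/
theorem exists_map_lg_eq (hfin : ∀ b : ℝ, μ {y | absv ℝ y ≤ b} < ⊤) (hμ : μ ≠ 0) :
    ∃ c : NNReal, c ≠ 0 ∧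
      (μ.withDensity fun y => ((absv ℝ y).toNNReal⁻¹ : NNReal)).map (lg ℝ : K → ℝ)
        = c • volume := by
  set ν := (μ.withDensity fun y => ((absv ℝ y).toNNReal⁻¹ : NNReal)).map (lg ℝ : K → ℝ) with hν
  have hdm : Measurable fun y : K => (((absv ℝ y).toNNReal⁻¹ : NNReal) : ℝ≥0∞) :=
    P.measurable_absv.real_toNNReal.inv.coe_nnreal_ennreal
  have happ : ∀ s : Set ℝ, MeasurableSet s →
      ν s = ∫⁻ y, (lg ℝ ⁻¹' s).indicator (fun y => (((absv ℝ y).toNNReal⁻¹ : NNReal) : ℝ≥0∞)) y ∂μ :=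
    fun s hs => by
      rw [hν, Measure.map_apply P.measurable_lg hs, withDensity_apply _ (P.measurable_lg hs),
        lintegral_indicator (P.measurable_lg hs)]
  have hinv : ν.IsAddLeftInvariant := ⟨fun t => by
    obtain ⟨a, ha, rfl⟩ := exists_lg_eq (K := K) t
    have ha' := absv_pos ℝ ha
    ext s hs
    rw [Measure.map_apply (measurable_const_add _) hs, happ _ (measurable_const_add _ hs), happ s hs]
    have h1 := P.lintegral_mul_left
      ((lg ℝ ⁻¹' s).indicator fun y => (((absv ℝ y).toNNReal⁻¹ : NNReal) : ℝ≥0∞)) ha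
    have h2 : ∫⁻ y, (lg ℝ ⁻¹' s).indicator
        (fun y => (((absv ℝ y).toNNReal⁻¹ : NNReal) : ℝ≥0∞)) (a * y) ∂μ
        = ENNReal.ofReal (absv ℝ a)⁻¹ * ∫⁻ y, (lg ℝ ⁻¹' ((fun x => lg ℝ a + x) ⁻¹' s)).indicator
        (fun y => (((absv ℝ y).toNNReal⁻¹ : NNReal) : ℝ≥0∞)) y ∂μ := by
      rw [← lintegral_const_mul' _ _ ENNReal.ofReal_ne_top]
      refine lintegral_congr_ae (P.ae_ne_zero.mono fun y hy => ?_)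
      by_cases h : lg ℝ a + lg ℝ y ∈ s
      · have h' : a * y ∈ lg ℝ ⁻¹' s := by rw [Set.mem_preimage, lg_mul ℝ ha hy]; exact h
        beta_reduce
        rw [Set.indicator_of_mem h', Set.indicator_of_mem (by exact h), absv_mul,
          Real.toNNReal_mul ha'.le, mul_inv, ENNReal.coe_mul, ENNReal.ofReal, Real.toNNReal_inv]
      · have h' : a * y ∉ lg ℝ ⁻¹' s := by rw [Set.mem_preimage, lg_mul ℝ ha hy]; exact h
        beta_reduce
        rw [Set.indicator_of_notMem h', Set.indicator_of_notMem (by exact h), mul_zero]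
    rw [h2] at h1
    exact (ENNReal.mul_right_inj (by simpa using ha') ENNReal.ofReal_ne_top).1 h1⟩
  have hfinc : IsFiniteMeasureOnCompacts ν := ⟨fun C hC => by
    obtain ⟨R, hR⟩ := hC.isBounded.subset_closedBall 0
    refine (measure_mono hR).trans_lt ?_
    rw [happ _ measurableSet_closedBall]
    -- If |log|y|| ≤ R, then both |y| and 1/|y| are at most exp(R).
    calc _ ≤ ∫⁻ y, {y : K | absv ℝ y ≤ Real.exp R}.indicator
            (fun _ => ENNReal.ofReal (Real.exp R)) y ∂μ := by
          refine lintegral_mono_ae (P.ae_ne_zero.mono fun y hy => ?_)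
          by_cases h : y ∈ lg ℝ ⁻¹' Metric.closedBall 0 R
          · have h3 := h
            rw [Set.mem_preimage, mem_closedBall_zero_iff, Real.norm_eq_abs, abs_le] at h3
            have h4 : y ∈ {y : K | absv ℝ y ≤ Real.exp R} := by
              rw [Set.mem_ofPred_eq, ← exp_lg ℝ hy]
              exact Real.exp_le_exp.2 h3.2
            rw [Set.indicator_of_mem h, Set.indicator_of_mem h4, ENNReal.ofReal, ← Real.toNNReal_inv,
              ← exp_lg ℝ hy, ← Real.exp_neg]
            gcongr
            linarith [h3.1]
          · rw [Set.indicator_of_notMem h]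
            exact zero_le
      _ < ⊤ := by
          rw [lintegral_indicator_const (measurableSet_le P.measurable_absv measurable_const)]
          exact ENNReal.mul_lt_top ENNReal.ofReal_lt_top (hfin _)⟩
  have h := Measure.isAddLeftInvariant_eq_smul ν volume
  refine ⟨_, fun h0 => ?_, h⟩
  rw [h0, zero_smul, hν, Measure.map_eq_zero_iff P.measurable_lg.aemeasurable,
    withDensity_eq_zero_iff hdm.aemeasurable] at h
  have h5 : ∀ᵐ y : K ∂μ, False := by
    filter_upwards [h, P.ae_ne_zero] with y h1 h2
    have := absv_pos ℝ h2
    rw [Pi.zero_apply, ENNReal.coe_eq_zero, inv_eq_zero, Real.toNNReal_eq_zero] at h1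
    linarith
  rw [Filter.eventually_false_iff_eq_bot, ae_eq_bot] at h5
  exact hμ h5

section

variable {c : NNReal}
  (hc : (μ.withDensity fun y => ((absv ℝ y).toNNReal⁻¹ : NNReal)).map (lg ℝ : K → ℝ) = c • volume)
include hc

omit [FiniteDimensional ℝ K] hc in
theorem measurable_absv_toNNReal_inv : Measurable fun y : K => (absv ℝ y).toNNReal⁻¹ :=
  P.measurable_absv.real_toNNReal.inv

omit [FiniteDimensional ℝ K] in
theorem integral_lg_eq {g : ℝ → ℂ} (hg : Measurable g) :
    ∫ y : K, g (lg ℝ y) * ((absv ℝ y)⁻¹ : ℝ) ∂μ = c * ∫ s, g s := by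
  have h1 : ∫ s, g s ∂((μ.withDensity fun y => ((absv ℝ y).toNNReal⁻¹ : NNReal)).map
      (lg ℝ : K → ℝ)) = _ := integral_map P.measurable_lg.aemeasurable hg.aestronglyMeasurable
  rw [hc, integral_smul_nnreal_measure,
    integral_withDensity_eq_integral_smul (measurable_absv_toNNReal_inv P)] at h1
  rw [NNReal.smul_def, Complex.real_smul] at h1
  refine Eq.trans ?_ h1.symm
  refine integral_congr_ae (Filter.Eventually.of_forall fun y => ?_)
  simp only [NNReal.smul_def, NNReal.coe_inv, Real.coe_toNNReal _ (absv_nonneg ℝ y),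
    Complex.real_smul]
  rw [mul_comm]

omit [FiniteDimensional ℝ K] in
theorem integrable_lg {g : ℝ → ℂ} (hg : Measurable g) (hi : Integrable g) :
    Integrable (fun y : K => g (lg ℝ y) * ((absv ℝ y)⁻¹ : ℝ)) μ := by
  have h1 := hi.smul_measure_nnreal (c := c)
  rw [← hc, integrable_map_measure hg.aestronglyMeasurable P.measurable_lg.aemeasurable,
    integrable_withDensity_iff_integrable_smul (measurable_absv_toNNReal_inv P)] at h1
  refine h1.congr (Filter.Eventually.of_forall fun y => ?_)
  simp only [NNReal.smul_def, NNReal.coe_inv, Real.coe_toNNReal _ (absv_nonneg ℝ y),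
    Complex.real_smul, Function.comp_apply]
  rw [mul_comm]

omit [FiniteDimensional ℝ K] in
theorem logCorr_eq {κ φ : ℝ → ℂ} (hκ : Measurable κ) (hφ : Measurable φ) (s : ℝ) :
    logCorr ℝ μ κ φ s = c * ∫ u, κ u * φ (u - s) := by
  rw [logCorr, integral_lg_eq P hc (g := fun u => κ (s + u) * φ u)
    ((hκ.comp (measurable_const_add s)).mul hφ),
    ← integral_add_left_eq_self (fun u => κ u * φ (u - s)) s]
  simp only [add_sub_cancel_left]

omit [FiniteDimensional ℝ K] in
theorem logConv_eq {κ φ : ℝ → ℂ} (hκ : Measurable κ) (hφ : Measurable φ) (s : ℝ) :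
    logConv ℝ μ κ φ s = c * ∫ u, κ u * φ (s - u) := by
  rw [logConv, integral_lg_eq P hc (g := fun u => κ (s - u) * φ u)
    ((hκ.comp (measurable_const.sub measurable_id)).mul hφ),
    ← integral_sub_left_eq_self (fun u => κ u * φ (s - u)) volume s]
  simp only [sub_sub_cancel]

omit [FiniteDimensional ℝ K] in
theorem logMellin_eq {φ : ℝ → ℂ} (hφ : Measurable φ) (τ : ℝ) :
    logMellin ℝ μ φ τ = c * ∫ s, φ s * Complex.exp (τ * s * Complex.I) := by
  rw [← integral_lg_eq P hc (g := fun s => φ s * Complex.exp (τ * s * Complex.I))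
    (hφ.mul (by fun_prop)), logMellin]
  simp only [mul_right_comm]

/-- Here both classes are the Schwartz functions. Every multiplicative integral is an integral on
the line times the constant c, so the preimages and the decomposition carry a factor c⁻¹. -/
theorem isProfileClass_schwartzOnLine (hc0 : c ≠ 0)
    (hadm : ∀ (χ : Kˣ →ₜ* Circle) (κ : ℝ → ℂ), ContDiff ℝ 2 κ → HasCompactSupport κ →
      IsAdmissible ℝ μ realChar χ κ) :
    IsProfileClass ℝ μ realChar SchwartzOnLine SchwartzOnLine where
  sch_add _ _ := SchwartzOnLine.add
  sch_smul c _ := SchwartzOnLine.smul c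
  sch_mul _ _ := SchwartzOnLine.mul
  measurable _ h := h.continuous.measurable
  integrable _ h := integrable_lg P hc h.continuous.measurable h.integrable
  bounded _ h := by
    obtain ⟨C, hC⟩ := h.decay 0
    exact ⟨C, fun y _ => by simpa using hC (lg ℝ y)⟩
  id_mul _ h := h.id_mul
  exp_mul t _ h := h.exp_mul t
  conj _ h := h.conj
  gaussian := schwartzOnLine_gaussian
  correlation κ φ hφ hκ h := by
    obtain ⟨C, hC⟩ := h
    have hC' : ∀ s, ‖κ s‖ ≤ C * Real.exp (-|s| / 2) := fun s => by
      obtain ⟨y, hy, rfl⟩ := exists_lg_eq (K := K) s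
      exact hC y hy
    rw [show logCorr ℝ μ κ φ = _ from funext (logCorr_eq P hc hκ hφ.continuous.measurable)]
    exact (hφ.correlation hκ hC').smul c
  sch_logMellin φ hφ := by
    rw [show logMellin ℝ μ φ = _ from funext (logMellin_eq P hc hφ.continuous.measurable)]
    exact hφ.integral_mul_exp.smul c
  exists_logMellin_eq f χ _ h := by
    obtain ⟨φ, hφ, h1⟩ := h.exists_integral_mul_exp_eq
    have h2 := hφ.smul (c : ℂ)⁻¹
    refine ⟨_, h2, fun τ => ?_⟩
    rw [logMellin_eq P hc h2.continuous.measurable, h1, ← integral_const_mul]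
    refine integral_congr_ae (Filter.Eventually.of_forall fun s => ?_)
    simp only [Pi.smul_apply, smul_eq_mul]
    rw [mul_assoc _ (φ s), mul_inv_cancel_left₀ (by exact_mod_cast hc0)]
  exists_decomposition φ χ hφ := by
    obtain ⟨κ, θ, h1, h2, h3, h4, h5⟩ := exists_parametrix
    obtain ⟨φ₁, hφ₁, d1⟩ := hφ.hasDerivAt
    obtain ⟨φ₂, hφ₂, d2⟩ := hφ₁.hasDerivAt
    obtain ⟨φ₃, hφ₃, d3⟩ := hφ₂.hasDerivAt
    obtain ⟨φ₄, hφ₄, d4⟩ := hφ₃.hasDerivAt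
    have hs := hφ₄.smul (c : ℂ)⁻¹
    have hs' := hφ.smul (-(c : ℂ)⁻¹)
    refine ⟨κ, _, θ, _, ⟨hadm χ κ h1 h2, hs⟩, ⟨hadm χ θ h3 h4, hs'⟩, fun y _ => ?_⟩
    rw [logConv_eq P hc h1.continuous.measurable hs.continuous.measurable,
      logConv_eq P hc h3.continuous.measurable hs'.continuous.measurable,
      h5 φ φ₁ φ₂ φ₃ φ₄ d1 d2 d3 d4 hφ₄.continuous, ← integral_const_mul, ← integral_const_mul,
      sub_eq_add_neg, ← integral_neg]
    have hc1 : (c : ℂ) * (c : ℂ)⁻¹ = 1 := mul_inv_cancel₀ (by exact_mod_cast hc0)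
    congr 1
    · refine integral_congr_ae (Filter.Eventually.of_forall fun s => ?_)
      simp only [Pi.smul_apply, smul_eq_mul]
      linear_combination -(κ s * φ₄ (lg ℝ y - s)) * hc1
    · refine integral_congr_ae (Filter.Eventually.of_forall fun s => ?_)
      simp only [Pi.smul_apply, smul_eq_mul]
      linear_combination (θ s * φ (lg ℝ y - s)) * hc1

end

end ArchimedeanProfile

/-! ### One-parameter groups and unitary characters -/

section OneParameter

/-- Averaging over an interval with nonzero integral expresses c through its own primitive, so c is
differentiable. Then c' = c'(0)c, and modulus one forces c'(0) to be imaginary. -/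
theorem exists_eq_exp_of_map_add {c : ℝ → ℂ} (hc : Continuous c)
    (hadd : ∀ x y, c (x + y) = c x * c y) (hn : ∀ x, ‖c x‖ = 1) :
    ∃ t : ℝ, ∀ x : ℝ, c x = Complex.exp (t * x * Complex.I) := by
  have h0 : ∀ x, c x ≠ 0 := fun x => norm_ne_zero_iff.1 (by rw [hn]; exact one_ne_zero)
  have hc0 : c 0 = 1 := by
    have := hadd 0 0
    rw [add_zero] at this
    exact (mul_eq_left₀ (h0 0)).1 this.symm
  have hΦ : ∀ x, HasDerivAt (fun a => ∫ u in (0 : ℝ)..a, c u) (c x) x := fun x =>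
    hc.integral_hasStrictDerivAt 0 x |>.hasDerivAt
  obtain ⟨a, ha⟩ : ∃ a, ∫ u in (0 : ℝ)..a, c u ≠ 0 := by
    by_contra! H
    have h1 := hΦ 0
    rw [show (fun a => ∫ u in (0 : ℝ)..a, c u) = fun _ => 0 from funext H] at h1
    exact h0 0 (h1.unique (hasDerivAt_const 0 0))
  have h2 : ∀ x, c x = ((∫ u in (0 : ℝ)..(x + a), c u) - ∫ u in (0 : ℝ)..x, c u) *
      (∫ u in (0 : ℝ)..a, c u)⁻¹ := fun x => by
    rw [eq_mul_inv_iff_mul_eq₀ ha, ← intervalIntegral.integral_const_mul,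
      intervalIntegral.integral_interval_sub_left (hc.intervalIntegrable _ _)
        (hc.intervalIntegrable _ _)]
    simp only [← hadd]
    simp
  obtain ⟨d, hd⟩ : ∃ d, HasDerivAt c d 0 := by
    have h3 := (((hΦ (0 + a)).comp_add_const 0 a).sub (hΦ 0)).mul_const (∫ u in (0 : ℝ)..a, c u)⁻¹
    exact ⟨_, h3.congr_of_eventuallyEq (Filter.Eventually.of_forall h2)⟩
  have hd' : ∀ x, HasDerivAt c (d * c x) x := fun x => by
    have h3 : HasDerivAt (fun y => c (y - x) * c x) (d * c x) x := by
      refine HasDerivAt.mul_const ?_ (c x)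
      have := hd
      rw [← sub_self x] at this
      exact this.comp_sub_const x x
    refine h3.congr_of_eventuallyEq (Filter.Eventually.of_forall fun y => ?_)
    beta_reduce
    rw [← hadd, sub_add_cancel]
  have hexp : ∀ x : ℝ, HasDerivAt (fun x : ℝ => Complex.exp (-(d * x))) (-d * Complex.exp (-(d * x))) x :=
    fun x => by
    have h3 : HasDerivAt (fun x : ℝ => -(d * (x : ℂ))) (-d) x := by
      have := ((Complex.ofRealCLM.hasDerivAt (x := x)).const_mul d).neg
      simp only [Complex.ofRealCLM_apply, Complex.ofReal_one, mul_one] at this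
      exact this
    exact h3.cexp.congr_deriv (mul_comm _ _)
  have hconst : ∀ x : ℝ, c x * Complex.exp (-(d * x)) = 1 := fun x => by
    have h3 := is_const_of_deriv_eq_zero (f := fun x : ℝ => c x * Complex.exp (-(d * x)))
      (fun y => ((hd' y).mul (hexp y)).differentiableAt)
      (fun y => (((hd' y).mul (hexp y)).congr_deriv (by ring)).deriv) x 0
    simpa [hc0] using h3
  have hcx : ∀ x : ℝ, c x = Complex.exp (d * x) := fun x => by
    have h3 := hconst x
    rw [Complex.exp_neg] at h3
    exact (mul_inv_eq_one₀ (Complex.exp_ne_zero _)).1 h3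
  have hre : d.re = 0 := by
    have := hn 1
    rw [hcx, Complex.norm_exp] at this
    simpa using this
  refine ⟨d.im, fun x => ?_⟩
  rw [hcx]
  congr 1
  conv_lhs => rw [← Complex.re_add_im d, hre]
  push_cast
  ring

theorem exists_char_eq_exp {G : Type*} [Group G] [TopologicalSpace G] (χ : G →ₜ* Circle)
    {e : ℝ → G} (he : Continuous e) (hadd : ∀ x y, e (x + y) = e x * e y) :
    ∃ t : ℝ, ∀ x : ℝ, (χ (e x) : ℂ) = Complex.exp (t * x * Complex.I) :=
  exists_eq_exp_of_map_add (continuous_subtype_val.comp (χ.continuous_toFun.comp he))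
    (fun x y => by rw [hadd, map_mul, Circle.coe_mul]) fun _ => Circle.norm_coe _

end OneParameter

/-! ### Archimedean places -/

section ArchimedeanPlace

theorem continuous_absv {k : Type*} [NontriviallyNormedField k] [CompleteSpace k] {K : Type*}
    [NormedField K] [NormedAlgebra k K] [FiniteDimensional k K] :
    Continuous (absv k : K → ℝ) := by
  let b := Module.finBasis k K
  have h : (absv k : K → ℝ) = fun y => ‖(Algebra.leftMulMatrix b y).det‖ := funext fun y => by
    rw [absv, Algebra.norm_eq_matrix_det b]
  rw [h]
  have h1 : Continuous (Algebra.leftMulMatrix b).toLinearMap :=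
    LinearMap.continuous_of_finiteDimensional _
  exact (Continuous.matrix_det h1).norm

variable {K : Type*} [NormedField K] [NormedAlgebra ℝ K]

/-- The one-parameter group of positive elements with `|e s| = exp s`. -/
def expUnit (K : Type*) [NormedField K] [NormedAlgebra ℝ K] (s : ℝ) : Kˣ :=
  Units.map (algebraMap ℝ K : ℝ →* K)
    (Units.mk0 (Real.exp (s / Module.finrank ℝ K)) (Real.exp_pos _).ne')

theorem coe_expUnit (s : ℝ) :
    (expUnit K s : K) = algebraMap ℝ K (Real.exp (s / Module.finrank ℝ K)) := rfl

theorem continuous_expUnit : Continuous (expUnit K) := by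
  rw [Units.isEmbedding_val₀.continuous_iff]
  exact (continuous_algebraMap ℝ K).comp (Real.continuous_exp.comp (by fun_prop))

theorem expUnit_add (x y : ℝ) : expUnit K (x + y) = expUnit K x * expUnit K y := by
  ext
  rw [Units.val_mul, coe_expUnit, coe_expUnit, coe_expUnit, ← map_mul, ← Real.exp_add, add_div]

variable [FiniteDimensional ℝ K]

theorem lg_expUnit (s : ℝ) : lg ℝ (expUnit K s : K) = s := by
  have hd : (Module.finrank ℝ K : ℝ) ≠ 0 := by exact_mod_cast Module.finrank_pos.ne'
  rw [lg, absv, coe_expUnit, Algebra.norm_algebraMap, norm_pow,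
    Real.norm_of_nonneg (Real.exp_pos _).le, ← Real.exp_nat_mul, Real.log_exp,
    mul_div_cancel₀ _ hd]

/-- The unit group is the product of {|u| = 1} and the positive one-parameter group. The quotient of
the characters is trivial on the first and exponential on the second. -/
theorem sameComponent_of_real {χ χ' : Kˣ →ₜ* Circle}
    (h : ∀ u : Kˣ, absv ℝ (u : K) = 1 → χ u = χ' u) : SameComponent ℝ χ χ' := by
  rw [sameComponent_iff ℝ continuous_absv]
  obtain ⟨t, ht⟩ := exists_char_eq_exp (χ' / χ) continuous_expUnit (expUnit_add (K := K))
  refine ⟨t, ?_⟩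
  ext u
  have h1 : absv ℝ ((u * (expUnit K (lg ℝ (u : K)))⁻¹ : Kˣ) : K) = 1 := by
    have h2 : lg ℝ ((u * (expUnit K (lg ℝ (u : K)))⁻¹ : Kˣ) : K) = 0 := by
      rw [Units.val_mul, lg_mul ℝ u.ne_zero (Units.ne_zero _), Units.val_inv_eq_inv_val, lg_inv,
        lg_expUnit, add_neg_cancel]
    rw [← exp_lg ℝ (Units.ne_zero _), h2, Real.exp_zero]
  have h3 := h _ h1
  rw [map_mul, map_mul, map_inv, map_inv] at h3
  have h4 : (χ' / χ) (expUnit K (lg ℝ (u : K))) = Circle.exp (t * lg ℝ (u : K)) :=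
    Subtype.ext (by rw [ht, Circle.coe_exp]; push_cast; rfl)
  have h5 : χ' (expUnit K (lg ℝ (u : K))) / χ (expUnit K (lg ℝ (u : K)))
      = Circle.exp (t * lg ℝ (u : K)) := h4
  refine congrArg Subtype.val (?_ : χ' u = χ u * Circle.exp (t * lg ℝ (u : K)))
  rw [← h5, mul_div_assoc', eq_div_iff_mul_eq', mul_comm]
  rw [mul_inv_eq_iff_eq_mul, mul_right_comm, eq_mul_inv_iff_mul_eq] at h3
  rw [h3, mul_comm]

theorem isPlace_of_real [MeasurableSpace K] [BorelSpace K] (μ : Measure K) [μ.IsAddHaarMeasure]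
    (hchar : ∀ u : Kˣ, absv ℝ (u : K) = 1 → u ≠ 1 → ∃ χ : Kˣ →ₜ* Circle, χ u ≠ 1) :
    IsPlace ℝ K μ realChar where
  continuous_absv := continuous_absv
  map_mul_left a ha := by
    have h1 : LinearMap.det (Algebra.lmul ℝ K a) ≠ 0 := by
      rw [← Algebra.norm_apply]
      exact Algebra.norm_ne_zero_iff.2 ha
    have h2 := Measure.map_linearMap_addHaar_eq_smul_addHaar μ h1
    rw [← Algebra.norm_apply, abs_inv] at h2
    exact h2
  measure_zero := by
    have : Nontrivial K := inferInstance
    have : (nhdsWithin (0 : K) {0}ᶜ).NeBot := Module.punctured_nhds_neBot ℝ K 0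
    exact measure_singleton 0
  continuous_char := by
    have h1 : Continuous (Algebra.trace ℝ K) := LinearMap.continuous_of_finiteDimensional _
    have h2 : Continuous realChar := by unfold realChar; fun_prop
    exact h2.comp h1
  norm_char x := by
    rw [addCharTr, realChar, Complex.norm_exp]
    simp
  exists_char u hu := by
    by_cases h : absv ℝ (u : K) = 1
    · exact hchar u h hu
    have hl : lg ℝ (u : K) ≠ 0 := fun h0 => h (by
      rw [← exp_lg ℝ u.ne_zero, h0, Real.exp_zero])
    -- With t = π / log|u|, the character |·|^(it) takes the value -1 at u.
    refine ⟨twist ℝ continuous_absv 1 (Real.pi / lg ℝ (u : K)), fun h1 => ?_⟩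
    have h2 : extChar (twist ℝ continuous_absv 1 (Real.pi / lg ℝ (u : K))) (u : K) = 1 := by
      rw [extChar_coe, h1, Circle.coe_one]
    rw [extChar_twist, extChar_coe] at h2
    have h3 : ((Real.pi / lg ℝ (u : K) : ℝ) : ℂ) * lg ℝ (u : K) = Real.pi := by
      rw [← Complex.ofReal_mul, div_mul_cancel₀ _ hl]
    rw [h3, Complex.exp_pi_mul_I] at h2
    have h4 : ((1 : Kˣ →ₜ* Circle) u : ℂ) = 1 := rfl
    rw [h4] at h2
    norm_num at h2
  sameComponent _ _ := sameComponent_of_real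
  exists_section := ⟨fun s => expUnit K s, (Units.continuous_val.comp continuous_expUnit).measurable,
    fun y _ => ⟨Units.ne_zero _, lg_expUnit _⟩⟩

end ArchimedeanPlace

/-! ### Admissible functions at an archimedean place -/

section ArchimedeanAdmissible

/-- Two derivatives of g are integrable. The bounds from orders 0 and 2 are added. -/
theorem exists_fourier_decay {V : Type*} [NormedAddCommGroup V] [InnerProductSpace ℝ V]
    [FiniteDimensional ℝ V] [MeasurableSpace V] [BorelSpace V] {g : V → ℂ} (hg : ContDiff ℝ 2 g)
    (hs : HasCompactSupport g) :
    ∃ C, ∀ w : V, (1 + ‖w‖ ^ 2) * ‖FourierTransform.fourier g w‖ ≤ C := by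
  have hint : ∀ m n : ℕ, (m : ℕ∞) ≤ (0 : ℕ∞) → (n : ℕ∞) ≤ (2 : ℕ∞) →
      Integrable (fun v => ‖v‖ ^ m * ‖iteratedFDeriv ℝ n g v‖) := by
    intro m n _ hn
    refine Continuous.integrable_of_hasCompactSupport ?_ ?_
    · exact (continuous_norm.pow m).mul (hg.continuous_iteratedFDeriv (by exact_mod_cast hn)).norm
    · exact (hs.iteratedFDeriv n).norm.mul_left
  have h := fun n hn w => Real.pow_mul_norm_iteratedFDeriv_fourier_le (K := 0) (N := 2) hg hint
    (k := 0) (n := n) le_rfl hn w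
  have h0 := h 0 (by simp)
  have h2 := h 2 le_rfl
  simp only [norm_iteratedFDeriv_zero] at h0 h2
  obtain ⟨C, hC⟩ : ∃ C, ∀ w, ‖w‖ ^ 0 * ‖FourierTransform.fourier g w‖ ≤ C := ⟨_, h0⟩
  obtain ⟨C', hC'⟩ : ∃ C, ∀ w, ‖w‖ ^ 2 * ‖FourierTransform.fourier g w‖ ≤ C := ⟨_, h2⟩
  refine ⟨C + C', fun w => ?_⟩
  rw [add_mul]
  refine add_le_add ?_ (hC' w)
  simpa using hC w

variable {K : Type*} [NormedField K] [NormedAlgebra ℝ K]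

/-- Away from 0 all factors are smooth enough. Near 0 the profile vanishes identically, since log|y|
leaves the compact support of κ. -/
theorem contDiff_profile (hχ : ∀ (χ : Kˣ →ₜ* Circle) (y : K), y ≠ 0 → ContDiffAt ℝ 2 (extChar χ) y)
    (hlg : ∀ y : K, y ≠ 0 → ContDiffAt ℝ 2 (lg ℝ) y) [FiniteDimensional ℝ K]
    (χ : Kˣ →ₜ* Circle) {κ : ℝ → ℂ} (hκ : ContDiff ℝ 2 κ) (hs : HasCompactSupport κ) :
    ContDiff ℝ 2 (profile ℝ χ κ : K → ℂ) := by
  rw [contDiff_iff_contDiffAt]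
  intro y
  rcases eq_or_ne y 0 with rfl | hy
  · obtain ⟨R, hR⟩ := hs.isCompact.isBounded.subset_closedBall 0
    refine (contDiffAt_const (c := (0 : ℂ))).congr_of_eventuallyEq ?_
    have h1 : (absv ℝ (0 : K)) < Real.exp (-R) := by rw [absv_zero]; exact Real.exp_pos _
    filter_upwards [(continuous_absv.tendsto (0 : K)).eventually_lt_const h1] with v hv
    rcases eq_or_ne v 0 with rfl | hv0
    · simp [profile, extChar_zero]
    · rw [profile, image_eq_zero_of_notMem_tsupport (f := κ), mul_zero]
      intro h2
      have h3 := hR h2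
      rw [mem_closedBall_zero_iff, Real.norm_eq_abs, abs_le] at h3
      rw [← exp_lg ℝ hv0, Real.exp_lt_exp] at hv
      linarith [h3.1]
  · have hw : ContDiffAt ℝ 2 (fun y : K => (Real.exp (-lg ℝ y / 2) : ℂ)) y :=
      Complex.ofRealCLM.contDiff.contDiffAt.comp y ((hlg y hy).neg.div_const 2).exp
    refine (((hχ χ⁻¹ y hy).mul hw).mul (hκ.contDiffAt.comp y (hlg y hy))).congr_of_eventuallyEq ?_
    filter_upwards [isOpen_ne.mem_nhds hy] with v hv
    rw [profile, wt_eq_exp hv]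
    rfl

theorem hasCompactSupport_profile [FiniteDimensional ℝ K]
    (hprop : ∀ b : ℝ, IsCompact {y : K | absv ℝ y ≤ b})
    (χ : Kˣ →ₜ* Circle) {κ : ℝ → ℂ} (hs : HasCompactSupport κ) :
    HasCompactSupport (profile ℝ χ κ : K → ℂ) := by
  obtain ⟨R, hR⟩ := hs.isCompact.isBounded.subset_closedBall 0
  refine HasCompactSupport.intro (hprop (Real.exp R)) fun y hy => ?_
  rw [Set.mem_ofPred_eq, not_le] at hy
  rw [profile, image_eq_zero_of_notMem_tsupport (f := κ), mul_zero]
  intro h2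
  have h3 := hR h2
  rw [mem_closedBall_zero_iff, Real.norm_eq_abs, abs_le] at h3
  have hy0 : y ≠ 0 := by
    rintro rfl
    rw [absv_zero] at hy
    exact (Real.exp_pos R).not_gt hy
  rw [← exp_lg ℝ hy0, Real.exp_lt_exp] at hy
  linarith [h3.2]

theorem hasStableDomain_of_real [FiniteDimensional ℝ K] [MeasurableSpace K] [BorelSpace K]
    (μ : Measure K) [μ.IsAddHaarMeasure]
    (hchar : ∀ u : Kˣ, absv ℝ (u : K) = 1 → u ≠ 1 → ∃ χ : Kˣ →ₜ* Circle, χ u ≠ 1)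
    (hχ : ∀ (χ : Kˣ →ₜ* Circle) (y : K), y ≠ 0 → ContDiffAt ℝ 2 (extChar χ) y)
    (hlg : ∀ y : K, y ≠ 0 → ContDiffAt ℝ 2 (lg ℝ) y)
    (hprop : ∀ b : ℝ, IsCompact {y : K | absv ℝ y ≤ b})
    (hdecay : ∀ g : K → ℂ, ContDiff ℝ 2 g → HasCompactSupport g → ∃ C : ℝ, ∀ x : K,
      absv ℝ x * ‖∫ y, g y * addCharTr realChar (-(x * y)) ∂μ‖ ≤ C)
    {F : Lp ℂ 2 μ ≃ₗᵢ[ℂ] Lp ℂ 2 μ} (hF : IsFourierTransform realChar F) :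
    HasStableDomain (K := K) realChar SchwartzOnLine μ := by
  have : ProperSpace K := FiniteDimensional.proper ℝ K
  have P := isPlace_of_real μ hchar
  obtain ⟨c, hc0, hc⟩ := exists_map_lg_eq P (fun b => (hprop b).measure_lt_top)
    (NeZero.ne μ)
  have Q := isProfileClass_schwartzOnLine P hc hc0 fun χ κ hκ hs => by
    have h1 := contDiff_profile hχ hlg χ hκ hs
    have h2 := hasCompactSupport_profile hprop χ hs
    exact ⟨hκ.continuous.measurable, h1.continuous.integrable_of_hasCompactSupport h2,
      h1.continuous.memLp_of_hasCompactSupport h2, hdecay _ h1 h2⟩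
  exact Q.hasStableDomain P (NeZero.ne μ) hF

end ArchimedeanAdmissible

/-- The character `z / |z|` of `ℂ`. -/
def argChar : ℂˣ →ₜ* Circle where
  toFun u := ⟨(u : ℂ) / ‖(u : ℂ)‖, mem_sphere_zero_iff_norm.2 <| by
    rw [norm_div, Complex.norm_real, norm_norm, div_self (norm_ne_zero_iff.2 u.ne_zero)]⟩
  map_one' := by ext; simp
  map_mul' u v := Circle.ext <| by
    change ((u * v : ℂˣ) : ℂ) / ‖((u * v : ℂˣ) : ℂ)‖ = u / ‖(u : ℂ)‖ * (v / ‖(v : ℂ)‖)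
    simp [mul_div_mul_comm]
  continuous_toFun := Continuous.subtype_mk
    (Units.continuous_val.div (Complex.continuous_ofReal.comp Units.continuous_val.norm)
      fun u => by simp) _

theorem argChar_ne_one {u : ℂˣ} (hu : ‖(u : ℂ)‖ = 1) (hu1 : u ≠ 1) : argChar u ≠ 1 := by
  refine fun h => hu1 (Units.ext ?_)
  have h2 := congrArg Subtype.val h
  change (u : ℂ) / ‖(u : ℂ)‖ = 1 at h2
  rwa [hu, Complex.ofReal_one, div_one] at h2

/-! ### The real place -/

section Real

theorem absv_real (y : ℝ) : absv ℝ y = |y| := by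
  rw [absv, Algebra.norm_self, MonoidHom.id_apply, Real.norm_eq_abs]

/-- On positive numbers the character is exp(it log v), and the negative half-line differs by the
factor χ(-1). -/
theorem contDiffAt_extChar_real (χ : ℝˣ →ₜ* Circle) {y : ℝ} (hy : y ≠ 0) :
    ContDiffAt ℝ 2 (extChar χ) y := by
  obtain ⟨t, ht⟩ := exists_char_eq_exp χ (continuous_expUnit (K := ℝ)) expUnit_add
  have hpos : ∀ v : ℝ, 0 < v → extChar χ v = Complex.exp (t * Real.log v * Complex.I) := by
    intro v hv
    rw [← ht, ← extChar_coe, coe_expUnit]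
    simp [Real.exp_log hv]
  have hsm : ∀ v : ℝ, v ≠ 0 →
      ContDiffAt ℝ 2 (fun v : ℝ => Complex.exp (t * Real.log v * Complex.I)) v := fun v hv => by
    have : ContDiffAt ℝ 2 (fun v : ℝ => ((Real.log v : ℝ) : ℂ)) v :=
      Complex.ofRealCLM.contDiff.contDiffAt.comp v (Real.contDiffAt_log.2 hv)
    exact ((contDiffAt_const.mul this).mul contDiffAt_const).cexp
  rcases hy.lt_or_gt with h | h
  · refine ((contDiffAt_const (c := extChar χ (-1))).mul (hsm y hy)).congr_of_eventuallyEq ?_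
    filter_upwards [eventually_lt_nhds h] with v hv
    rw [← Real.log_neg_eq_log, ← hpos (-v) (neg_pos.2 hv), ← extChar_mul, neg_mul_neg, one_mul]
  · refine (hsm y hy).congr_of_eventuallyEq ?_
    filter_upwards [eventually_gt_nhds h] with v hv
    exact hpos v hv

theorem hasStableDomain_real : HasStableDomain (K := ℝ) realChar SchwartzOnLine volume := by
  refine hasStableDomain_of_real volume ?_ (fun χ y hy => contDiffAt_extChar_real χ hy) ?_ ?_ ?_
    isFourierTransform_real
  · intro u hu hu1
    -- The sign character is obtained by restricting z/|z| to the real units.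
    have hc : Continuous (Units.map (Complex.ofRealHom : ℝ →* ℂ)) :=
      Continuous.units_map _ Complex.continuous_ofReal
    refine ⟨argChar.comp ⟨Units.map (Complex.ofRealHom : ℝ →* ℂ), hc⟩,
      argChar_ne_one (u := Units.map (Complex.ofRealHom : ℝ →* ℂ) u) ?_ fun h => hu1 ?_⟩
    · rw [absv_real] at hu
      simpa using hu
    · have h1 := congrArg Units.val h
      exact Units.ext (Complex.ofReal_injective h1)
  · intro y hy
    have : (lg ℝ : ℝ → ℝ) = Real.log := funext fun y => by rw [lg, absv_real, Real.log_abs]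
    rw [this]
    exact Real.contDiffAt_log.2 hy
  · intro b
    have : {y : ℝ | absv ℝ y ≤ b} = Metric.closedBall 0 b := by
      ext y
      rw [Set.mem_ofPred_eq, absv_real, mem_closedBall_zero_iff, Real.norm_eq_abs]
    rw [this]
    exact isCompact_closedBall _ _
  · intro g hg hs
    obtain ⟨C, hC⟩ := exists_fourier_decay hg hs
    refine ⟨C, fun x => ?_⟩
    have h1 : ∫ y, g y * addCharTr realChar (-(x * y)) = FourierTransform.fourier g (-x) := by
      rw [Real.fourier_eq']
      refine integral_congr_ae (Filter.Eventually.of_forall fun y => ?_)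
      simp only [addCharTr, realChar, Algebra.trace_self_apply, smul_eq_mul, RCLike.inner_apply,
        conj_trivial]
      rw [mul_comm]
      congr 2
      push_cast
      ring
    rw [h1, absv_real]
    refine le_trans ?_ (hC (-x))
    gcongr
    rw [norm_neg, Real.norm_eq_abs]
    nlinarith [abs_nonneg x, sq_nonneg (|x| - 1)]

end Real

/-! ### The complex place -/

section Complex

theorem absv_complex (z : ℂ) : absv ℝ z = ‖z‖ ^ 2 := by
  rw [absv, Algebra.norm_complex_apply, Real.norm_of_nonneg (Complex.normSq_nonneg z),
    Complex.normSq_eq_norm_sq]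

/-- In the logarithm's real and imaginary parts the character is a product of two exponentials,
smooth on the slit plane. The negative axis is reached through multiplication by -1. -/
theorem contDiffAt_extChar_complex (χ : ℂˣ →ₜ* Circle) {y : ℂ} (hy : y ≠ 0) :
    ContDiffAt ℝ 2 (extChar χ) y := by
  have hexp : Continuous fun z : ℂ => Units.mk0 (Complex.exp z) (Complex.exp_ne_zero z) := by
    rw [Units.isEmbedding_val₀.continuous_iff]
    exact Complex.continuous_exp
  obtain ⟨t, ht⟩ := exists_char_eq_exp χ (hexp.comp Complex.continuous_ofReal) fun x y => by
    ext
    simp [Complex.exp_add]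
  obtain ⟨t', ht'⟩ := exists_char_eq_exp χ
    (e := fun x : ℝ => Units.mk0 (Complex.exp (x * Complex.I)) (Complex.exp_ne_zero _))
    (hexp.comp (Complex.continuous_ofReal.mul continuous_const)) fun x y => by
    ext
    simp [add_mul, Complex.exp_add]
  have hslit : ∀ z : ℂ, z ≠ 0 → extChar χ z = Complex.exp (t * (Complex.log z).re * Complex.I) *
      Complex.exp (t' * (Complex.log z).im * Complex.I) := fun z hz => by
    rw [← ht, ← ht', ← extChar_coe, ← extChar_coe, ← extChar_mul]
    congr 1
    simp only [Function.comp_apply, Units.val_mk0]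
    rw [← Complex.exp_add, Complex.re_add_im, Complex.exp_log hz]
  have hsm : ∀ z : ℂ, z ∈ Complex.slitPlane → ContDiffAt ℝ 2 (extChar χ) z := fun z hz => by
    have h1 : ContDiffAt ℝ 2 Complex.log z := (Complex.contDiffAt_log hz).restrict_scalars ℝ
    have h2 : ContDiffAt ℝ 2 (fun z => (((Complex.log z).re : ℝ) : ℂ)) z :=
      (Complex.ofRealCLM.comp Complex.reCLM).contDiff.contDiffAt.comp z h1
    have h3 : ContDiffAt ℝ 2 (fun z => (((Complex.log z).im : ℝ) : ℂ)) z :=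
      (Complex.ofRealCLM.comp Complex.imCLM).contDiff.contDiffAt.comp z h1
    have h4 := ((contDiffAt_const (c := (t : ℂ))).mul h2).mul (contDiffAt_const (c := Complex.I))
    have h5 := ((contDiffAt_const (c := (t' : ℂ))).mul h3).mul (contDiffAt_const (c := Complex.I))
    refine (h4.cexp.mul h5.cexp).congr_of_eventuallyEq ?_
    filter_upwards [isOpen_ne.mem_nhds (Complex.slitPlane_ne_zero hz)] with v hv
    exact hslit v hv
  by_cases h : y ∈ Complex.slitPlane
  · exact hsm y h
  · have h1 : -y ∈ Complex.slitPlane := by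
      rw [Complex.mem_slitPlane_iff_not_le_zero, not_not] at h
      rw [Complex.mem_slitPlane_iff]
      left
      rw [Complex.neg_re]
      have h2 := (Complex.le_def.1 h)
      refine neg_pos.2 (lt_of_le_of_ne h2.1 fun h3 => hy ?_)
      exact Complex.ext h3 h2.2
    refine ((contDiffAt_const (c := extChar χ (-1))).mul
      ((hsm _ h1).comp y contDiffAt_id.neg)).congr_of_eventuallyEq
      (Filter.Eventually.of_forall fun v => ?_)
    simp only [Function.comp_apply]
    rw [← extChar_mul, neg_mul_neg, one_mul]

theorem hasStableDomain_complex :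
    HasStableDomain (K := ℂ) realChar SchwartzOnLine ((2 : ℝ≥0∞) • volume) := by
  obtain ⟨F, hF⟩ := exists_isFourierTransform_complex
  have : ((2 : ℝ≥0∞) • (volume : Measure ℂ)).IsAddHaarMeasure :=
    Measure.IsAddHaarMeasure.smul _ two_ne_zero (by simp)
  refine hasStableDomain_of_real _ ?_ (fun χ y hy => contDiffAt_extChar_complex χ hy) ?_ ?_ ?_ hF
  · intro u hu hu1
    rw [absv_complex, pow_eq_one_iff_of_nonneg (norm_nonneg _) two_ne_zero] at hu
    exact ⟨argChar, argChar_ne_one hu hu1⟩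
  · intro y hy
    have : (lg ℝ : ℂ → ℝ) = fun z => Real.log (‖z‖ ^ 2) := funext fun y => by
      rw [lg, absv_complex]
    rw [this]
    exact (contDiff_norm_sq ℝ).contDiffAt.log (by positivity)
  · intro b
    refine (isCompact_closedBall (0 : ℂ) (√b)).of_isClosed_subset
      (isClosed_le continuous_absv continuous_const) fun z hz => ?_
    rw [Set.mem_ofPred_eq, absv_complex] at hz
    rw [mem_closedBall_zero_iff]
    exact Real.le_sqrt_of_sq_le hz
  · intro g hg hs
    obtain ⟨C, hC⟩ := exists_fourier_decay hg hs
    refine ⟨2 * C, fun x => ?_⟩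
    -- The trace pairing 2Re(xy) is the inner product of y with 2x̄, so the frequency is -2x̄. The
    -- normalized absolute value is ‖x‖², so the quadratic decay is just enough.
    have h1 : ∫ y, g y * addCharTr realChar (-(x * y)) ∂((2 : ℝ≥0∞) • (volume : Measure ℂ))
        = 2 * FourierTransform.fourier g (-(2 * starRingEnd ℂ x)) := by
      rw [integral_smul_measure, Real.fourier_eq', ENNReal.toReal_ofNat, Complex.real_smul,
        Complex.ofReal_ofNat]
      congr 1
      refine integral_congr_ae (Filter.Eventually.of_forall fun y => ?_)
      simp only [addCharTr, realChar, Algebra.trace_complex_apply, smul_eq_mul]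
      rw [mul_comm]
      congr 2
      have h7 : inner ℝ y (-(2 * starRingEnd ℂ x)) = -(2 * (x * y).re) := by
        rw [Complex.inner]
        simp
        ring
      rw [h7]
      push_cast
      simp only [Complex.neg_re]
      push_cast
      ring
    rw [h1, absv_complex, norm_mul, Complex.norm_ofNat, mul_left_comm]
    refine mul_le_mul_of_nonneg_left (le_trans ?_ (hC (-(2 * starRingEnd ℂ x)))) zero_le_two
    gcongr
    rw [norm_neg, norm_mul, Complex.norm_ofNat, RCLike.norm_conj]
    nlinarith [norm_nonneg x, sq_nonneg ‖x‖]

end Complex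

/-! ### The additive character of `ℚ_p` -/

section PadicChar

variable (p : ℕ) [Fact p.Prime]

theorem norm_sub_padicFrac (x : ℚ_[p]) : ‖x - (padicFrac p x : ℚ_[p])‖ ≤ 1 := by
  have h := (exists_padicFrac p x).choose_spec
  rw [padicFrac]
  push_cast
  exact h

theorem exists_pow_mul_padicFrac (x : ℚ_[p]) : ∃ (n : ℕ) (c : ℤ), padicFrac p x * (p : ℚ) ^ n = c := by
  refine ⟨(exists_padicFrac p x).choose.2, (exists_padicFrac p x).choose.1, ?_⟩
  rw [padicFrac, div_mul_cancel₀]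
  exact pow_ne_zero _ (by exact_mod_cast (Fact.out : p.Prime).ne_zero)

variable {p} in
-- A rational whose denominator is a power of p is an integer as soon as it is p-integral.
theorem exists_int_eq_of_norm_le_one {r : ℚ} {n : ℕ} {c : ℤ} (h : r * (p : ℚ) ^ n = c)
    (hr : ‖(r : ℚ_[p])‖ ≤ 1) : ∃ m : ℤ, r = m := by
  have hp0 : (p : ℚ) ^ n ≠ 0 := pow_ne_zero _ (by exact_mod_cast (Fact.out : p.Prime).ne_zero)
  have h1 : (c : ℚ_[p]) = r * (p : ℚ_[p]) ^ n := by exact_mod_cast (congrArg ((↑) : ℚ → ℚ_[p]) h).symm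
  have h2 : ‖(c : ℚ_[p])‖ ≤ (p : ℝ) ^ (-(n : ℤ)) := by
    rw [h1, norm_mul, Padic.norm_p_pow]
    exact mul_le_of_le_one_left (by positivity) hr
  obtain ⟨m, hm⟩ := (Padic.norm_int_le_pow_iff_dvd c n).1 h2
  refine ⟨m, ?_⟩
  rw [hm] at h
  push_cast at h
  exact mul_right_cancel₀ hp0 (h.trans (mul_comm _ _))

/-- exp(2πir) = 1 exactly for integral r. The polar part is integral exactly when it is p-integral,
that is, when x is. -/
theorem padicChar_eq_one_iff {x : ℚ_[p]} : padicChar p x = 1 ↔ ‖x‖ ≤ 1 := by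
  have hx := norm_sub_padicFrac p x
  obtain ⟨n, c, hc⟩ := exists_pow_mul_padicFrac p x
  have key : ‖x‖ ≤ 1 ↔ ‖(padicFrac p x : ℚ_[p])‖ ≤ 1 := by
    constructor <;> intro h
    · have := (Padic.nonarchimedean x (-(x - (padicFrac p x : ℚ_[p])))).trans
        (max_le h (by rwa [norm_neg]))
      simpa using this
    · have := (Padic.nonarchimedean (padicFrac p x : ℚ_[p])
        (x - (padicFrac p x : ℚ_[p]))).trans (max_le h hx)
      simpa using this
  rw [key, padicChar, Complex.exp_eq_one_iff]
  constructor
  · rintro ⟨m, hm⟩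
    have h1 : padicFrac p x = m := by
      have : ((padicFrac p x : ℚ) : ℂ) = (m : ℂ) :=
        mul_left_cancel₀ Complex.two_pi_I_ne_zero (by linear_combination hm)
      exact_mod_cast this
    rw [h1]
    push_cast
    exact Padic.norm_int_le_one m
  · intro h
    obtain ⟨m, hm⟩ := exists_int_eq_of_norm_le_one hc h
    refine ⟨m, ?_⟩
    rw [hm]
    push_cast
    ring

/-- The chosen polar parts are additive only up to a rational number that is p-integral with p-power
denominator. This is an integer, invisible to the exponential. -/
theorem padicChar_add (x y : ℚ_[p]) : padicChar p (x + y) = padicChar p x * padicChar p y := by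
  obtain ⟨n, c, hc⟩ := exists_pow_mul_padicFrac p x
  obtain ⟨n', c', hc'⟩ := exists_pow_mul_padicFrac p y
  obtain ⟨n'', c'', hc''⟩ := exists_pow_mul_padicFrac p (x + y)
  have h1 : (padicFrac p (x + y) - padicFrac p x - padicFrac p y) * (p : ℚ) ^ (n + n' + n'')
      = ((c'' * p ^ n * p ^ n' - c * p ^ n' * p ^ n'' - c' * p ^ n * p ^ n'' : ℤ) : ℚ) := by
    push_cast
    rw [← hc, ← hc', ← hc'']
    ring
  have h2 : ‖((padicFrac p (x + y) - padicFrac p x - padicFrac p y : ℚ) : ℚ_[p])‖ ≤ 1 := by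
    have h3 := norm_sub_padicFrac p x
    have h4 := norm_sub_padicFrac p y
    have h5 := norm_sub_padicFrac p (x + y)
    have h6 := (Padic.nonarchimedean _ (-(x + y - (padicFrac p (x + y) : ℚ_[p])))).trans
      (max_le ((Padic.nonarchimedean _ _).trans (max_le h3 h4)) (by rwa [norm_neg]))
    push_cast
    convert! h6 using 2
    ring
  obtain ⟨m, hm⟩ := exists_int_eq_of_norm_le_one h1 h2
  rw [padicChar, padicChar, padicChar, ← Complex.exp_add, Complex.exp_eq_exp_iff_exists_int]
  refine ⟨m, ?_⟩
  have h7 : (padicFrac p (x + y) : ℂ) = padicFrac p x + padicFrac p y + m := by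
    have : padicFrac p (x + y) = padicFrac p x + padicFrac p y + m := by linarith
    exact_mod_cast congrArg ((↑) : ℚ → ℂ) this
  rw [h7]
  ring

theorem norm_padicChar (x : ℚ_[p]) : ‖padicChar p x‖ = 1 := by
  rw [padicChar, show 2 * (Real.pi : ℂ) * Complex.I * (padicFrac p x : ℂ)
    = ((2 * Real.pi * (padicFrac p x : ℝ) : ℝ) : ℂ) * Complex.I by push_cast; ring,
    Complex.norm_exp_ofReal_mul_I]

end PadicChar

/-! ### The absolute value of a finite extension of `ℚ_p` -/

section PadicField

set_option linter.unusedSectionVars false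

variable (p : ℕ) [Fact p.Prime] (K : Type*) [NormedField K] [NormedAlgebra ℚ_[p] K]

include p in
theorem isUltrametricDist_of_padic : IsUltrametricDist K := by
  refine IsUltrametricDist.isUltrametricDist_of_forall_norm_natCast_le_one fun n => ?_
  rw [← map_natCast (algebraMap ℚ_[p] K), norm_algebraMap']
  exact_mod_cast Padic.norm_int_le_one (p := p) n

variable [FiniteDimensional ℚ_[p] K] {K}

/-- The norm of K is the spectral norm, hence given by the constant coefficient of the minimal
polynomial. The field norm is, up to sign, a power of that coefficient. -/
theorem absv_eq_norm_pow (y : K) : absv ℚ_[p] y = ‖y‖ ^ Module.finrank ℚ_[p] K := by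
  have hy : IsIntegral ℚ_[p] y := Algebra.IsIntegral.isIntegral y
  have h1 : ‖y‖ = ‖(minpoly ℚ_[p] y).coeff 0‖ ^ (1 / (minpoly ℚ_[p] y).natDegree : ℝ) := by
    rw [NormedAlgebra.norm_eq_spectralNorm ℚ_[p] y,
      spectralNorm.spectralNorm_eq_norm_coeff_zero_rpow]
  have h2 : (minpoly ℚ_[p] y).natDegree ≠ 0 := (minpoly.natDegree_pos hy).ne'
  have h3 : ‖y‖ ^ (minpoly ℚ_[p] y).natDegree = ‖(minpoly ℚ_[p] y).coeff 0‖ := by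
    rw [h1, one_div, Real.rpow_inv_natCast_pow (norm_nonneg _) h2]
  have h4 := Algebra.PowerBasis.norm_gen_eq_coeff_zero_minpoly (IntermediateField.adjoin.powerBasis hy)
  have h5 : Module.finrank ℚ_[p] K = (minpoly ℚ_[p] y).natDegree *
      Module.finrank (IntermediateField.adjoin ℚ_[p] {y}) K := by
    rw [← IntermediateField.adjoin.finrank hy, Module.finrank_mul_finrank]
  rw [IntermediateField.adjoin.powerBasis_gen, IntermediateField.minpoly_gen] at h4
  rw [absv, Algebra.norm_eq_norm_adjoin, h4, norm_pow, norm_mul, norm_pow, norm_neg, norm_one,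
    one_pow, one_mul, ← h3, h5, pow_mul]

theorem exists_absv_eq_zpow {y : K} (hy : y ≠ 0) : ∃ n : ℤ, absv ℚ_[p] y = (p : ℝ) ^ n := by
  exact ⟨_, Padic.norm_eq_zpow_neg_valuation (Algebra.norm_ne_zero_iff.2 hy)⟩

/-- There is an element whose absolute value generates the value group. -/
theorem exists_generator : ∃ b : K, 1 < absv ℚ_[p] b ∧
    ∀ y : K, y ≠ 0 → ∃ m : ℤ, absv ℚ_[p] y = absv ℚ_[p] b ^ m := by
  have hp1 : (1 : ℝ) < p := by exact_mod_cast (Fact.out : p.Prime).one_lt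
  have hp0 : (p : ℝ) ≠ 0 := (zero_lt_one.trans hp1).ne'
  let G : AddSubgroup ℤ :=
    { carrier := {n | ∃ y : K, y ≠ 0 ∧ absv ℚ_[p] y = (p : ℝ) ^ n}
      zero_mem' := ⟨1, one_ne_zero, by rw [absv_one, zpow_zero]⟩
      add_mem' := by
        rintro _ _ ⟨x, hx, hx'⟩ ⟨y, hy, hy'⟩
        exact ⟨x * y, mul_ne_zero hx hy, by rw [absv_mul, hx', hy', zpow_add₀ hp0]⟩
      neg_mem' := by
        rintro _ ⟨x, hx, hx'⟩
        exact ⟨x⁻¹, inv_ne_zero hx, by rw [absv_inv, hx', zpow_neg]⟩ }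
  obtain ⟨g, hg⟩ := Int.subgroup_cyclic G
  have hg' : ∀ n, n ∈ G ↔ ∃ m : ℤ, m * g = n := fun n => by
    rw [hg, AddSubgroup.mem_closure_singleton]; simp
  -- The element p has absolute value different from 1, so the group of exponents is not trivial.
  have hg0 : g ≠ 0 := by
    rintro rfl
    have h1 : (p : K) ≠ 0 := by
      rw [← map_natCast (algebraMap ℚ_[p] K)]
      exact (map_ne_zero _).2 (by exact_mod_cast (Fact.out : p.Prime).ne_zero)
    obtain ⟨n, hn⟩ := exists_absv_eq_zpow p h1
    obtain ⟨m, hm⟩ := (hg' n).1 ⟨_, h1, hn⟩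
    rw [mul_zero] at hm
    rw [← hm, zpow_zero, absv_eq_norm_pow, ← map_natCast (algebraMap ℚ_[p] K), norm_algebraMap',
      Padic.norm_p] at hn
    exact (pow_lt_one₀ (by positivity) (inv_lt_one_of_one_lt₀ hp1) Module.finrank_pos.ne').ne hn
  obtain ⟨b, hb, hb'⟩ : |g| ∈ G := (hg' _).2 (by
    rcases abs_choice g with h | h
    · exact ⟨1, by rw [h, one_mul]⟩
    · exact ⟨-1, by rw [h]; ring⟩)
  refine ⟨b, ?_, fun y hy => ?_⟩
  · rw [hb']
    exact one_lt_zpow₀ hp1 (abs_pos.2 hg0)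
  · obtain ⟨n, hn⟩ := exists_absv_eq_zpow p hy
    obtain ⟨m, hm⟩ := (hg' n).1 ⟨y, hy, hn⟩
    rcases abs_choice g with h | h
    · exact ⟨m, by rw [hn, hb', h, ← hm, mul_comm, zpow_mul]⟩
    · exact ⟨-m, by rw [hn, hb', h, ← hm, ← zpow_mul]; ring_nf⟩

theorem absv_eq_one_iff {x : K} : absv ℚ_[p] x = 1 ↔ ‖x‖ = 1 := by
  rw [absv_eq_norm_pow, pow_eq_one_iff_of_nonneg (norm_nonneg _) Module.finrank_pos.ne']

/-! ### The additive character -/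

theorem addCharTr_add (x y : K) : addCharTr (padicChar p) (x + y)
    = addCharTr (padicChar p) x * addCharTr (padicChar p) y := by
  rw [addCharTr, map_add, padicChar_add]; rfl

theorem norm_addCharTr (x : K) : ‖addCharTr (padicChar p) x‖ = 1 := norm_padicChar p _

theorem addCharTr_zero : addCharTr (padicChar p) (0 : K) = 1 := by
  rw [addCharTr, map_zero, padicChar_eq_one_iff, norm_zero]
  exact zero_le_one

theorem continuous_trace_padic : Continuous (Algebra.trace ℚ_[p] K) :=
  (Algebra.trace ℚ_[p] K).continuous_of_finiteDimensional

theorem eventually_addCharTr_eq_one : ∀ᶠ x : K in nhds 0, addCharTr (padicChar p) x = 1 := by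
  have h := (continuous_trace_padic p (K := K)).norm.tendsto 0
  rw [map_zero, norm_zero] at h
  filter_upwards [h.eventually_le_const one_pos] with x hx
  exact (padicChar_eq_one_iff p).2 hx

theorem continuous_addCharTr : Continuous (addCharTr (padicChar p) : K → ℂ) := by
  rw [continuous_iff_continuousAt]
  intro x
  refine (continuousAt_const (y := addCharTr (padicChar p) x)).congr ?_
  have h : Filter.Tendsto (fun y => y - x) (nhds x) (nhds 0) := by
    simpa using (continuous_sub_right x).tendsto x
  filter_upwards [h.eventually (eventually_addCharTr_eq_one p)] with y hy
  rw [← sub_add_cancel y x, addCharTr_add, hy, one_mul]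

theorem exists_addCharTr_ne_one : ∃ x : K, addCharTr (padicChar p) x ≠ 1 := by
  obtain ⟨x, hx⟩ := Algebra.trace_surjective ℚ_[p] K ((p : ℚ_[p])⁻¹)
  refine ⟨x, fun h => ?_⟩
  rw [addCharTr, hx, padicChar_eq_one_iff, norm_inv, Padic.norm_p, inv_inv] at h
  have hp1 : (1 : ℝ) < p := by exact_mod_cast (Fact.out : p.Prime).one_lt
  exact hp1.not_ge h

end PadicField

/-! ### The module of a finite extension of `ℚ_p` -/

section PadicModule

set_option linter.unusedSectionVars false

open scoped Pointwise NNReal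

variable (p : ℕ) [Fact p.Prime] {K : Type*} [NormedField K] [NormedAlgebra ℚ_[p] K]
  [FiniteDimensional ℚ_[p] K]

theorem existsUnique_norm_sub_natCast_lt_one {x : ℚ_[p]} (hx : ‖x‖ ≤ 1) :
    ∃! j : Fin p, ‖x - (j : ℕ)‖ < 1 := by
  obtain ⟨n, hn, hn'⟩ := PadicInt.exists_mem_range (⟨x, hx⟩ : ℤ_[p])
  have h1 : ‖x - (n : ℚ_[p])‖ < 1 := by
    rw [IsLocalRing.mem_maximalIdeal, PadicInt.mem_nonunits] at hn'
    exact hn'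
  refine ⟨⟨n, hn⟩, h1, fun j hj => Fin.ext ?_⟩
  have h2 : ‖(((n : ℤ) - ((j : ℕ) : ℤ) : ℤ) : ℚ_[p])‖ < 1 := by
    have := (Padic.nonarchimedean (x - ((j : ℕ) : ℚ_[p])) (-(x - (n : ℚ_[p])))).trans_lt
      (max_lt hj (by rwa [norm_neg]))
    push_cast
    convert! this using 2
    ring
  rw [Padic.norm_intCast_lt_one_iff] at h2
  have h4 : ((n : ℤ)) ≡ ((j : ℕ) : ℤ) [ZMOD p] := (Int.modEq_iff_dvd.2 h2).symm
  have h5 := (Int.natCast_modEq_iff.1 h4)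
  have h6 := Nat.ModEq.eq_of_lt_of_lt h5 hn j.2
  exact h6.symm

theorem norm_inv_mul_le_one_iff {x : ℚ_[p]} : ‖(p : ℚ_[p])⁻¹ * x‖ ≤ 1 ↔ ‖x‖ < 1 := by
  have hp0 : (0 : ℝ) < p := by exact_mod_cast (Fact.out : p.Prime).pos
  have h := Padic.norm_le_pow_iff_norm_lt_pow_add_one x (-1)
  rw [norm_mul, norm_inv, Padic.norm_p, inv_inv]
  rw [neg_add_cancel, zpow_zero, zpow_neg_one] at h
  rw [← h, mul_comm, ← le_div_iff₀ hp0, one_div]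

variable (K) in
theorem natCast_ne_zero_of_padic : (p : K) ≠ 0 := by
  rw [← map_natCast (algebraMap ℚ_[p] K)]
  exact (map_ne_zero _).2 (by exact_mod_cast (Fact.out : p.Prime).ne_zero)

variable [MeasurableSpace K] [BorelSpace K] (μ : Measure K) [μ.IsAddHaarMeasure]

/-- The lattice spanned by a basis over `ℤ_p`, and its multiple by the maximal ideal. -/
theorem measure_lattice (b : Module.Basis (Fin (Module.finrank ℚ_[p] K)) ℚ_[p] K) :
    μ {x | ∀ i, ‖b.repr x i‖ ≤ 1}
      = (p : ℝ≥0∞) ^ Module.finrank ℚ_[p] K * μ {x | ∀ i, ‖b.repr x i‖ < 1} := by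
  have hcont : ∀ i, Continuous fun x : K => ‖b.repr x i‖ := fun i =>
    ((b.coord i).continuous_of_finiteDimensional).norm
  have hm : MeasurableSet {x : K | ∀ i, ‖b.repr x i‖ < 1} := by
    rw [Set.ofPred_forall]
    exact MeasurableSet.iInter fun i => (isOpen_lt (hcont i) continuous_const).measurableSet
  -- Coset representatives: all coordinates are digits between 0 and p - 1.
  set c : (Fin (Module.finrank ℚ_[p] K) → Fin p) → K :=
    fun s => b.equivFun.symm fun i => ((s i : ℕ) : ℚ_[p]) with hc
  have hcr : ∀ s i, b.repr (c s) i = ((s i : ℕ) : ℚ_[p]) := fun s i => by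
    rw [hc, ← b.equivFun_apply, LinearEquiv.apply_symm_apply]
  have h1 : {x : K | ∀ i, ‖b.repr x i‖ ≤ 1}
      = ⋃ s, (fun x => -c s + x) ⁻¹' {x | ∀ i, ‖b.repr x i‖ < 1} := by
    ext x
    simp only [Set.mem_ofPred_eq, Set.mem_iUnion, Set.mem_preimage, map_add, map_neg,
      Finsupp.add_apply, Finsupp.neg_apply, hcr]
    constructor
    · intro h
      choose s hs using fun i => (existsUnique_norm_sub_natCast_lt_one p (h i)).exists
      exact ⟨s, fun i => by rw [neg_add_eq_sub]; exact hs i⟩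
    · rintro ⟨s, hs⟩ i
      have := Padic.nonarchimedean (((s i : ℕ) : ℚ_[p])) (-((s i : ℕ) : ℚ_[p]) + b.repr x i)
      rw [add_neg_cancel_left] at this
      exact this.trans (max_le (by exact_mod_cast Padic.norm_int_le_one (p := p) (s i : ℕ)) (hs i).le)
  have h2 : Pairwise (Function.onFun Disjoint
      fun s => (fun x => -c s + x) ⁻¹' {x | ∀ i, ‖b.repr x i‖ < 1}) := by
    intro s s' hss
    refine Set.disjoint_left.2 fun x hx hx' => hss (funext fun i => ?_)
    simp only [Set.mem_ofPred_eq, Set.mem_preimage, map_add, map_neg,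
      Finsupp.add_apply, Finsupp.neg_apply, hcr] at hx hx'
    simp only [neg_add_eq_sub] at hx hx'
    have h3 : ‖b.repr x i‖ ≤ 1 := by
      have := Padic.nonarchimedean (((s i : ℕ) : ℚ_[p])) (b.repr x i - ((s i : ℕ) : ℚ_[p]))
      rw [add_sub_cancel] at this
      exact this.trans (max_le (by exact_mod_cast Padic.norm_int_le_one (p := p) (s i : ℕ)) (hx i).le)
    exact (existsUnique_norm_sub_natCast_lt_one p h3).unique (hx i) (hx' i)
  rw [h1, measure_iUnion h2 fun s => measurable_const_add _ hm]
  simp only [measure_preimage_add]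
  rw [tsum_fintype, Finset.sum_const, Finset.card_univ, Fintype.card_fun, Fintype.card_fin,
    Fintype.card_fin, nsmul_eq_mul]
  push_cast
  rfl

/-- Multiplication by p carries a ℤ_p-lattice onto the sublattice with coordinates in the maximal
ideal, whose index is computed in `measure_lattice`. -/
theorem distribHaarChar_natCast [LocallyCompactSpace K] [SecondCountableTopology K] :
    (distribHaarChar K (Units.mk0 (p : K) (natCast_ne_zero_of_padic p K)) : ℝ)
      = ((p : ℝ) ^ Module.finrank ℚ_[p] K)⁻¹ := by
  have hp0 : (p : ℝ≥0∞) ≠ 0 := by exact_mod_cast (Fact.out : p.Prime).ne_zero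
  set b := Module.finBasis ℚ_[p] K
  let μ : Measure K := Measure.addHaar
  have hcont : ∀ i, Continuous fun x : K => ‖b.repr x i‖ := fun i =>
    ((b.coord i).continuous_of_finiteDimensional).norm
  have hopen : IsOpen {x : K | ∀ i, ‖b.repr x i‖ < 1} := by
    rw [Set.ofPred_forall]
    exact isOpen_iInter_of_finite fun i => isOpen_lt (hcont i) continuous_const
  have hcomp : IsCompact {x : K | ∀ i, ‖b.repr x i‖ ≤ 1} := by
    have h := (isCompact_univ_pi fun _ : Fin (Module.finrank ℚ_[p] K) =>
      isCompact_closedBall (0 : ℚ_[p]) 1)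
    have h2 := b.equivFunL.toHomeomorph.isCompact_preimage.2 h
    convert! h2 using 1
    ext x
    simp [Set.mem_pi]
  have h0 : μ {x : K | ∀ i, ‖b.repr x i‖ < 1} ≠ 0 :=
    (hopen.measure_pos μ ⟨0, fun i => by simp⟩).ne'
  have h1 : μ {x : K | ∀ i, ‖b.repr x i‖ ≤ 1} ≠ 0 := fun h =>
    h0 (measure_mono_null (fun x hx i => (hx i).le) h)
  have h2 : Units.mk0 (p : K) (natCast_ne_zero_of_padic p K) • {x : K | ∀ i, ‖b.repr x i‖ ≤ 1}
      = {x : K | ∀ i, ‖b.repr x i‖ < 1} := by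
    ext x
    rw [Set.mem_smul_set_iff_inv_smul_mem]
    refine forall_congr' fun i => ?_
    rw [Units.smul_def, Units.val_inv_eq_inv_val, Units.val_mk0, smul_eq_mul,
      ← norm_inv_mul_le_one_iff, ← map_natCast (algebraMap ℚ_[p] K), ← map_inv₀,
      ← Algebra.smul_def, map_smul, Finsupp.smul_apply, smul_eq_mul]
  have h3 := distribHaarChar_eq_of_measure_smul_eq_mul (μ := μ)
    (g := Units.mk0 (p : K) (natCast_ne_zero_of_padic p K)) (r := ((p : ℝ≥0) ^ Module.finrank ℚ_[p] K)⁻¹)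
    h1 hcomp.measure_lt_top.ne (by
      rw [h2, measure_lattice p μ b, ENNReal.coe_inv (pow_ne_zero _ (by exact_mod_cast (Fact.out : p.Prime).ne_zero)), ← mul_assoc]
      push_cast
      rw [ENNReal.inv_mul_cancel (pow_ne_zero _ hp0) (by simp), one_mul])
  rw [h3]
  push_cast
  rfl

theorem distribHaarChar_eq_one [LocallyCompactSpace K] [ProperSpace K] {u : Kˣ}
    (hu : ‖(u : K)‖ = 1) : distribHaarChar K u = 1 := by
  let μ : Measure K := Measure.addHaar
  refine distribHaarChar_eq_of_measure_smul_eq_mul (μ := μ) (s := Metric.closedBall 0 1)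
    (Metric.measure_closedBall_pos μ 0 one_pos).ne' measure_closedBall_lt_top.ne ?_
  rw [ENNReal.coe_one, one_mul]
  congr 1
  ext x
  rw [Set.mem_smul_set_iff_inv_smul_mem, Units.smul_def, smul_eq_mul, mem_closedBall_zero_iff,
    mem_closedBall_zero_iff, norm_mul, Units.val_inv_eq_inv_val, norm_inv, hu, inv_one, one_mul]

/-- Both sides are multiplicative. If d is the degree and |u| = p^n, then u^d p^n has norm 1 and
preserves the unit ball, so the module of u is determined by that of p. -/
theorem distribHaarChar_eq_absv [LocallyCompactSpace K] [ProperSpace K] (u : Kˣ) :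
    (distribHaarChar K u : ℝ) = absv ℚ_[p] (u : K) := by
  have hd : Module.finrank ℚ_[p] K ≠ 0 := Module.finrank_pos.ne'
  have hp0 : (p : ℝ) ≠ 0 := by exact_mod_cast (Fact.out : p.Prime).ne_zero
  obtain ⟨n, hn⟩ := exists_absv_eq_zpow p u.ne_zero
  set P : Kˣ := Units.mk0 (p : K) (natCast_ne_zero_of_padic p K)
  have hP : ‖(P : K)‖ = (p : ℝ)⁻¹ := by
    change ‖(p : K)‖ = _
    rw [← map_natCast (algebraMap ℚ_[p] K), norm_algebraMap', Padic.norm_p]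
  have h1 : ‖((u ^ Module.finrank ℚ_[p] K * P ^ n : Kˣ) : K)‖ = 1 := by
    rw [Units.val_mul, norm_mul, Units.val_pow_eq_pow_val, norm_pow, ← absv_eq_norm_pow, hn,
      Units.val_zpow_eq_zpow_val, norm_zpow, hP, inv_zpow, mul_inv_cancel₀ (zpow_ne_zero _ hp0)]
  have h2 := distribHaarChar_eq_one h1
  rw [map_mul, map_pow, map_zpow] at h2
  have h3 := congrArg ((↑) : ℝ≥0 → ℝ) h2
  push_cast at h3
  rw [distribHaarChar_natCast p] at h3
  have h4 : (distribHaarChar K u : ℝ) ^ Module.finrank ℚ_[p] K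
      = absv ℚ_[p] (u : K) ^ Module.finrank ℚ_[p] K := by
    rw [inv_zpow, mul_inv_eq_one₀ (by positivity)] at h3
    rw [h3, hn, ← zpow_natCast, ← zpow_natCast, ← zpow_mul, ← zpow_mul, mul_comm]
  exact (pow_left_inj₀ NNReal.zero_le_coe (absv_nonneg _ _) hd).1 h4

theorem map_mul_left_of_padic [ProperSpace K] {a : K} (ha : a ≠ 0) :
    μ.map (fun y => a * y) = ENNReal.ofReal (absv ℚ_[p] a)⁻¹ • μ := by
  ext s hs
  rw [Measure.map_apply (measurable_const_mul a) hs, Measure.smul_apply, smul_eq_mul, ← absv_inv]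
  have h1 := distribHaarChar_eq_absv p (Units.mk0 a ha)⁻¹
  have h2 := distribHaarChar_mul μ (Units.mk0 a ha)⁻¹ s
  rw [Units.val_inv_eq_inv_val, Units.val_mk0] at h1
  rw [← h1, ENNReal.ofReal_coe_nnreal, h2]
  congr 1
  ext x
  rw [Set.mem_smul_set_iff_inv_smul_mem, inv_inv]
  rfl

end PadicModule

/-! ### Finite places -/

section Character

/-- The embedding of `ℚ / ℤ` into the circle. -/
def ratCircle : AddCircle (1 : ℚ) →+ Additive Circle :=
  QuotientAddGroup.lift _
    { toFun := fun q => Additive.ofMul (Circle.exp (2 * Real.pi * q))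
      map_zero' := by simp
      map_add' := fun x y => by rw [Rat.cast_add, mul_add, Circle.exp_add]; rfl } <| by
    intro q hq
    obtain ⟨n, rfl⟩ := AddSubgroup.mem_zmultiples_iff.1 hq
    change Additive.ofMul (Circle.exp _) = 0
    rw [ofMul_eq_zero, Circle.exp_eq_one]
    refine ⟨n, ?_⟩
    simp
    ring

theorem ratCircle_injective : Function.Injective ratCircle := by
  rw [injective_iff_map_eq_zero]
  intro x
  induction x using QuotientAddGroup.induction_on with
  | H q =>
  intro h
  change Additive.ofMul (Circle.exp (2 * Real.pi * q)) = 0 at h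
  rw [ofMul_eq_zero, Circle.exp_eq_one] at h
  obtain ⟨n, hn⟩ := h
  have h1 : (q : ℝ) = n :=
    mul_left_cancel₀ Real.two_pi_pos.ne' (by linear_combination hn)
  rw [QuotientAddGroup.eq_zero_iff]
  refine AddSubgroup.mem_zmultiples_iff.2 ⟨n, ?_⟩
  have : q = n := by exact_mod_cast h1
  rw [this]; simp

/-- The characters of an abelian group which are trivial on an open subgroup `V` separate points
modulo `V`. -/
theorem exists_char_ne_one_of_notMem {G : Type*} [CommGroup G] [TopologicalSpace G]
    [IsTopologicalGroup G] {V : Subgroup G} (hV : IsOpen (V : Set G)) {u : G} (hu : u ∉ V) :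
    ∃ χ : G →ₜ* Circle, χ u ≠ 1 := by
  have h1 : Additive.ofMul (QuotientGroup.mk u : G ⧸ V) ≠ 0 := by
    rw [Ne, ofMul_eq_zero, QuotientGroup.eq_one_iff]
    exact hu
  -- Homomorphisms to ℚ/ℤ separate the elements of any abelian group. Continuity is automatic
  -- because they are pulled back from a quotient by an open subgroup.
  obtain ⟨c, hc⟩ := CharacterModule.exists_character_apply_ne_zero_of_ne_zero h1
  let f : G →* Circle := (MonoidHom.toAdditive.symm (ratCircle.comp c)).comp (QuotientGroup.mk' V)
  have hf : Continuous f := by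
    refine continuous_of_continuousAt_one f ?_
    refine (continuousAt_const (y := (1 : Circle))).congr ?_
    filter_upwards [hV.mem_nhds V.one_mem] with v hv
    have h2 : QuotientGroup.mk' V v = 1 := (QuotientGroup.eq_one_iff v).2 hv
    exact ((congrArg (MonoidHom.toAdditive.symm (ratCircle.comp c)) h2).trans (map_one _)).symm
  refine ⟨⟨f, hf⟩, fun h => hc (ratCircle_injective ?_)⟩
  rw [map_zero]
  exact h

end Character

section PadicPlace

set_option linter.unusedSectionVars false

variable (p : ℕ) [Fact p.Prime] {K : Type*} [NormedField K] [NormedAlgebra ℚ_[p] K]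

include p in
theorem norm_add_le_max_padic (x y : K) : ‖x + y‖ ≤ max ‖x‖ ‖y‖ := by
  have := isUltrametricDist_of_padic p K
  exact IsUltrametricDist.norm_add_le_max x y

include p in
theorem norm_eq_one_of_norm_sub_one_lt {v : K} (h : ‖v - 1‖ < 1) : ‖v‖ = 1 := by
  have := isUltrametricDist_of_padic p K
  have h1 := IsUltrametricDist.norm_add_eq_max_of_norm_ne_norm (x := v - 1) (y := 1)
    (by rw [norm_one]; exact h.ne)
  rw [sub_add_cancel, norm_one, max_eq_right h.le] at h1
  exact h1

variable (K) in
/-- The group of units `u` with `‖u - 1‖ < r`. -/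
def unitBall {r : ℝ} (h0 : 0 < r) (h1 : r ≤ 1) : Subgroup Kˣ where
  carrier := {v | ‖(v : K) - 1‖ < r}
  one_mem' := by simpa using h0
  mul_mem' := by
    intro v w hv hw
    have hw1 := norm_eq_one_of_norm_sub_one_lt p (lt_of_lt_of_le hw h1)
    have := norm_add_le_max_padic p (((v : K) - 1) * w) (w - 1)
    rw [norm_mul, hw1, mul_one] at this
    refine lt_of_le_of_lt (le_of_eq_of_le ?_ this) (max_lt hv hw)
    congr 1
    push_cast
    ring
  inv_mem' := by
    intro v hv
    have hv1 := norm_eq_one_of_norm_sub_one_lt p (lt_of_lt_of_le hv h1)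
    have : ((v⁻¹ : Kˣ) : K) - 1 = -(((v : K) - 1) * (v : K)⁻¹) := by
      rw [Units.val_inv_eq_inv_val]
      field_simp
      ring
    change ‖((v⁻¹ : Kˣ) : K) - 1‖ < r
    rw [this, norm_neg, norm_mul, norm_inv, hv1, inv_one, mul_one]
    exact hv

variable [FiniteDimensional ℚ_[p] K]

/-- The open subgroup {‖v - 1‖ < ‖u - 1‖} excludes u by strictness. -/
theorem exists_char_ne_one_of_padic {u : Kˣ} (hu : absv ℚ_[p] (u : K) = 1) (h : u ≠ 1) :
    ∃ χ : Kˣ →ₜ* Circle, χ u ≠ 1 := by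
  rw [absv_eq_one_iff] at hu
  have h0 : 0 < ‖(u : K) - 1‖ := norm_pos_iff.2 (sub_ne_zero.2 fun h' => h (Units.ext h'))
  have h1 : ‖(u : K) - 1‖ ≤ 1 := by
    have := norm_add_le_max_padic p (u : K) (-1)
    rwa [norm_neg, norm_one, hu, max_self, ← sub_eq_add_neg] at this
  refine exists_char_ne_one_of_notMem (V := unitBall p K h0 h1) ?_
    (lt_irrefl ‖(u : K) - 1‖)
  exact isOpen_lt ((Units.continuous_val.sub continuous_const).norm) continuous_const

/-- The element `b` has absolute value `> 1` and its absolute value generates the value group. -/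
def IsGenerator (b : K) : Prop :=
  1 < absv ℚ_[p] b ∧ ∀ y : K, y ≠ 0 → ∃ m : ℤ, absv ℚ_[p] y = absv ℚ_[p] b ^ m

variable {p} {b : K}

namespace IsGenerator

variable (hb : IsGenerator p b)
include hb

theorem ne_zero : b ≠ 0 := by
  rintro rfl
  have := hb.1
  rw [absv_zero] at this
  exact this.not_gt zero_lt_one

theorem lg_pos : 0 < lg ℚ_[p] b := Real.log_pos hb.1

theorem exists_lg_eq {y : K} (hy : y ≠ 0) : ∃ m : ℤ, lg ℚ_[p] y = m * lg ℚ_[p] b := by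
  obtain ⟨m, hm⟩ := hb.2 y hy
  exact ⟨m, by rw [lg, hm, Real.log_zpow, lg]⟩

theorem lg_zpow (m : ℤ) : lg ℚ_[p] (b ^ m) = m * lg ℚ_[p] b := by
  rw [lg, lg, absv_eq_norm_pow, absv_eq_norm_pow, norm_zpow, Real.log_pow, Real.log_pow,
    Real.log_zpow, mul_left_comm]

theorem round_mul_div (m : ℤ) : round (m * lg ℚ_[p] b / lg ℚ_[p] b) = m := by
  rw [mul_div_cancel_right₀ _ hb.lg_pos.ne', round_intCast]

/-- Every element is a power of b times a unit of absolute value 1, so t need only be chosen with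
|b|^(it) = χ'(b)/χ(b). -/
theorem sameComponent {χ χ' : Kˣ →ₜ* Circle}
    (h : ∀ u : Kˣ, absv ℚ_[p] (u : K) = 1 → χ u = χ' u) : SameComponent ℚ_[p] χ χ' := by
  rw [sameComponent_iff ℚ_[p] continuous_absv]
  set B : Kˣ := Units.mk0 b hb.ne_zero with hB
  obtain ⟨t, ht⟩ : ∃ t : ℝ, Circle.exp (t * lg ℚ_[p] b) = χ' B / χ B := by
    refine ⟨(Circle.argEquiv (χ' B / χ B) : ℝ) / lg ℚ_[p] b, ?_⟩
    rw [div_mul_cancel₀ _ hb.lg_pos.ne']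
    exact Circle.exp_arg _
  refine ⟨t, ?_⟩
  ext u
  obtain ⟨m, hm⟩ := hb.exists_lg_eq u.ne_zero
  have h1 : absv ℚ_[p] ((u * B ^ (-m) : Kˣ) : K) = 1 := by
    have h2 : lg ℚ_[p] ((u * B ^ (-m) : Kˣ) : K) = 0 := by
      rw [Units.val_mul, lg_mul _ u.ne_zero (Units.ne_zero _), Units.val_zpow_eq_zpow_val, hB,
        Units.val_mk0, hb.lg_zpow, hm]
      push_cast
      ring
    rw [← exp_lg ℚ_[p] (Units.ne_zero _), h2, Real.exp_zero]
  have h3 := h _ h1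
  rw [map_mul, map_mul, map_zpow, map_zpow] at h3
  refine congrArg Subtype.val (?_ : χ' u = χ u * Circle.exp (t * lg ℚ_[p] (u : K)))
  have h4 : Circle.exp (t * lg ℚ_[p] (u : K)) = (χ' B / χ B) ^ m := by
    rw [← ht, hm, ← Circle.exp_zsmul, zsmul_eq_mul]
    congr 1
    ring
  rw [h4, div_zpow, mul_div_assoc', eq_div_iff_mul_eq']
  rw [zpow_neg, zpow_neg, ← div_eq_mul_inv, ← div_eq_mul_inv, div_eq_div_iff_mul_eq_mul] at h3
  rw [h3, mul_comm]

theorem isPlace [MeasurableSpace K] [BorelSpace K] (μ : Measure K) [μ.IsAddHaarMeasure] :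
    IsPlace ℚ_[p] K μ (padicChar p) where
  continuous_absv := continuous_absv
  map_mul_left a ha := by
    have : ProperSpace K := FiniteDimensional.proper ℚ_[p] K
    exact map_mul_left_of_padic p μ ha
  measure_zero := by
    have : (nhdsWithin (0 : K) {0}ᶜ).NeBot := Module.punctured_nhds_neBot ℚ_[p] K 0
    have : ProperSpace K := FiniteDimensional.proper ℚ_[p] K
    exact measure_singleton 0
  continuous_char := continuous_addCharTr p
  norm_char := norm_addCharTr p
  exists_char u hu := by
    by_cases h : absv ℚ_[p] (u : K) = 1
    · exact exists_char_ne_one_of_padic p h hu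
    have hl : lg ℚ_[p] (u : K) ≠ 0 := fun h0 => h (by
      rw [← exp_lg ℚ_[p] u.ne_zero, h0, Real.exp_zero])
    refine ⟨twist ℚ_[p] continuous_absv 1 (Real.pi / lg ℚ_[p] (u : K)), fun h1 => ?_⟩
    have h2 : extChar (twist ℚ_[p] continuous_absv 1 (Real.pi / lg ℚ_[p] (u : K))) (u : K) = 1 := by
      rw [extChar_coe, h1, Circle.coe_one]
    rw [extChar_twist, extChar_coe] at h2
    have h3 : ((Real.pi / lg ℚ_[p] (u : K) : ℝ) : ℂ) * lg ℚ_[p] (u : K) = Real.pi := by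
      rw [← Complex.ofReal_mul, div_mul_cancel₀ _ hl]
    rw [h3, Complex.exp_pi_mul_I] at h2
    have h4 : ((1 : Kˣ →ₜ* Circle) u : ℂ) = 1 := rfl
    rw [h4] at h2
    norm_num at h2
  sameComponent _ _ := hb.sameComponent
  exists_section := by
    -- Only multiples of log|b| occur as values of log|y|. Rounding extends the section measurably
    -- to the line.
    refine ⟨fun s => b ^ round (s / lg ℚ_[p] b), ?_, fun y hy => ?_⟩
    · have h1 : Measurable fun s : ℝ => round (s / lg ℚ_[p] b) := by
        rw [show (fun s : ℝ => round (s / lg ℚ_[p] b)) = fun s => ⌊s / lg ℚ_[p] b + 1 / 2⌋ from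
          funext fun s => round_eq _]
        exact Int.measurable_floor.comp (by fun_prop)
      exact (measurable_from_top (f := fun m : ℤ => b ^ m)).comp h1
    · obtain ⟨m, hm⟩ := hb.exists_lg_eq hy
      rw [hm]
      beta_reduce
      rw [hb.round_mul_div, hb.lg_zpow]
      exact ⟨zpow_ne_zero _ hb.ne_zero, rfl⟩

end IsGenerator

end PadicPlace

/-! ### Rapidly decreasing sequences and smooth periodic functions -/

section RapidSequence

/-- The sequence `a` decreases faster than any power. -/
def IsRapidSeq (a : ℤ → ℂ) : Prop := ∀ n : ℕ, ∃ C : ℝ, ∀ m : ℤ, (1 + |(m : ℝ)|) ^ n * ‖a m‖ ≤ C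

theorem summable_inv_one_add_abs_sq : Summable fun m : ℤ => ((1 + |(m : ℝ)|) ^ 2)⁻¹ := by
  have h : Summable fun n : ℕ => ((1 + (n : ℝ)) ^ 2)⁻¹ := by
    have := (summable_nat_add_iff 1).2 (Real.summable_nat_pow_inv.2 one_lt_two)
    simpa [add_comm] using this
  refine Summable.of_nat_of_neg ?_ ?_
  · simpa using h
  · simpa using h

namespace IsRapidSeq

variable {a : ℤ → ℂ}

theorem of_norm_le (ha : IsRapidSeq a) {a' : ℤ → ℂ} (h : ∀ m, ‖a' m‖ ≤ ‖a m‖) : IsRapidSeq a' :=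
  fun n => (ha n).imp fun _ hC m =>
    (mul_le_mul_of_nonneg_left (h m) (by positivity)).trans (hC m)

theorem summable_norm (ha : IsRapidSeq a) : Summable fun m => ‖a m‖ := by
  obtain ⟨C, hC⟩ := ha 2
  refine Summable.of_nonneg_of_le (fun m => norm_nonneg _) (fun m => ?_)
    (summable_inv_one_add_abs_sq.mul_left C)
  rw [← div_eq_mul_inv, le_div_iff₀ (by positivity), mul_comm]
  exact hC m

theorem const_mul (ha : IsRapidSeq a) (c : ℂ) : IsRapidSeq fun m => c * a m := fun n => by
  obtain ⟨C, hC⟩ := ha n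
  refine ⟨‖c‖ * C, fun m => ?_⟩
  rw [norm_mul, mul_left_comm]
  exact mul_le_mul_of_nonneg_left (hC m) (norm_nonneg c)

theorem id_mul (ha : IsRapidSeq a) : IsRapidSeq fun m => m * a m := fun n => by
  obtain ⟨C, hC⟩ := ha (n + 1)
  refine ⟨C, fun m => le_trans ?_ (hC m)⟩
  rw [norm_mul, Complex.norm_intCast, ← mul_assoc, pow_succ]
  gcongr
  linarith

end IsRapidSeq

theorem exists_pow_mul_exp_le {c : ℝ} (hc : 0 < c) (n : ℕ) :
    ∃ C, ∀ m : ℤ, (1 + |(m : ℝ)|) ^ n * Real.exp (-(c * |(m : ℝ)|)) ≤ C := by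
  refine ⟨(n.factorial : ℝ) / c ^ n * Real.exp c, fun m => ?_⟩
  have h := Real.pow_div_factorial_le_exp (x := c * (1 + |(m : ℝ)|)) (by positivity) n
  rw [div_le_iff₀ (by positivity), mul_pow, mul_add, mul_one, Real.exp_add] at h
  rw [Real.exp_neg, ← div_eq_mul_inv, div_le_iff₀ (Real.exp_pos _), div_mul_eq_mul_div,
    div_mul_eq_mul_div, le_div_iff₀ (by positivity)]
  linarith

theorem isRapidSeq_gaussian {L : ℝ} (hL : 0 < L) :
    IsRapidSeq fun m => (Real.exp (-(m * L) ^ 2) : ℂ) := fun n => by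
  obtain ⟨C, hC⟩ := exists_pow_mul_exp_le (c := L ^ 2) (by positivity) n
  refine ⟨C, fun m => le_trans ?_ (hC m)⟩
  rw [Complex.norm_real, Real.norm_of_nonneg (Real.exp_pos _).le]
  gcongr
  have h1 : |(m : ℝ)| ≤ (m : ℝ) ^ 2 := by
    rw [← sq_abs]
    have h2 : (|m| : ℤ) ≤ |m| ^ 2 := by
      rcases eq_or_ne m 0 with rfl | hm
      · simp
      · exact le_self_pow₀ (Int.one_le_abs hm) two_ne_zero
    exact_mod_cast h2
  nlinarith [mul_le_mul_of_nonneg_left h1 (sq_nonneg L)]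

/-- The inequality 1 + |n| ≤ (1 + |n + m|)(1 + |m|) distributes the polynomial weight over the two
factors. -/
theorem IsRapidSeq.correlation {a κ : ℤ → ℂ} (ha : IsRapidSeq a) {c C : ℝ} (hc : 0 < c)
    (hκ : ∀ m, ‖κ m‖ ≤ C * Real.exp (-(c * |(m : ℝ)|))) :
    IsRapidSeq fun n => ∑' m, κ (n + m) * a m := fun N => by
  obtain ⟨A, hA⟩ := ha (N + 2)
  obtain ⟨B, hB⟩ := exists_pow_mul_exp_le hc N
  have hC : 0 ≤ C := by
    have := (norm_nonneg _).trans (hκ 0)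
    simpa using this
  have key : ∀ n m : ℤ, (1 + |(n : ℝ)|) ^ N * ‖κ (n + m) * a m‖
      ≤ C * B * A * ((1 + |(m : ℝ)|) ^ 2)⁻¹ := fun n m => by
    have h1 : 1 + |(n : ℝ)| ≤ (1 + |((n + m : ℤ) : ℝ)|) * (1 + |(m : ℝ)|) := by
      have h2 : |(n : ℝ)| ≤ |((n + m : ℤ) : ℝ)| + |(m : ℝ)| := by
        have := abs_sub ((n + m : ℤ) : ℝ) (m : ℝ)
        push_cast at this ⊢
        rwa [add_sub_cancel_right] at this
      nlinarith [abs_nonneg ((n + m : ℤ) : ℝ), abs_nonneg (m : ℝ)]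
    have h3 : ‖a m‖ * (1 + |(m : ℝ)|) ^ N ≤ A * ((1 + |(m : ℝ)|) ^ 2)⁻¹ := by
      rw [← div_eq_mul_inv, le_div_iff₀ (by positivity), mul_assoc, ← pow_add, mul_comm]
      exact hA m
    have h4 : (1 + |((n + m : ℤ) : ℝ)|) ^ N * ‖κ (n + m)‖ ≤ C * B := by
      refine (mul_le_mul_of_nonneg_left (hκ _) (by positivity)).trans ?_
      rw [mul_left_comm]
      exact mul_le_mul_of_nonneg_left (hB _) hC
    rw [norm_mul]
    calc _ ≤ ((1 + |((n + m : ℤ) : ℝ)|) * (1 + |(m : ℝ)|)) ^ N * (‖κ (n + m)‖ * ‖a m‖) := by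
          gcongr
      _ = ((1 + |((n + m : ℤ) : ℝ)|) ^ N * ‖κ (n + m)‖) * (‖a m‖ * (1 + |(m : ℝ)|) ^ N) := by
          rw [mul_pow]; ring
      _ ≤ (C * B) * (A * ((1 + |(m : ℝ)|) ^ 2)⁻¹) := by
          refine mul_le_mul h4 h3 (by positivity) (le_trans (by positivity) h4)
      _ = _ := by ring
  refine ⟨∑' m : ℤ, C * B * A * ((1 + |(m : ℝ)|) ^ 2)⁻¹, fun n => ?_⟩
  rw [← abs_of_nonneg (show 0 ≤ (1 + |(n : ℝ)|) ^ N by positivity), ← Real.norm_eq_abs,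
    ← Complex.norm_real, ← norm_mul, ← tsum_mul_left]
  refine tsum_of_norm_bounded (summable_inv_one_add_abs_sq.mul_left _).hasSum fun m => ?_
  rw [norm_mul, Complex.norm_real, Real.norm_of_nonneg (by positivity)]
  exact key n m

/-- The sum of the Fourier series with coefficients `a`, of period `2π / L`. -/
def fourierSum (L : ℝ) (a : ℤ → ℂ) (τ : ℝ) : ℂ :=
  ∑' m : ℤ, a m * Complex.exp (τ * (m * L : ℝ) * Complex.I)

theorem IsRapidSeq.hasDerivAt_fourierSum {a : ℤ → ℂ} (ha : IsRapidSeq a) (L τ : ℝ) :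
    HasDerivAt (fourierSum L a) (fourierSum L (fun m => L * Complex.I * (m * a m)) τ) τ := by
  have h1 : ∀ (b : ℤ → ℂ) (m : ℤ) (τ : ℝ),
      ‖b m * Complex.exp (τ * (m * L : ℝ) * Complex.I)‖ = ‖b m‖ := fun b m τ => by
    rw [norm_mul, ← Complex.ofReal_mul, Complex.norm_exp_ofReal_mul_I, mul_one]
  refine hasDerivAt_tsum ((ha.id_mul.const_mul (L * Complex.I)).summable_norm) (fun m τ => ?_)
    (fun m τ => (h1 (fun m => L * Complex.I * (m * a m)) m τ).le) (y₀ := 0) ?_ τ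
  · have h2 : HasDerivAt (fun τ : ℝ => (τ : ℂ) * (m * L : ℝ) * Complex.I)
        (1 * (m * L : ℝ) * Complex.I) τ :=
      ((Complex.ofRealCLM.hasDerivAt (x := τ)).mul_const _).mul_const _
    refine (h2.cexp.const_mul (a m)).congr_deriv ?_
    push_cast
    ring
  · refine Summable.of_norm ?_
    simp only [h1]
    exact ha.summable_norm

theorem IsRapidSeq.contDiff_fourierSum {a : ℤ → ℂ} (ha : IsRapidSeq a) (L : ℝ) :
    ContDiff ℝ ∞ (fourierSum L a) := by
  rw [contDiff_infty]
  intro n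
  induction n generalizing a with
  | zero =>
    refine contDiff_zero.2 (continuous_iff_continuousAt.2 fun τ => ?_)
    exact (ha.hasDerivAt_fourierSum L τ).continuousAt
  | succ n ih =>
    push_cast
    rw [contDiff_succ_iff_deriv]
    refine ⟨fun τ => (ha.hasDerivAt_fourierSum L τ).differentiableAt, by simp, ?_⟩
    have h1 : deriv (fourierSum L a) = fourierSum L (fun m => L * Complex.I * (m * a m)) :=
      funext fun τ => (ha.hasDerivAt_fourierSum L τ).deriv
    rw [h1]
    exact ih (ha.id_mul.const_mul _)

/-- Each integration by parts gains a factor mL. Boundary terms cancel because g and the exponential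
have period T. -/
theorem exists_fourierCoeff_bound {L T : ℝ} (hLT : L * T = 2 * Real.pi) (k : ℕ) {g : ℝ → ℂ}
    (hg : ContDiff ℝ ∞ g) (hper : Function.Periodic g T) : ∃ C : ℝ, ∀ m : ℤ,
      |m * L| ^ k * ‖∫ τ in (0 : ℝ)..T, g τ * Complex.exp (-(τ * (m * L : ℝ) * Complex.I))‖ ≤ C := by
  induction k generalizing g with
  | zero =>
    refine ⟨|∫ τ in (0 : ℝ)..T, ‖g τ‖|, fun m => ?_⟩
    rw [pow_zero, one_mul]
    refine intervalIntegral.norm_integral_le_abs_integral_norm.trans (le_of_eq ?_)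
    congr 2
    ext τ
    rw [norm_mul, ← Complex.ofReal_mul, ← neg_mul, ← Complex.ofReal_neg,
      Complex.norm_exp_ofReal_mul_I, mul_one]
  | succ k ih =>
    have hd : ContDiff ℝ ∞ (deriv g) := (contDiff_infty_iff_deriv.1 hg).2
    obtain ⟨C, hC⟩ := ih hd fun x => by
      have h1 : (fun x => g (x + T)) = g := funext hper
      conv_rhs => rw [← h1]
      rw [deriv_comp_add_const]
    refine ⟨C, fun m => le_trans (le_of_eq ?_) (hC m)⟩
    have he : ∀ τ : ℝ, HasDerivAt (fun τ : ℝ => Complex.exp (-(τ * (m * L : ℝ) * Complex.I)))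
        (-((m * L : ℝ) * Complex.I) * Complex.exp (-(τ * (m * L : ℝ) * Complex.I))) τ := fun τ => by
      have h2 : HasDerivAt (fun τ : ℝ => -((τ : ℂ) * (m * L : ℝ) * Complex.I))
          (-(1 * (m * L : ℝ) * Complex.I)) τ :=
        (((Complex.ofRealCLM.hasDerivAt (x := τ)).mul_const _).mul_const _).neg
      refine h2.cexp.congr_deriv ?_
      ring
    have hgd : ∀ τ : ℝ, HasDerivAt g (deriv g τ) τ := fun τ =>
      (hg.differentiable (by simp) τ).hasDerivAt
    have h3 := intervalIntegral.integral_mul_deriv_eq_deriv_mul (a := 0) (b := T)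
      (fun τ _ => hgd τ) (fun τ _ => he τ) (hd.continuous.intervalIntegrable _ _)
      (Continuous.intervalIntegrable (by fun_prop) _ _)
    have h4 : Complex.exp (-((T : ℂ) * (m * L : ℝ) * Complex.I)) = 1 := by
      rw [Complex.exp_eq_one_iff]
      refine ⟨-m, ?_⟩
      have h5 : (L : ℂ) * T = 2 * Real.pi := by exact_mod_cast hLT
      push_cast
      linear_combination (-m * Complex.I) * h5
    have h6 : g T = g 0 := by simpa using hper 0
    rw [h4, h6, Complex.ofReal_zero, zero_mul, zero_mul, neg_zero, Complex.exp_zero, sub_self,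
      zero_sub] at h3
    have h7 : ∫ τ in (0 : ℝ)..T, deriv g τ * Complex.exp (-(τ * (m * L : ℝ) * Complex.I))
        = ((m * L : ℝ) * Complex.I) *
          ∫ τ in (0 : ℝ)..T, g τ * Complex.exp (-(τ * (m * L : ℝ) * Complex.I)) := by
      rw [← neg_eq_iff_eq_neg.2 h3, ← intervalIntegral.integral_const_mul,
        ← intervalIntegral.integral_neg]
      congr 1
      ext τ
      ring
    rw [h7, norm_mul, norm_mul, Complex.norm_real, Complex.norm_I, mul_one, Real.norm_eq_abs,
      pow_succ, mul_assoc]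

/-- Absolute summability allows the coefficients to be recovered by termwise integration over one
period. Smoothness then makes them decrease rapidly. -/
theorem isRapidSeq_of_contDiff_fourierSum {L : ℝ} (hL : 0 < L) {a : ℤ → ℂ}
    (ha : Summable fun m => ‖a m‖) (h : ContDiff ℝ ∞ (fourierSum L a)) : IsRapidSeq a := by
  set T := 2 * Real.pi / L with hT
  have hT0 : 0 < T := by positivity
  have hLT : L * T = 2 * Real.pi := mul_div_cancel₀ _ hL.ne'
  have hLTc : (L : ℂ) * T = 2 * Real.pi := by exact_mod_cast hLT
  have hexp : ∀ m : ℤ, Complex.exp ((T : ℂ) * (m * L : ℝ) * Complex.I) = 1 := fun m => by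
    rw [Complex.exp_eq_one_iff]
    refine ⟨m, ?_⟩
    push_cast
    linear_combination (m * Complex.I) * hLTc
  have hper : Function.Periodic (fourierSum L a) T := fun τ => by
    refine tsum_congr fun m => ?_
    rw [Complex.ofReal_add, add_mul, add_mul, Complex.exp_add, hexp, mul_one]
  have hcoeff : ∀ n : ℤ, ∫ τ in (0 : ℝ)..T, fourierSum L a τ *
      Complex.exp (-(τ * (n * L : ℝ) * Complex.I)) = T * a n := fun n => by
    have h1 := intervalIntegral.hasSum_intervalIntegral_of_summable_norm (a := 0) (b := T)
      (f := fun m : ℤ => (⟨fun τ : ℝ => a m * Complex.exp (τ * (m * L : ℝ) * Complex.I) *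
        Complex.exp (-(τ * (n * L : ℝ) * Complex.I)), by fun_prop⟩ : C(ℝ, ℂ))) (by
      refine ha.of_nonneg_of_le (fun _ => norm_nonneg _) fun m => ?_
      refine (ContinuousMap.norm_le _ (norm_nonneg _)).2 fun τ => ?_
      simp only [ContinuousMap.restrict_apply, ContinuousMap.coe_mk]
      rw [norm_mul, norm_mul, ← Complex.ofReal_mul, Complex.norm_exp_ofReal_mul_I, mul_one,
        ← Complex.ofReal_mul, ← neg_mul, ← Complex.ofReal_neg, Complex.norm_exp_ofReal_mul_I,
        mul_one])
    have h2 : ∀ m : ℤ, ∫ τ in (0 : ℝ)..T, (a m * Complex.exp (τ * (m * L : ℝ) * Complex.I) *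
        Complex.exp (-(τ * (n * L : ℝ) * Complex.I))) = if m = n then T * a n else 0 := fun m => by
      have h3 : ∀ τ : ℝ, a m * Complex.exp (τ * (m * L : ℝ) * Complex.I) *
          Complex.exp (-(τ * (n * L : ℝ) * Complex.I))
          = a m * Complex.exp (((m - n : ℤ) * L : ℝ) * Complex.I * τ) := fun τ => by
        rw [mul_assoc, ← Complex.exp_add]
        push_cast
        ring_nf
      simp only [h3]
      rw [intervalIntegral.integral_const_mul]
      split_ifs with hmn
      · subst hmn
        simp [mul_comm]
      · have h4 : (((m - n : ℤ) * L : ℝ) : ℂ) * Complex.I ≠ 0 :=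
          mul_ne_zero (Complex.ofReal_ne_zero.2 (mul_ne_zero
            (Int.cast_ne_zero.2 (sub_ne_zero.2 hmn)) hL.ne')) Complex.I_ne_zero
        rw [integral_exp_mul_complex h4]
        have h5 := hexp (m - n)
        rw [mul_assoc, mul_comm] at h5
        rw [h5]
        simp
    have h6 : ∀ τ : ℝ, fourierSum L a τ * Complex.exp (-(τ * (n * L : ℝ) * Complex.I))
        = ∑' m : ℤ, a m * Complex.exp (τ * (m * L : ℝ) * Complex.I) *
        Complex.exp (-(τ * (n * L : ℝ) * Complex.I)) := fun τ => by
      rw [fourierSum, tsum_mul_right]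
    simp only [ContinuousMap.coe_mk] at h1
    simp only [h6]
    rw [← h1.tsum_eq]
    simp only [h2]
    rw [tsum_ite_eq]
  intro k
  obtain ⟨C, hC⟩ := exists_fourierCoeff_bound hLT k h hper
  obtain ⟨C', hC'⟩ := exists_fourierCoeff_bound hLT 0 h hper
  simp only [hcoeff, norm_mul, Complex.norm_real, Real.norm_of_nonneg hT0.le, pow_zero,
    one_mul] at hC hC'
  refine ⟨2 ^ k * (C' / T + C / T / L ^ k), fun m => ?_⟩
  have h1 : (1 + |(m : ℝ)|) ^ k ≤ 2 ^ k * (1 + |(m : ℝ)| ^ k) := by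
    have h2 := add_pow_le (zero_le_one' ℝ) (abs_nonneg (m : ℝ)) k
    rw [one_pow] at h2
    refine h2.trans ?_
    gcongr
    · exact one_le_two
    · exact Nat.sub_le _ _
  have h3 : ‖a m‖ ≤ C' / T := by rw [le_div_iff₀ hT0, mul_comm]; exact hC' m
  have h4 : |(m : ℝ)| ^ k * ‖a m‖ ≤ C / T / L ^ k := by
    rw [le_div_iff₀ (by positivity), le_div_iff₀ hT0]
    have := hC m
    rw [abs_mul, abs_of_pos hL, mul_pow] at this
    linarith
  calc _ ≤ 2 ^ k * (1 + |(m : ℝ)| ^ k) * ‖a m‖ := by gcongr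
    _ = 2 ^ k * (‖a m‖ + |(m : ℝ)| ^ k * ‖a m‖) := by ring
    _ ≤ _ := by gcongr

end RapidSequence

/-! ### The transform of integrable functions -/

section CharTransform

variable {k : Type*} [NormedField k] {K : Type*} [NormedField K] [NormedAlgebra k K]
  [MeasurableSpace K]

/-- The function `x ↦ ∫ f(y) λ(-xy) dy`. -/
def charTransform (ψ : k → ℂ) (μ : Measure K) (f : K → ℂ) (x : K) : ℂ :=
  ∫ y, f y * addCharTr ψ (-(x * y)) ∂μ

theorem IsPlace.integral_charTransform_mul [BorelSpace K] [SecondCountableTopology K]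
    {μ : Measure K} [SFinite μ] {ψ : k → ℂ} (P : IsPlace k K μ ψ) {f g : K → ℂ}
    (hf : Integrable f μ) (hg : Integrable g μ) :
    ∫ x, charTransform ψ μ f x * g x ∂μ = ∫ x, f x * charTransform ψ μ g x ∂μ := by
  have h1 : Integrable (fun z : K × K => (g z.1 * f z.2) * addCharTr ψ (-(z.1 * z.2)))
      (μ.prod μ) := by
    refine (hg.mul_prod hf).mul_bdd (c := 1) ?_ (Filter.Eventually.of_forall fun z => ?_)
    · exact (P.continuous_char.comp (by fun_prop)).aestronglyMeasurable
    · exact (P.norm_char _).le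
  have h2 := integral_integral_swap (f := fun x y => (g x * f y) * addCharTr ψ (-(x * y))) h1
  simp only [charTransform]
  calc _ = ∫ x, ∫ y, g x * f y * addCharTr ψ (-(x * y)) ∂μ ∂μ := by
        refine integral_congr_ae (Filter.Eventually.of_forall fun x => ?_)
        beta_reduce
        rw [mul_comm, ← integral_const_mul]
        simp only [mul_assoc]
    _ = ∫ y, ∫ x, g x * f y * addCharTr ψ (-(x * y)) ∂μ ∂μ := h2
    _ = _ := by
        refine integral_congr_ae (Filter.Eventually.of_forall fun y => ?_)
        beta_reduce
        rw [← integral_const_mul]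
        refine integral_congr_ae (Filter.Eventually.of_forall fun x => ?_)
        beta_reduce
        rw [mul_comm y x]
        ring

end CharTransform

/-! ### Locally constant functions of compact support -/

section Bruhat

variable {K : Type*} [NormedField K]

/-- `f` is invariant under translation by a neighbourhood of `0`, and of bounded support. -/
structure IsBruhat (f : K → ℂ) : Prop where
  exists_period : ∃ r > 0, ∀ x y : K, ‖y‖ ≤ r → f (x + y) = f x
  exists_support : ∃ R, ∀ x : K, R < ‖x‖ → f x = 0

namespace IsBruhat

variable {f g : K → ℂ}

theorem add (hf : IsBruhat f) (hg : IsBruhat g) : IsBruhat (f + g) := by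
  obtain ⟨r, hr, h1⟩ := hf.exists_period
  obtain ⟨r', hr', h1'⟩ := hg.exists_period
  obtain ⟨R, h2⟩ := hf.exists_support
  obtain ⟨R', h2'⟩ := hg.exists_support
  refine ⟨⟨min r r', lt_min hr hr', fun x y hy => ?_⟩, ⟨max R R', fun x hx => ?_⟩⟩
  · rw [Pi.add_apply, Pi.add_apply, h1 x y (hy.trans (min_le_left _ _)),
      h1' x y (hy.trans (min_le_right _ _))]
  · rw [Pi.add_apply, h2 x ((le_max_left _ _).trans_lt hx), h2' x ((le_max_right _ _).trans_lt hx),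
      add_zero]

theorem comp_map (hf : IsBruhat f) {φ : ℂ → ℂ} (h0 : φ 0 = 0) : IsBruhat fun x => φ (f x) := by
  obtain ⟨r, hr, h1⟩ := hf.exists_period
  obtain ⟨R, h2⟩ := hf.exists_support
  exact ⟨⟨r, hr, fun x y hy => by rw [h1 x y hy]⟩, ⟨R, fun x hx => by rw [h2 x hx, h0]⟩⟩

theorem comp_neg (hf : IsBruhat f) : IsBruhat fun x => f (-x) := by
  obtain ⟨r, hr, h1⟩ := hf.exists_period
  obtain ⟨R, h2⟩ := hf.exists_support
  exact ⟨⟨r, hr, fun x y hy => by rw [neg_add, h1 _ _ (by rwa [norm_neg])]⟩,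
    ⟨R, fun x hx => h2 _ (by rwa [norm_neg])⟩⟩

theorem continuous (hf : IsBruhat f) : Continuous f := by
  obtain ⟨r, hr, h1⟩ := hf.exists_period
  rw [continuous_iff_continuousAt]
  intro x
  refine (continuousAt_const (y := f x)).congr ?_
  filter_upwards [Metric.closedBall_mem_nhds x hr] with y hy
  rw [mem_closedBall_iff_norm] at hy
  rw [← add_sub_cancel x y, h1 x _ hy]

theorem hasCompactSupport [ProperSpace K] (hf : IsBruhat f) : HasCompactSupport f := by
  obtain ⟨R, h2⟩ := hf.exists_support
  refine HasCompactSupport.intro (isCompact_closedBall 0 R) fun x hx => h2 x ?_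
  rwa [mem_closedBall_zero_iff, not_le] at hx

variable [ProperSpace K] [MeasurableSpace K] [BorelSpace K] (μ : Measure K) [μ.IsAddHaarMeasure]

theorem integrable (hf : IsBruhat f) : Integrable f μ :=
  hf.continuous.integrable_of_hasCompactSupport hf.hasCompactSupport

theorem memLp (hf : IsBruhat f) (q : ℝ≥0∞) : MemLp f q μ :=
  hf.continuous.memLp_of_hasCompactSupport hf.hasCompactSupport

end IsBruhat

variable (K) in
/-- The space of locally constant functions of compact support. -/
def bruhat : Submodule ℂ (K → ℂ) where
  carrier := {f | IsBruhat f}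
  add_mem' := IsBruhat.add
  zero_mem' := ⟨⟨1, one_pos, fun _ _ _ => rfl⟩, ⟨0, fun _ _ => rfl⟩⟩
  smul_mem' c _ hf := hf.comp_map (φ := fun z => c • z) (smul_zero c)

/-- The class in `L²` of a locally constant function of compact support. -/
def bruhatToLp [ProperSpace K] [MeasurableSpace K] [BorelSpace K] (μ : Measure K)
    [μ.IsAddHaarMeasure] : bruhat K →ₗ[ℂ] Lp ℂ 2 μ where
  toFun f := (IsBruhat.memLp μ f.2 2).toLp f.1
  map_add' _ _ := MemLp.toLp_add _ _
  map_smul' c _ := MemLp.toLp_const_smul c _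

end Bruhat

/-! ### The conductor and the transform of locally constant functions -/

section BruhatTransform

set_option linter.unusedSectionVars false

variable {p : ℕ} [Fact p.Prime] {K : Type*} [NormedField K] [NormedAlgebra ℚ_[p] K]

include p in
variable (p K) in
theorem exists_lt_norm_of_padic (c : ℝ) : ∃ a : K, a ≠ 0 ∧ c < ‖a‖ := by
  obtain ⟨a, ha⟩ := NormedSpace.exists_lt_norm ℚ_[p] K (max c 0)
  exact ⟨a, norm_pos_iff.1 ((le_max_right _ _).trans_lt ha), (le_max_left _ _).trans_lt ha⟩

include p in
variable (p K) in
theorem exists_norm_lt_of_padic {c : ℝ} (hc : 0 < c) : ∃ a : K, a ≠ 0 ∧ ‖a‖ < c := by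
  obtain ⟨a, ha0, ha⟩ := exists_lt_norm_of_padic p K c⁻¹
  exact ⟨a⁻¹, inv_ne_zero ha0, by rw [norm_inv]; exact inv_lt_of_inv_lt₀ hc ha⟩

variable (p K) in
/-- The annihilator of the ring of integers is a ball. -/
def IsConductor (b : K) : Prop :=
  b ≠ 0 ∧ ∀ x : K, (∀ y : K, ‖y‖ ≤ 1 → addCharTr (padicChar p) (x * y) = 1) ↔ ‖x‖ ≤ ‖b‖

variable [FiniteDimensional ℚ_[p] K]

variable (p K) in
-- The annihilator contains with x every element of no larger norm, and it is closed and bounded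
-- because the character is nontrivial. It is thus the ball given by an element of maximal norm,
-- which is nonzero since the character is trivial near 0.
theorem exists_isConductor [ProperSpace K] : ∃ b : K, IsConductor p K b := by
  set D : Set K := {x | ∀ y : K, ‖y‖ ≤ 1 → addCharTr (padicChar p) (x * y) = 1} with hD
  obtain ⟨x₀, hx₀⟩ := exists_addCharTr_ne_one p (K := K)
  have hx₀0 : x₀ ≠ 0 := by
    rintro rfl
    exact hx₀ (addCharTr_zero p)
  have hbd : ∀ x ∈ D, ‖x‖ < ‖x₀‖ := fun x hx => by
    by_contra! h
    have hx0 : x ≠ 0 := norm_pos_iff.1 ((norm_pos_iff.2 hx₀0).trans_le h)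
    refine hx₀ ?_
    have := hx (x₀ / x) (by rw [norm_div]; exact div_le_one_of_le₀ h (norm_nonneg _))
    rwa [mul_div_cancel₀ _ hx0] at this
  have hcl : IsClosed D := by
    rw [hD, Set.ofPred_forall]
    refine isClosed_iInter fun y => ?_
    rw [Set.ofPred_forall]
    refine isClosed_iInter fun _ => ?_
    exact isClosed_eq ((continuous_addCharTr p).comp (continuous_mul_const y)) continuous_const
  have hcomp : IsCompact D := (isCompact_closedBall (0 : K) ‖x₀‖).of_isClosed_subset hcl
    fun x hx => mem_closedBall_zero_iff.2 (hbd x hx).le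
  have hmono : ∀ x ∈ D, ∀ x' : K, ‖x'‖ ≤ ‖x‖ → x' ∈ D := fun x hx x' hx' y hy => by
    rcases eq_or_ne x 0 with rfl | h0
    · rw [norm_zero, norm_le_zero_iff] at hx'
      rw [hx', zero_mul, addCharTr_zero]
    · have := hx (x' / x * y) (by
        rw [norm_mul, norm_div]
        exact mul_le_one₀ (div_le_one_of_le₀ hx' (norm_nonneg _)) (norm_nonneg _) hy)
      rwa [← mul_assoc, mul_div_cancel₀ _ h0] at this
  obtain ⟨b, hb, hmax⟩ := hcomp.exists_isMaxOn ⟨0, fun y _ => by rw [zero_mul, addCharTr_zero]⟩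
    continuous_norm.continuousOn
  refine ⟨b, ?_, fun x => ⟨fun hx => hmax hx, fun hx => hmono b hb x hx⟩⟩
  rintro rfl
  obtain ⟨ε, hε, h⟩ := Metric.eventually_nhds_iff.1 (eventually_addCharTr_eq_one p (K := K))
  obtain ⟨a, ha0, ha⟩ := exists_norm_lt_of_padic p K hε
  have haD : a ∈ D := fun y hy => h (by
    rw [dist_zero_right, norm_mul]
    exact (mul_le_of_le_one_right (norm_nonneg _) hy).trans_lt ha)
  have := hmax haD
  simp only [Set.mem_ofPred_eq, norm_zero] at this
  exact ha0 (norm_le_zero_iff.1 this)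

namespace IsConductor

variable {b : K} (hb : IsConductor p K b)
include hb

theorem forall_iff {a x : K} (ha : a ≠ 0) :
    (∀ y : K, ‖y‖ ≤ ‖a‖ → addCharTr (padicChar p) (x * y) = 1) ↔ ‖x‖ ≤ ‖b / a‖ := by
  rw [norm_div, le_div_iff₀ (norm_pos_iff.2 ha), ← norm_mul, ← hb.2]
  constructor
  · intro h y hy
    rw [mul_assoc]
    exact h _ (by rw [norm_mul]; exact mul_le_of_le_one_right (norm_nonneg _) hy)
  · intro h y hy
    have := h (y / a) (by rw [norm_div]; exact div_le_one_of_le₀ hy (norm_nonneg _))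
    rwa [mul_assoc, mul_div_cancel₀ _ ha] at this

variable [MeasurableSpace K] [BorelSpace K] {μ : Measure K} [μ.IsAddHaarMeasure]

/-- Translating by some y₀ with λ(xy₀) ≠ 1 leaves f unchanged but multiplies the integral by that
value. -/
theorem charTransform_eq_zero {f : K → ℂ} {a : K} (ha : a ≠ 0)
    (hf : ∀ x y : K, ‖y‖ ≤ ‖a‖ → f (x + y) = f x) {x : K} (hx : ‖b / a‖ < ‖x‖) :
    charTransform (padicChar p) μ f x = 0 := by
  obtain ⟨y₀, hy₀, h1⟩ : ∃ y₀ : K, ‖y₀‖ ≤ ‖a‖ ∧ addCharTr (padicChar p) (x * y₀) ≠ 1 := by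
    by_contra! h
    exact hx.not_ge ((hb.forall_iff ha).1 h)
  have h2 := integral_add_right_eq_self (μ := μ)
    (fun y => f y * addCharTr (padicChar p) (-(x * y))) (-y₀)
  have h3 : ∀ y, f (y + -y₀) * addCharTr (padicChar p) (-(x * (y + -y₀)))
      = addCharTr (padicChar p) (x * y₀) * (f y * addCharTr (padicChar p) (-(x * y))) := fun y => by
    rw [hf _ _ (by rwa [norm_neg]), show -(x * (y + -y₀)) = x * y₀ + -(x * y) by ring,
      addCharTr_add]
    ring
  simp only [h3] at h2
  rw [integral_const_mul] at h2
  by_contra h4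
  exact h1 (mul_right_cancel₀ h4 (h2.trans (one_mul _).symm))

/-- The transform exchanges the two conditions: bounded support becomes local constancy, and the
period of f bounds the support. -/
theorem isBruhat_charTransform {f : K → ℂ} (hf : IsBruhat f) :
    IsBruhat (charTransform (padicChar p) μ f) := by
  obtain ⟨r, hr, h1⟩ := hf.exists_period
  obtain ⟨R, h2⟩ := hf.exists_support
  constructor
  · obtain ⟨c, hc0, hc⟩ := exists_lt_norm_of_padic p K R
    refine ⟨‖b / c‖, norm_pos_iff.2 (div_ne_zero hb.1 hc0), fun x y hy => ?_⟩
    refine integral_congr_ae (Filter.Eventually.of_forall fun z => ?_)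
    beta_reduce
    rcases le_or_gt ‖z‖ ‖c‖ with hz | hz
    · rw [add_mul, neg_add, addCharTr_add, ← mul_neg y, (hb.forall_iff hc0).2 hy _ (by
        rwa [norm_neg]), mul_one]
    · rw [h2 z (hc.trans hz), zero_mul, zero_mul]
  · obtain ⟨a, ha0, ha⟩ := exists_norm_lt_of_padic p K hr
    exact ⟨‖b / a‖, fun x hx => hb.charTransform_eq_zero ha0
      (fun x y hy => h1 x y (hy.trans ha.le)) hx⟩

end IsConductor

end BruhatTransform

/-! ### Density of the locally constant functions in L² -/

section BruhatDense

set_option linter.unusedSectionVars false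

variable (p : ℕ) [Fact p.Prime] {K : Type*} [NormedField K] [NormedAlgebra ℚ_[p] K]

/-- The closed ball of radius `r` as a subgroup. -/
def ballSubgroup (K : Type*) [NormedField K] [NormedAlgebra ℚ_[p] K] {r : ℝ} (hr : 0 ≤ r) :
    AddSubgroup K where
  carrier := {x | ‖x‖ ≤ r}
  zero_mem' := by simpa using hr
  add_mem' hx hy := (norm_add_le_max_padic p _ _).trans (max_le hx hy)
  neg_mem' {x} hx := by
    change ‖-x‖ ≤ r
    rwa [norm_neg]

include p in
-- Replace g(x) by its value at a representative of the coset of x modulo a small ball. The radius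
-- is also kept at most R, so that cosets of points outside the large ball do not meet it.
theorem exists_isBruhat_norm_sub_le {g : K → ℂ} (hg : Continuous g)
    (hs : HasCompactSupport g) {ε : ℝ} (hε : 0 < ε) {R : ℝ} (hR : 0 < R)
    (hsupp : ∀ x, R < ‖x‖ → g x = 0) :
    ∃ h : K → ℂ, IsBruhat h ∧ (∀ x, R < ‖x‖ → h x = 0) ∧ ∀ x, ‖h x - g x‖ ≤ ε := by
  obtain ⟨δ, hδ, h1⟩ := Metric.uniformContinuous_iff.1 (hs.uniformContinuous_of_continuous hg) ε hε
  set r := min (δ / 2) R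
  have hr : 0 < r := lt_min (half_pos hδ) hR
  set V := ballSubgroup p K hr.le
  set s : K → K := fun x => (QuotientAddGroup.mk x : K ⧸ V).out
  have hs1 : ∀ x, ‖-s x + x‖ ≤ r := fun x => by
    have h2 : (QuotientAddGroup.mk (s x) : K ⧸ V) = QuotientAddGroup.mk x :=
      Quotient.out_eq _
    exact QuotientAddGroup.eq.1 h2
  have hs2 : ∀ x y, ‖y‖ ≤ r → s (x + y) = s x := fun x y hy => by
    have h2 : (QuotientAddGroup.mk (x + y) : K ⧸ V) = QuotientAddGroup.mk x := by
      refine QuotientAddGroup.eq.2 ?_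
      change ‖-(x + y) + x‖ ≤ r
      rwa [neg_add_rev, neg_add_cancel_right, norm_neg]
    simp only [s, h2]
  have hs3 : ∀ x, R < ‖x‖ → g (s x) = 0 := fun x hx => by
    refine hsupp _ ?_
    by_contra! h3
    have := norm_add_le_max_padic p (s x) (-s x + x)
    rw [add_neg_cancel_left] at this
    exact hx.not_ge (this.trans (max_le h3 ((hs1 x).trans (min_le_right _ _))))
  refine ⟨fun x => g (s x), ⟨⟨r, hr, fun x y hy => by rw [hs2 x y hy]⟩, ⟨R, hs3⟩⟩, hs3, fun x => ?_⟩
  rw [← dist_eq_norm]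
  refine (h1 ?_).le
  rw [dist_eq_norm, ← norm_neg, neg_sub, ← neg_add_eq_sub]
  exact (hs1 x).trans_lt ((min_le_left _ _).trans_lt (half_lt_self hδ))

variable [ProperSpace K] [MeasurableSpace K] [BorelSpace K] (μ : Measure K) [μ.IsAddHaarMeasure]

include p in
-- Continuous functions of compact support are dense. Uniform approximation within one fixed ball is
-- also L² approximation, its measure being finite.
theorem denseRange_bruhatToLp : DenseRange (bruhatToLp (K := K) μ) := by
  classical
  rw [Metric.denseRange_iff]
  intro f ε hε
  have h2 : (ENNReal.ofReal (ε / 3)) ≠ 0 := by simpa using by positivity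
  obtain ⟨g, hs, hg, hc, hmem⟩ := (Lp.memLp f).exists_hasCompactSupport_eLpNorm_sub_le
    (by simp) h2
  obtain ⟨R₀, hR₀⟩ := hs.isCompact.isBounded.subset_closedBall 0
  set R := max R₀ 1
  have hR : 0 < R := lt_max_of_lt_right one_pos
  have hsupp : ∀ x, R < ‖x‖ → g x = 0 := fun x hx => by
    refine image_eq_zero_of_notMem_tsupport fun h => ?_
    have := mem_closedBall_zero_iff.1 (hR₀ h)
    exact hx.not_ge (this.trans (le_max_left _ _))
  set M := μ (Metric.closedBall (0 : K) R) ^ (1 / (2 : ℝ≥0∞).toReal)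
  have hM : M ≠ ⊤ := ENNReal.rpow_ne_top_of_nonneg (by positivity) measure_closedBall_lt_top.ne
  obtain ⟨η, hη, hηM⟩ : ∃ η : ℝ, 0 < η ∧ ENNReal.ofReal η * M ≤ ENNReal.ofReal (ε / 3) := by
    refine ⟨ε / 3 / (M.toReal + 1), by positivity, ?_⟩
    rw [← ENNReal.ofReal_toReal hM, ← ENNReal.ofReal_mul (by positivity)]
    refine ENNReal.ofReal_le_ofReal ?_
    rw [ENNReal.toReal_ofReal ENNReal.toReal_nonneg, div_mul_eq_mul_div, div_le_iff₀ (by positivity)]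
    nlinarith [ENNReal.toReal_nonneg (a := M)]
  obtain ⟨h, hh, hsh, hgh⟩ := exists_isBruhat_norm_sub_le p hc hs hη hR hsupp
  have h3 : eLpNorm (h - g) 2 μ ≤ ENNReal.ofReal (ε / 3) := by
    refine le_trans ?_ hηM
    have h4 : eLpNorm (h - g) 2 μ
        ≤ eLpNorm ((Metric.closedBall (0 : K) R).indicator fun _ => η) 2 μ := by
      refine eLpNorm_mono_real fun x => ?_
      rw [Set.indicator_apply]
      split_ifs with hx
      · exact hgh x
      · rw [mem_closedBall_zero_iff, not_le] at hx
        rw [Pi.sub_apply, hsh x hx, hsupp x hx, sub_zero, norm_zero]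
    refine h4.trans (le_of_eq ?_)
    rw [eLpNorm_indicator_const Metric.isClosed_closedBall.measurableSet (by norm_num) (by norm_num),
      ← ofReal_norm, Real.norm_of_nonneg hη.le]
  refine ⟨⟨h, hh⟩, ?_⟩
  have h5 : dist f (bruhatToLp μ ⟨h, hh⟩) ≤ ε / 3 + ε / 3 := by
    rw [Lp.dist_def]
    refine ENNReal.toReal_le_of_le_ofReal (by positivity) ?_
    rw [ENNReal.ofReal_add (by positivity) (by positivity)]
    have h6 : eLpNorm (⇑f - ⇑(bruhatToLp μ ⟨h, hh⟩)) 2 μ = eLpNorm ((⇑f - g) - (h - g)) 2 μ := by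
      refine eLpNorm_congr_ae ?_
      filter_upwards [(IsBruhat.memLp μ hh 2).coeFn_toLp] with x hx
      rw [Pi.sub_apply, Pi.sub_apply, Pi.sub_apply, Pi.sub_apply, sub_sub_sub_cancel_right]
      congr 1
    rw [h6]
    refine (eLpNorm_sub_le ((Lp.aestronglyMeasurable f).sub hc.aestronglyMeasurable)
      (hh.continuous.sub hc).aestronglyMeasurable (by norm_num)).trans (add_le_add hg h3)
  linarith

end BruhatDense

/-! ### The Plancherel theorem at a finite place -/

section PadicFourier

set_option linter.unusedSectionVars false

variable {p : ℕ} [Fact p.Prime] {K : Type*} [NormedField K] [NormedAlgebra ℚ_[p] K]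
  [FiniteDimensional ℚ_[p] K] [MeasurableSpace K] [BorelSpace K] {μ : Measure K}
  [μ.IsAddHaarMeasure]

theorem IsPlace.measure_norm_le (P : IsPlace ℚ_[p] K μ (padicChar p)) {a : K} (ha : a ≠ 0) :
    μ {x | ‖x‖ ≤ ‖a‖} = ENNReal.ofReal (absv ℚ_[p] a) * μ {x | ‖x‖ ≤ 1} := by
  have h := P.map_mul_left a⁻¹ (inv_ne_zero ha)
  have h1 := congrArg (fun ν => ν {x : K | ‖x‖ ≤ 1}) h
  beta_reduce at h1
  rw [Measure.map_apply (measurable_const_mul _)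
    (isClosed_le continuous_norm continuous_const).measurableSet, absv_inv, inv_inv] at h1
  rw [← smul_eq_mul, ← Measure.smul_apply, ← h1]
  congr 1
  ext x
  rw [Set.mem_preimage, Set.mem_ofPred_eq, Set.mem_ofPred_eq, norm_mul, norm_inv,
    inv_mul_le_one₀ (norm_pos_iff.2 ha)]

variable (P : IsPlace ℚ_[p] K μ (padicChar p)) {b : K} (hb : IsConductor p K b)
  [ProperSpace K] (hself : IsSelfDualNormalized (padicChar p) μ)

section

include P hb hself

/-- The ball of radius ‖a‖ and its annihilator scale by |a| and |a|⁻¹, so the product of their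
volumes is the normalized one for a = 1. -/
theorem measure_ball_mul_measure_dual_ball {a : K} (ha : a ≠ 0) :
    μ {x | ‖x‖ ≤ ‖b / a‖} * μ {x | ‖x‖ ≤ ‖a‖} = 1 := by
  have h1 : {x : K | ∀ y : K, ‖y‖ ≤ 1 → addCharTr (padicChar p) (x * y) = 1} = {x | ‖x‖ ≤ ‖b‖} :=
    Set.ext hb.2
  rw [IsSelfDualNormalized, h1, P.measure_norm_le hb.1] at hself
  have h2 : absv ℚ_[p] b = absv ℚ_[p] (b / a) * absv ℚ_[p] a := by
    rw [← absv_mul, div_mul_cancel₀ _ ha]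
  rw [P.measure_norm_le ha, P.measure_norm_le (div_ne_zero hb.1 ha), ← hself, h2,
    ENNReal.ofReal_mul (absv_nonneg _ _)]
  ring

/-- Fourier inversion. -/
theorem charTransform_charTransform {f : K → ℂ} (hf : IsBruhat f) (x : K) :
    charTransform (padicChar p) μ (charTransform (padicChar p) μ f) x = f (-x) := by
  obtain ⟨r, hr, h1⟩ := hf.exists_period
  obtain ⟨a, ha0, ha⟩ := exists_norm_lt_of_padic p K hr
  have hba : b / a ≠ 0 := div_ne_zero hb.1 ha0
  have hper : ∀ x y : K, ‖y‖ ≤ ‖a‖ → f (x + y) = f x := fun x y hy => h1 x y (hy.trans ha.le)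
  set V : Set K := {z | ‖z‖ ≤ ‖b / a‖} with hV
  have hVm : MeasurableSet V := (isClosed_le continuous_norm continuous_const).measurableSet
  have hVfin : μ V ≠ ⊤ := by
    have : V = Metric.closedBall 0 ‖b / a‖ := by ext; simp [hV]
    rw [this]
    exact measure_closedBall_lt_top.ne
  set W : Set K := {z | ‖z‖ ≤ ‖a‖} with hW
  have hWm : MeasurableSet W := (isClosed_le continuous_norm continuous_const).measurableSet
  -- The transform of f lives on V, so the exponential may be cut off there without change. The
  -- cutoff makes it integrable, as the multiplication formula requires.
  set g : K → ℂ := V.indicator fun z => addCharTr (padicChar p) (-(x * z)) with hg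
  have hgi : Integrable g μ := by
    refine (integrable_indicator_iff hVm).2 ?_
    refine IntegrableOn.of_bound hVfin.lt_top ?_ 1 (Filter.Eventually.of_forall fun z => ?_)
    · exact (P.continuous_char.comp (by fun_prop)).aestronglyMeasurable
    · exact (P.norm_char _).le
  have h2 : ∀ z, charTransform (padicChar p) μ f z * g z
      = charTransform (padicChar p) μ f z * addCharTr (padicChar p) (-(x * z)) := fun z => by
    rw [hg, Set.indicator_apply]
    split_ifs with hz
    · rfl
    · rw [hb.charTransform_eq_zero ha0 hper (not_le.1 hz), zero_mul, zero_mul]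
  -- The transform of g is μ(V) times the indicator of the small ball around -x, on which f is
  -- constant.
  have h3 : ∀ y, charTransform (padicChar p) μ g y
      = if ‖x + y‖ ≤ ‖a‖ then ((μ V).toReal : ℂ) else 0 := fun y => by
    have h4 : charTransform (padicChar p) μ g y
        = charTransform (padicChar p) μ (V.indicator fun _ => 1) (x + y) := by
      refine integral_congr_ae (Filter.Eventually.of_forall fun z => ?_)
      simp only [hg, Set.indicator_apply]
      split_ifs
      · rw [← addCharTr_add, one_mul]
        congr 1
        ring
      · rw [zero_mul, zero_mul]
    rw [h4]
    split_ifs with h5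
    · have h6 : ∀ z, V.indicator (fun _ => (1 : ℂ)) z * addCharTr (padicChar p) (-((x + y) * z))
          = V.indicator (fun _ => (1 : ℂ)) z := fun z => by
        rw [Set.indicator_apply]
        split_ifs with hz
        · rw [one_mul, ← mul_neg]
          refine (hb.forall_iff hba).2 ?_ _ (by rwa [norm_neg])
          rwa [div_div_cancel₀ hb.1]
        · rw [zero_mul]
      rw [charTransform]
      simp only [h6]
      rw [integral_indicator_const _ hVm]
      simp [Measure.real]
    · refine hb.charTransform_eq_zero hba (fun z w hw => ?_) (by
        rw [div_div_cancel₀ hb.1]; exact not_le.1 h5)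
      have h6 : z + w ∈ V ↔ z ∈ V := by
        constructor
        · intro h
          have := norm_add_le_max_padic p (z + w) (-w)
          rw [add_neg_cancel_right, norm_neg] at this
          exact this.trans (max_le h hw)
        · intro h
          exact (norm_add_le_max_padic p z w).trans (max_le h hw)
      by_cases h7 : z ∈ V
      · rw [Set.indicator_of_mem h7, Set.indicator_of_mem (h6.2 h7)]
      · rw [Set.indicator_of_notMem h7, Set.indicator_of_notMem (mt h6.1 h7)]
  have h4 := P.integral_charTransform_mul (hf.integrable μ) hgi
  simp only [h2, h3] at h4
  rw [charTransform, h4, ← integral_add_left_eq_self _ (-x)]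
  have h5 : ∀ y, f (-x + y) * (if ‖x + (-x + y)‖ ≤ ‖a‖ then ((μ V).toReal : ℂ) else 0)
      = W.indicator (fun _ => f (-x) * ((μ V).toReal : ℂ)) y := fun y => by
    rw [add_neg_cancel_left, Set.indicator_apply]
    by_cases hy : ‖y‖ ≤ ‖a‖
    · rw [if_pos hy, if_pos (show y ∈ W from hy), hper _ _ hy]
    · rw [if_neg hy, if_neg (show y ∉ W from hy), mul_zero]
  simp only [h5]
  rw [integral_indicator_const _ hWm, Measure.real, Complex.real_smul]
  have h6 : (((μ V).toReal : ℝ) : ℂ) * ((μ W).toReal : ℝ) = 1 := by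
    rw [← Complex.ofReal_mul, ← ENNReal.toReal_mul,
      measure_ball_mul_measure_dual_ball P hb hself ha0, ENNReal.toReal_one, Complex.ofReal_one]
  linear_combination (f (-x)) * h6

/-- The transform as an automorphism of the space of locally constant functions of compact
support. -/
def bruhatTransform : bruhat K ≃ₗ[ℂ] bruhat K where
  toFun f := ⟨charTransform (padicChar p) μ f.1, hb.isBruhat_charTransform f.2⟩
  map_add' f g := Subtype.ext <| funext fun x => by
    have h : ∀ f : bruhat K, Integrable (fun y => f.1 y * addCharTr (padicChar p) (-(x * y))) μ :=
      fun f => (IsBruhat.integrable μ f.2).mul_bdd (c := 1)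
        (P.continuous_char.comp (by fun_prop)).aestronglyMeasurable
        (Filter.Eventually.of_forall fun y => (P.norm_char _).le)
    change charTransform _ μ (f.1 + g.1) x = charTransform _ μ f.1 x + charTransform _ μ g.1 x
    rw [charTransform, charTransform, charTransform, ← integral_add (h f) (h g)]
    simp only [Pi.add_apply, add_mul]
  map_smul' c f := Subtype.ext <| funext fun x => by
    change charTransform _ μ (c • f.1) x = c * charTransform _ μ f.1 x
    rw [charTransform, charTransform, ← integral_const_mul]
    simp only [Pi.smul_apply, smul_eq_mul, mul_assoc]
  invFun f := ⟨fun x => charTransform (padicChar p) μ f.1 (-x),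
    (hb.isBruhat_charTransform f.2).comp_neg⟩
  left_inv f := Subtype.ext <| funext fun x => by
    change charTransform _ μ (charTransform _ μ f.1) (-x) = f.1 x
    rw [charTransform_charTransform P hb hself f.2, neg_neg]
  right_inv f := Subtype.ext <| funext fun x => by
    change charTransform _ μ (fun x => charTransform _ μ f.1 (-x)) x = f.1 x
    have h := charTransform_charTransform P hb hself f.2 (-x)
    rw [neg_neg] at h
    rw [← h, charTransform, charTransform, ← integral_neg_eq_self]
    simp only [neg_neg, mul_neg, neg_mul]

end

end PadicFourier

/-! ### Parseval's relation and the unitary extension to L² -/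

section PadicPlancherel

set_option linter.unusedSectionVars false

variable {p : ℕ} [Fact p.Prime] {K : Type*} [NormedField K] [NormedAlgebra ℚ_[p] K]
  [FiniteDimensional ℚ_[p] K] [MeasurableSpace K] [BorelSpace K] {μ : Measure K}
  [μ.IsAddHaarMeasure]

theorem conj_addCharTr (x : K) :
    starRingEnd ℂ (addCharTr (padicChar p) x) = addCharTr (padicChar p) (-x) := by
  have h1 := addCharTr_add p x (-x)
  rw [add_neg_cancel, addCharTr_zero] at h1
  have h2 := Complex.mul_conj' (addCharTr (padicChar p) x)
  rw [norm_addCharTr, Complex.ofReal_one, one_pow] at h2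
  have h3 : addCharTr (padicChar p) x ≠ 0 := norm_ne_zero_iff.1 (by rw [norm_addCharTr]; simp)
  exact mul_left_cancel₀ h3 (h2.trans h1)

variable (P : IsPlace ℚ_[p] K μ (padicChar p)) {b : K} (hb : IsConductor p K b)
  [ProperSpace K] (hself : IsSelfDualNormalized (padicChar p) μ)

theorem inner_bruhatToLp (g : bruhat K) (f : Lp ℂ 2 μ) :
    inner ℂ (bruhatToLp μ g) f = ∫ x, starRingEnd ℂ (g.1 x) * f x ∂μ := by
  rw [L2.inner_def]
  refine integral_congr_ae ?_
  filter_upwards [(IsBruhat.memLp μ g.2 2).coeFn_toLp] with x hx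
  rw [RCLike.inner_apply, mul_comm]
  congr 2

theorem charTransform_conj (f : K → ℂ) (x : K) :
    charTransform (padicChar p) μ (fun y => starRingEnd ℂ (f y)) x
      = starRingEnd ℂ (charTransform (padicChar p) μ f (-x)) := by
  rw [charTransform, charTransform, ← integral_conj]
  simp only [map_mul, conj_addCharTr, neg_mul, neg_neg]

include P hb hself

/-- Apply the multiplication formula to f and the conjugate of the transform of g; inversion returns
the conjugate of g. -/
theorem inner_bruhatTransform (f g : bruhat K) :
    inner ℂ (bruhatToLp μ (bruhatTransform P hb hself g))
      (bruhatToLp μ (bruhatTransform P hb hself f)) = inner ℂ (bruhatToLp μ g) (bruhatToLp μ f) := by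
  have h1 : ∀ g f : bruhat K, inner ℂ (bruhatToLp μ g) (bruhatToLp μ f)
      = ∫ x, f.1 x * starRingEnd ℂ (g.1 x) ∂μ := fun g f => by
    rw [inner_bruhatToLp]
    refine integral_congr_ae ?_
    filter_upwards [(IsBruhat.memLp μ f.2 2).coeFn_toLp] with x hx
    rw [mul_comm]
    congr 1
  rw [h1, h1]
  have hg := hb.isBruhat_charTransform (μ := μ) g.2
  refine (P.integral_charTransform_mul (IsBruhat.integrable μ f.2)
    (IsBruhat.integrable μ (hg.comp_map (map_zero (starRingEnd ℂ))))).trans ?_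
  congr 1
  ext x
  rw [charTransform_conj, charTransform_charTransform P hb hself g.2, neg_neg]

theorem norm_bruhatTransform (f : bruhat K) :
    ‖bruhatToLp μ (bruhatTransform P hb hself f)‖ = ‖bruhatToLp μ f‖ := by
  have h := inner_bruhatTransform P hb hself f f
  rw [inner_self_eq_norm_sq_to_K, inner_self_eq_norm_sq_to_K] at h
  exact (pow_left_inj₀ (norm_nonneg _) (norm_nonneg _) two_ne_zero).1 (by exact_mod_cast h)

/-- The Fourier transform on `L²`. -/
def padicFourier : Lp ℂ 2 μ ≃ₗᵢ[ℂ] Lp ℂ 2 μ :=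
  (bruhatTransform P hb hself).extendOfIsometry (bruhatToLp μ) (bruhatToLp μ)
    (denseRange_bruhatToLp p μ) (denseRange_bruhatToLp p μ) (norm_bruhatTransform P hb hself)

theorem padicFourier_bruhatToLp (f : bruhat K) :
    padicFourier P hb hself (bruhatToLp μ f) = bruhatToLp μ (bruhatTransform P hb hself f) :=
  LinearEquiv.extendOfIsometry_eq _ _ _ _ _ _ _

/-- The extension and the integral have the same pairings with all locally constant functions of
compact support, by Parseval's relation. These determine the functions almost everywhere. -/
theorem isFourierTransform_padicFourier :
    IsFourierTransform (padicChar p) (padicFourier P hb hself) := by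
  intro f hf
  set F := padicFourier P hb hself
  change F f =ᵐ[μ] charTransform (padicChar p) μ f
  have hcont : Continuous (charTransform (padicChar p) μ f) := by
    refine continuous_of_dominated (bound := fun y => ‖f y‖) (fun x => ?_)
      (fun x => Filter.Eventually.of_forall fun y => ?_) hf.norm
      (Filter.Eventually.of_forall fun y => ?_)
    · exact hf.1.mul (P.continuous_char.comp (by fun_prop)).aestronglyMeasurable
    · rw [norm_mul, P.norm_char, mul_one]
    · exact continuous_const.mul (P.continuous_char.comp (by fun_prop))
  have hbdd : ∀ x, ‖charTransform (padicChar p) μ f x‖ ≤ ∫ y, ‖f y‖ ∂μ := fun x => by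
    refine (norm_integral_le_integral_norm _).trans (le_of_eq ?_)
    simp only [norm_mul, P.norm_char, mul_one]
  -- Parseval's relation for `F` against locally constant functions
  have key : ∀ (g : bruhat K) (f : Lp ℂ 2 μ), inner ℂ (bruhatToLp μ g) (F f)
      = ∫ x, f x * charTransform (padicChar p) μ (fun y => starRingEnd ℂ (g.1 y)) x ∂μ := by
    intro g f
    set g' := (bruhatTransform P hb hself).symm g
    have h1 : inner ℂ (bruhatToLp μ g) (F f) = inner ℂ (bruhatToLp μ g') f := by
      have h2 : F (bruhatToLp μ g') = bruhatToLp μ g := by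
        rw [padicFourier_bruhatToLp, LinearEquiv.apply_symm_apply]
      rw [← h2, LinearIsometryEquiv.inner_map_map]
    rw [h1, inner_bruhatToLp]
    refine integral_congr_ae (Filter.Eventually.of_forall fun x => ?_)
    beta_reduce
    rw [charTransform_conj, mul_comm]
    rfl
  have key2 : ∀ g : bruhat K,
      ∫ x, starRingEnd ℂ (g.1 x) * (F f x - charTransform (padicChar p) μ f x) ∂μ = 0 := fun g => by
    have hg : IsBruhat fun x => starRingEnd ℂ (g.1 x) :=
      IsBruhat.comp_map g.2 (map_zero (starRingEnd ℂ))
    have h1 := key g f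
    rw [← P.integral_charTransform_mul hf (hg.integrable μ), inner_bruhatToLp] at h1
    have h2 : Integrable (fun x => starRingEnd ℂ (g.1 x) * F f x) μ :=
      (hg.memLp μ 2).integrable_mul (Lp.memLp (F f))
    have h3 : Integrable (fun x => starRingEnd ℂ (g.1 x) * charTransform (padicChar p) μ f x) μ :=
      (hg.integrable μ).mul_bdd (c := ∫ y, ‖f y‖ ∂μ) hcont.aestronglyMeasurable
        (Filter.Eventually.of_forall hbdd)
    simp only [mul_sub]
    rw [integral_sub h2 h3, h1, sub_eq_zero]
    simp only [mul_comm]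
  -- The integral is known only to be bounded and continuous. On a ball the difference is square
  -- integrable, and orthogonality to the dense subspace applies.
  have key3 : ∀ c : K, c ≠ 0 → ∀ᵐ x ∂μ, ‖x‖ ≤ ‖c‖ → F f x = charTransform (padicChar p) μ f x := by
    intro c hc
    set V : Set K := {x | ‖x‖ ≤ ‖c‖} with hV
    have hVm : MeasurableSet V := (isClosed_le continuous_norm continuous_const).measurableSet
    have hVfin : μ V ≠ ⊤ := by
      have : V = Metric.closedBall 0 ‖c‖ := by ext; simp [hV]
      rw [this]
      exact measure_closedBall_lt_top.ne
    have hd : MemLp (V.indicator fun x => F f x - charTransform (padicChar p) μ f x) 2 μ := by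
      have h1 : MemLp (V.indicator (charTransform (padicChar p) μ f)) 2 μ := by
        rw [memLp_indicator_iff_restrict hVm]
        have : IsFiniteMeasure (μ.restrict V) := ⟨by simpa using hVfin.lt_top⟩
        exact MemLp.of_bound hcont.aestronglyMeasurable _ (Filter.Eventually.of_forall hbdd)
      have h2 := ((Lp.memLp (F f)).indicator hVm).sub h1
      rwa [← Set.indicator_sub'] at h2
    have h0 : hd.toLp = 0 := by
      refine Dense.eq_zero_of_inner_right (𝕜 := ℂ) (denseRange_bruhatToLp p μ) ?_
      rintro _ ⟨g, rfl⟩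
      have hg : IsBruhat (V.indicator g.1) := by
        obtain ⟨r, hr, h1⟩ := IsBruhat.exists_period g.2
        obtain ⟨R, h2⟩ := IsBruhat.exists_support g.2
        refine ⟨⟨min r ‖c‖, lt_min hr (norm_pos_iff.2 hc), fun x y hy => ?_⟩, ⟨R, fun x hx => ?_⟩⟩
        · have h6 : x + y ∈ V ↔ x ∈ V := by
            constructor
            · intro h
              have := norm_add_le_max_padic p (x + y) (-y)
              rw [add_neg_cancel_right, norm_neg] at this
              exact this.trans (max_le h (hy.trans (min_le_right _ _)))
            · intro h
              exact (norm_add_le_max_padic p x y).trans (max_le h (hy.trans (min_le_right _ _)))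
          by_cases h7 : x ∈ V
          · rw [Set.indicator_of_mem h7, Set.indicator_of_mem (h6.2 h7),
              h1 x y (hy.trans (min_le_left _ _))]
          · rw [Set.indicator_of_notMem h7, Set.indicator_of_notMem (mt h6.1 h7)]
        · by_cases h7 : x ∈ V
          · rw [Set.indicator_of_mem h7, h2 x hx]
          · rw [Set.indicator_of_notMem h7]
      rw [inner_bruhatToLp, ← key2 ⟨_, hg⟩]
      refine integral_congr_ae ?_
      filter_upwards [hd.coeFn_toLp] with x hx
      rw [hx]
      by_cases h7 : x ∈ V
      · rw [Set.indicator_of_mem h7, Set.indicator_of_mem h7]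
      · rw [Set.indicator_of_notMem h7, Set.indicator_of_notMem h7, mul_zero, map_zero, zero_mul]
    have h4 := hd.coeFn_toLp
    rw [h0] at h4
    filter_upwards [h4, Lp.coeFn_zero ℂ 2 μ] with x hx hx0 hxc
    rw [hx0, Pi.zero_apply, Set.indicator_of_mem (show x ∈ V from hxc)] at hx
    exact sub_eq_zero.1 hx.symm
  obtain ⟨c, hc⟩ : ∃ c : ℕ → K, ∀ n, c n ≠ 0 ∧ (n : ℝ) < ‖c n‖ := by
    choose c hc using fun n : ℕ => exists_lt_norm_of_padic p K n
    exact ⟨c, hc⟩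
  have h5 := ae_all_iff.2 fun n => key3 (c n) (hc n).1
  filter_upwards [h5] with x hx
  obtain ⟨n, hn⟩ := exists_nat_ge ‖x‖
  exact hx n (hn.trans (hc n).2.le)

end PadicPlancherel

/-! ### Characters are locally constant on the units -/

section LocallyConstantChar

/-- The circle has no small subgroups: as long as the powers stay near 1, each squaring multiplies
the distance to 1 by at least 3/2. -/
theorem eq_one_of_forall_norm_pow_sub_one_lt {z : ℂ}
    (h : ∀ n : ℕ, ‖z ^ 2 ^ n - 1‖ < 1 / 2) : z = 1 := by
  by_contra hz
  have h0 : 0 < ‖z - 1‖ := norm_pos_iff.2 (sub_ne_zero.2 hz)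
  have h1 : ∀ n : ℕ, (3 / 2 : ℝ) ^ n * ‖z - 1‖ ≤ ‖z ^ 2 ^ n - 1‖ := fun n => by
    induction n with
    | zero => simp
    | succ n ih =>
      have h2 : z ^ 2 ^ (n + 1) - 1 = (z ^ 2 ^ n - 1) * (z ^ 2 ^ n + 1) := by
        rw [pow_succ, pow_mul]
        ring
      have h3 : 3 / 2 ≤ ‖z ^ 2 ^ n + 1‖ := by
        have h4 : (2 : ℂ) = (z ^ 2 ^ n + 1) - (z ^ 2 ^ n - 1) := by ring
        have h5 := norm_sub_le (z ^ 2 ^ n + 1) (z ^ 2 ^ n - 1)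
        rw [← h4, Complex.norm_ofNat] at h5
        linarith [h n]
      rw [h2, norm_mul, pow_succ, mul_right_comm]
      exact mul_le_mul ih h3 (by norm_num) (norm_nonneg _)
  obtain ⟨n, hn⟩ := pow_unbounded_of_one_lt (1 / ‖z - 1‖) (by norm_num : (1 : ℝ) < 3 / 2)
  rw [div_lt_iff₀ h0] at hn
  linarith [h1 n, h n]

variable (p : ℕ) [Fact p.Prime] {K : Type*} [NormedField K] [NormedAlgebra ℚ_[p] K]

include p in
-- In a small ball around 1 repeated squares do not leave the ball, so all values χ(u)^(2^n) stay
-- near 1, which forces χ(u) = 1.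
theorem exists_char_eq_one_of_norm_sub_one_le (χ : Kˣ →ₜ* Circle) :
    ∃ r, 0 < r ∧ r < 1 ∧ ∀ u : Kˣ, ‖(u : K) - 1‖ ≤ r → χ u = 1 := by
  have h1 : ∀ᶠ u : Kˣ in nhds 1, ‖(χ u : ℂ) - 1‖ < 1 / 2 := by
    have hc : Continuous fun u => ‖(χ u : ℂ) - 1‖ :=
      ((continuous_subtype_val.comp χ.continuous_toFun).sub continuous_const).norm
    have h0 : ‖(χ 1 : ℂ) - 1‖ < 1 / 2 := by
      rw [map_one, Circle.coe_one, sub_self, norm_zero]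
      norm_num
    exact hc.continuousAt.eventually_lt_const h0
  rw [Units.isEmbedding_val₀.nhds_eq_comap, Filter.eventually_comap] at h1
  obtain ⟨ε, hε, h2⟩ := Metric.eventually_nhds_iff.1 h1
  refine ⟨min (ε / 2) (1 / 2), by positivity, (min_le_right _ _).trans_lt (by norm_num),
    fun u hu => Subtype.ext ?_⟩
  set r := min (ε / 2) (1 / 2)
  have hr1 : r < 1 := (min_le_right _ _).trans_lt (by norm_num)
  refine eq_one_of_forall_norm_pow_sub_one_lt fun n => ?_
  have h3 : ∀ n : ℕ, ‖((u ^ 2 ^ n : Kˣ) : K) - 1‖ ≤ r := fun n => by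
    induction n with
    | zero => simpa using hu
    | succ n ih =>
      have h5 := norm_eq_one_of_norm_sub_one_lt p (ih.trans_lt hr1)
      have h4 : ((u ^ 2 ^ (n + 1) : Kˣ) : K) - 1 = (((u ^ 2 ^ n : Kˣ) : K) - 1) *
          (((u ^ 2 ^ n : Kˣ) : K) + 1) := by
        rw [pow_succ, pow_mul]
        push_cast
        ring
      have h6 := norm_add_le_max_padic p ((u ^ 2 ^ n : Kˣ) : K) 1
      rw [h5, norm_one, max_self] at h6
      rw [h4, norm_mul]
      exact (mul_le_of_le_one_right (norm_nonneg _) h6).trans ih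
  have h7 := h2 (y := ((u ^ 2 ^ n : Kˣ) : K)) (by
    rw [dist_eq_norm, Units.val_one]
    exact (h3 n).trans_lt ((min_le_left _ _).trans_lt (half_lt_self hε))) _ rfl
  rwa [map_pow, Circle.coe_pow] at h7

end LocallyConstantChar

/-! ### The image of `dy / |y|` under `log |·|` at a finite place -/

section PadicOrd

set_option linter.unusedSectionVars false

variable {p : ℕ} [Fact p.Prime] {K : Type*} [NormedField K] [NormedAlgebra ℚ_[p] K]

variable (p) in
/-- The integer `m` with `|y| = |b| ^ m`. -/
def ord (b y : K) : ℤ := round (lg ℚ_[p] y / lg ℚ_[p] b)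

variable [FiniteDimensional ℚ_[p] K] {b : K} (hb : IsGenerator p b)

namespace IsGenerator

include hb

theorem lg_eq {y : K} (hy : y ≠ 0) : lg ℚ_[p] y = ord p b y * lg ℚ_[p] b := by
  obtain ⟨m, hm⟩ := hb.exists_lg_eq hy
  rw [ord, hm, hb.round_mul_div]

theorem ord_eq_iff {y : K} (hy : y ≠ 0) {m : ℤ} :
    ord p b y = m ↔ lg ℚ_[p] y = m * lg ℚ_[p] b := by
  rw [hb.lg_eq hy, mul_left_inj' hb.lg_pos.ne', Int.cast_inj]

theorem ord_eq_zero_iff {y : K} (hy : y ≠ 0) : ord p b y = 0 ↔ absv ℚ_[p] y = 1 := by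
  rw [hb.ord_eq_iff hy, Int.cast_zero, zero_mul]
  constructor
  · intro h
    rw [← exp_lg ℚ_[p] hy, h, Real.exp_zero]
  · intro h
    rw [lg, h, Real.log_one]

variable [MeasurableSpace K] [BorelSpace K] {μ : Measure K} [μ.IsAddHaarMeasure]

theorem measurable_ord : Measurable (ord p b) := by
  have h : Measurable (lg ℚ_[p] : K → ℝ) := (continuous_absv (k := ℚ_[p])).measurable.log
  rw [show ord p b = fun y : K => ⌊lg ℚ_[p] y / lg ℚ_[p] b + 1 / 2⌋ from
    funext fun y => round_eq _]
  exact Int.measurable_floor.comp ((h.div_const _).add_const _)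

omit hb in
theorem measurable_ofReal_inv_absv : Measurable fun y : K => ENNReal.ofReal (absv ℚ_[p] y)⁻¹ :=
  (continuous_absv (k := ℚ_[p])).measurable.inv.ennreal_ofReal

/-- The fibre over m is b^m times the units, and dy/|y| is invariant under multiplication, so all
fibres have the volume of the units. -/
theorem map_ord : (μ.withDensity fun y => ENNReal.ofReal (absv ℚ_[p] y)⁻¹).map (ord p b)
    = μ {y | absv ℚ_[p] y = 1} • Measure.count := by
  have P := hb.isPlace μ
  have hm : Measurable (ord p b) := hb.measurable_ord
  refine Measure.ext_of_singleton fun m => ?_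
  rw [Measure.map_apply hm (measurableSet_singleton m), withDensity_apply _
    (hm (measurableSet_singleton m)), ← lintegral_indicator (hm (measurableSet_singleton m)),
    Measure.smul_apply, Measure.count_singleton, smul_eq_mul, mul_one]
  have hbm : b ^ m ≠ 0 := zpow_ne_zero _ hb.ne_zero
  have h1 := P.lintegral_mul_left (fun y => (ord p b ⁻¹' {m}).indicator
    (fun y => ENNReal.ofReal (absv ℚ_[p] y)⁻¹) y) hbm
  have hS : MeasurableSet {y : K | absv ℚ_[p] y = 1} :=
    P.measurable_absv (measurableSet_singleton 1)
  have h2 : ∀ᵐ y ∂μ, (ord p b ⁻¹' {m}).indicator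
      (fun y => ENNReal.ofReal (absv ℚ_[p] y)⁻¹) (b ^ m * y)
      = {y : K | absv ℚ_[p] y = 1}.indicator
        (fun _ => ENNReal.ofReal (absv ℚ_[p] (b ^ m))⁻¹) y := by
    filter_upwards [P.ae_ne_zero] with y hy
    have h3 : b ^ m * y ∈ ord p b ⁻¹' {m} ↔ y ∈ {y : K | absv ℚ_[p] y = 1} := by
      rw [Set.mem_preimage, Set.mem_singleton_iff, hb.ord_eq_iff (mul_ne_zero hbm hy),
        lg_mul _ hbm hy, hb.lg_zpow, Set.mem_ofPred_eq, ← hb.ord_eq_zero_iff hy,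
        hb.ord_eq_iff hy, Int.cast_zero, zero_mul, add_eq_left]
    by_cases hy1 : y ∈ {y : K | absv ℚ_[p] y = 1}
    · rw [Set.indicator_of_mem hy1, Set.indicator_of_mem (h3.2 hy1), absv_mul,
        show absv ℚ_[p] y = 1 from hy1, mul_one]
    · rw [Set.indicator_of_notMem hy1, Set.indicator_of_notMem (mt h3.1 hy1)]
  rw [lintegral_congr_ae h2, lintegral_indicator hS, lintegral_const,
    Measure.restrict_apply_univ] at h1
  exact ((ENNReal.mul_right_inj (by simpa using absv_pos _ hbm) ENNReal.ofReal_ne_top).1 h1).symm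

variable (μ) in
theorem measure_absv_eq_one_ne_top : μ {y : K | absv ℚ_[p] y = 1} ≠ ⊤ := by
  have : ProperSpace K := FiniteDimensional.proper ℚ_[p] K
  refine ne_top_of_le_ne_top (measure_closedBall_lt_top (μ := μ) (x := (0 : K)) (r := 1)).ne
    (measure_mono fun y hy => ?_)
  rw [mem_closedBall_zero_iff, (absv_eq_one_iff p).1 hy]

variable (μ) in
theorem measure_absv_eq_one_ne_zero : μ {y : K | absv ℚ_[p] y = 1} ≠ 0 := by
  refine ne_of_gt ((Metric.measure_ball_pos μ (1 : K) one_pos).trans_le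
    (measure_mono fun y hy => ?_))
  rw [mem_ball_iff_norm] at hy
  exact (absv_eq_one_iff p).2 (norm_eq_one_of_norm_sub_one_lt p hy)

variable (μ) in
theorem measure_absv_eq_one_pos : 0 < (μ {y : K | absv ℚ_[p] y = 1}).toReal :=
  ENNReal.toReal_pos (hb.measure_absv_eq_one_ne_zero μ) (hb.measure_absv_eq_one_ne_top μ)

theorem ae_comp_lg (φ : ℝ → ℂ) : ∀ᵐ y ∂μ, φ (lg ℚ_[p] y) = φ (ord p b y * lg ℚ_[p] b) := by
  filter_upwards [(hb.isPlace μ).ae_ne_zero] with y hy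
  rw [hb.lg_eq hy]

variable (μ) in
theorem integrable_comp_ord {a : ℤ → ℂ} (ha : Summable fun m => ‖a m‖) :
    Integrable (fun y => a (ord p b y) * ((absv ℚ_[p] y)⁻¹ : ℝ)) μ := by
  have hm : Measurable (ord p b) := hb.measurable_ord
  have h1 : Integrable a (μ {y : K | absv ℚ_[p] y = 1} • Measure.count) :=
    (Integrable.smul_measure ⟨measurable_from_top.aestronglyMeasurable,
      hasFiniteIntegral_count_iff.2 ha⟩ (hb.measure_absv_eq_one_ne_top μ))
  rw [← hb.map_ord, integrable_map_measure measurable_from_top.aestronglyMeasurable hm.aemeasurable,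
    integrable_withDensity_iff_integrable_smul' measurable_ofReal_inv_absv
      (Filter.Eventually.of_forall fun _ => ENNReal.ofReal_lt_top)] at h1
  refine h1.congr (Filter.Eventually.of_forall fun y => ?_)
  beta_reduce
  rw [ENNReal.toReal_ofReal (inv_nonneg.2 (absv_nonneg _ _)), Complex.real_smul, mul_comm]
  rfl

variable (μ) in
theorem integral_comp_ord {a : ℤ → ℂ} (ha : Summable fun m => ‖a m‖) :
    ∫ y, a (ord p b y) * ((absv ℚ_[p] y)⁻¹ : ℝ) ∂μ
      = (μ {y : K | absv ℚ_[p] y = 1}).toReal * ∑' m, a m := by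
  have hm : Measurable (ord p b) := hb.measurable_ord
  have h1 : Integrable a Measure.count :=
    ⟨measurable_from_top.aestronglyMeasurable, hasFiniteIntegral_count_iff.2 ha⟩
  have h2 : ∫ m, a m ∂Measure.count = ∑' m, a m := by
    rw [integral_countable h1]
    simp [Measure.real]
  rw [← h2, ← Complex.real_smul, ← integral_smul_measure, ← hb.map_ord,
    integral_map hm.aemeasurable measurable_from_top.aestronglyMeasurable,
    integral_withDensity_eq_integral_toReal_smul measurable_ofReal_inv_absv
      (Filter.Eventually.of_forall fun _ => ENNReal.ofReal_lt_top)]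
  refine integral_congr_ae (Filter.Eventually.of_forall fun y => ?_)
  beta_reduce
  rw [ENNReal.toReal_ofReal (inv_nonneg.2 (absv_nonneg _ _)), Complex.real_smul, mul_comm]

end IsGenerator

end PadicOrd

/-! ### The profile class at a finite place -/

section PadicProfile

set_option linter.unusedSectionVars false

variable {p : ℕ} [Fact p.Prime] {K : Type*} [NormedField K] [NormedAlgebra ℚ_[p] K]
  [FiniteDimensional ℚ_[p] K] [MeasurableSpace K] [BorelSpace K] (μ : Measure K)
  [μ.IsAddHaarMeasure]

/-- The measurable functions that decrease rapidly along the multiples of `L`. -/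
structure IsRapidOn (L : ℝ) (φ : ℝ → ℂ) : Prop where
  measurable : Measurable φ
  rapid : IsRapidSeq fun m : ℤ => φ (m * L)

variable {b : K} (hb : IsGenerator p b)
include hb

namespace IsGenerator

theorem logMellin_eq {φ : ℝ → ℂ} (hφ : IsRapidOn (lg ℚ_[p] b) φ) (τ : ℝ) :
    logMellin ℚ_[p] μ φ τ = (μ {y : K | absv ℚ_[p] y = 1}).toReal *
      fourierSum (lg ℚ_[p] b) (fun m => φ (m * lg ℚ_[p] b)) τ := by
  rw [fourierSum, ← hb.integral_comp_ord μ]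
  · refine integral_congr_ae ?_
    filter_upwards [(hb.isPlace μ).ae_ne_zero] with y hy
    rw [hb.lg_eq hy]
    ring
  · simp only [norm_mul, ← Complex.ofReal_mul, Complex.norm_exp_ofReal_mul_I, mul_one]
    exact hφ.rapid.summable_norm

theorem logCorr_eq {κ φ : ℝ → ℂ} (hφ : IsRapidOn (lg ℚ_[p] b) φ) {C : ℝ}
    (hC : ∀ m : ℤ, ‖κ (m * lg ℚ_[p] b)‖ ≤ C) (n : ℤ) :
    logCorr ℚ_[p] μ κ φ (n * lg ℚ_[p] b) = (μ {y : K | absv ℚ_[p] y = 1}).toReal *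
      ∑' m : ℤ, κ ((n + m : ℤ) * lg ℚ_[p] b) * φ (m * lg ℚ_[p] b) := by
  rw [← hb.integral_comp_ord μ]
  · refine integral_congr_ae ?_
    filter_upwards [(hb.isPlace μ).ae_ne_zero] with y hy
    rw [hb.lg_eq hy, Int.cast_add, add_mul]
  · refine Summable.of_nonneg_of_le (fun _ => norm_nonneg _) (fun m => ?_)
      (hφ.rapid.summable_norm.mul_left C)
    rw [norm_mul]
    exact mul_le_mul_of_nonneg_right (hC _) (norm_nonneg _)

/-- The exponential is constant on each fibre of the order, so the integrals of f over the fibres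
are the coefficients. Their absolute summability comes from integrability of f. -/
theorem exists_integral_eq_fourierSum {f : K → ℂ} (hf : Integrable f μ) :
    ∃ a : ℤ → ℂ, (Summable fun m => ‖a m‖) ∧ ∀ τ : ℝ,
      ∫ y, f y * Complex.exp (τ * lg ℚ_[p] y * Complex.I) ∂μ = fourierSum (lg ℚ_[p] b) a τ := by
  have P := hb.isPlace μ
  have hm : ∀ m, MeasurableSet (ord p b ⁻¹' {m}) := fun m =>
    hb.measurable_ord (measurableSet_singleton m)
  have hd : Pairwise (Function.onFun Disjoint fun m : ℤ => ord p b ⁻¹' {m}) := fun m n hmn =>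
    Disjoint.preimage _ (Set.disjoint_singleton.2 hmn)
  have hU : ⋃ m : ℤ, ord p b ⁻¹' {m} = Set.univ := by
    ext y; simp
  refine ⟨fun m => ∫ y in ord p b ⁻¹' {m}, f y ∂μ, ?_, fun τ => ?_⟩
  · have h1 := (hasSum_integral_iUnion hm hd (f := fun y => ‖f y‖) hf.norm.integrableOn).summable
    exact Summable.of_nonneg_of_le (fun _ => norm_nonneg _)
      (fun m => norm_integral_le_integral_norm _) h1
  · have hint : Integrable (fun y => f y * Complex.exp (τ * lg ℚ_[p] y * Complex.I)) μ := by
      refine hf.mul_bdd (c := 1) ?_ (Filter.Eventually.of_forall fun y => ?_)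
      · exact (Complex.measurable_exp.comp ((measurable_const.mul
          (Complex.measurable_ofReal.comp P.measurable_lg)).mul_const _)).aestronglyMeasurable
      · rw [← Complex.ofReal_mul, Complex.norm_exp_ofReal_mul_I]
    have h1 := hasSum_integral_iUnion hm hd hint.integrableOn
    rw [hU, setIntegral_univ] at h1
    rw [← h1.tsum_eq]
    refine tsum_congr fun m => ?_
    rw [← integral_mul_const]
    refine setIntegral_congr_ae (hm m) ?_
    filter_upwards [P.ae_ne_zero] with y hy hym
    rw [hb.lg_eq hy, show ord p b y = m from hym]

end IsGenerator

end PadicProfile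

/-! ### Admissible kernels and the profile axioms at a finite place -/

section PadicDomain

set_option linter.unusedSectionVars false

variable {p : ℕ} [Fact p.Prime] {K : Type*} [NormedField K] [NormedAlgebra ℚ_[p] K]
  [FiniteDimensional ℚ_[p] K]

/-- This profile is a multiple of χ⁻¹ on the units extended by 0. Characters are trivial near 1, so
it is locally constant. -/
theorem isBruhat_profile (χ : Kˣ →ₜ* Circle) (c : ℂ) :
    IsBruhat (profile ℚ_[p] χ fun s => if s = 0 then c else 0 : K → ℂ) := by
  classical
  have h1 : ∀ y : K, profile ℚ_[p] χ (fun s => if s = 0 then c else 0) y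
      = if ‖y‖ = 1 then extChar χ⁻¹ y * c else 0 := fun y => by
    rcases eq_or_ne y 0 with rfl | hy
    · simp [profile, extChar_zero]
    have h2 : lg ℚ_[p] y = 0 ↔ ‖y‖ = 1 := by
      rw [← absv_eq_one_iff p, ← exp_lg ℚ_[p] hy, Real.exp_eq_one_iff]
    rw [profile]
    simp only [h2]
    split_ifs with h
    · rw [wt, (absv_eq_one_iff p).2 h, Real.one_rpow, Complex.ofReal_one, mul_one]
    · rw [mul_zero]
  obtain ⟨r, hr0, hr1, hr⟩ := exists_char_eq_one_of_norm_sub_one_le p χ⁻¹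
  refine ⟨⟨r, hr0, fun y h hh => ?_⟩, ⟨1, fun y hy => by rw [h1, if_neg hy.ne']⟩⟩
  have hlt := hh.trans_lt hr1
  have key : ∀ y h : K, ‖h‖ < 1 → ‖y‖ = 1 → ‖y + h‖ = 1 := fun y h hh hy => by
    have := isUltrametricDist_of_padic p K
    rw [IsUltrametricDist.norm_add_eq_max_of_norm_ne_norm (by rw [hy]; exact hh.ne'), hy,
      max_eq_left hh.le]
  rw [h1, h1]
  by_cases hy : ‖y‖ = 1
  · rw [if_pos hy, if_pos (key y h hlt hy)]
    have hy0 : y ≠ 0 := norm_pos_iff.1 (hy ▸ one_pos)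
    have hn : ‖1 + h / y - 1‖ ≤ r := by rwa [add_sub_cancel_left, norm_div, hy, div_one]
    have hu0 : 1 + h / y ≠ 0 := by
      refine norm_pos_iff.1 ?_
      rw [norm_eq_one_of_norm_sub_one_lt p (hn.trans_lt hr1)]
      exact one_pos
    have h3 := hr (Units.mk0 _ hu0) hn
    have h4 : y + h = y * ((Units.mk0 _ hu0 : Kˣ) : K) := by
      rw [Units.val_mk0, mul_add, mul_one, mul_div_cancel₀ _ hy0]
    rw [h4, extChar_mul, extChar_coe, h3, Circle.coe_one, mul_one]
  · rw [if_neg hy, if_neg fun h5 => hy ?_]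
    have := key (y + h) (-h) (by rwa [norm_neg]) h5
    rwa [add_neg_cancel_right] at this

variable [MeasurableSpace K] [BorelSpace K] {μ : Measure K} [μ.IsAddHaarMeasure] [ProperSpace K]

/-- The transform is again of compact support, so any decay condition holds. -/
theorem isAdmissible_of_padic (χ : Kˣ →ₜ* Circle) (c : ℂ) :
    IsAdmissible ℚ_[p] μ (padicChar p) χ fun s => if s = 0 then c else 0 := by
  have hf := isBruhat_profile (p := p) χ c
  refine ⟨Measurable.ite (measurableSet_singleton 0) measurable_const measurable_const,
    hf.integrable μ, hf.memLp μ 2, ?_⟩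
  obtain ⟨b, hb⟩ := exists_isConductor p K
  have h1 := hb.isBruhat_charTransform (μ := μ) hf
  have h2 : Continuous fun x : K => absv ℚ_[p] x * ‖charTransform (padicChar p) μ
      (profile ℚ_[p] χ fun s => if s = 0 then c else 0) x‖ :=
    continuous_absv.mul h1.continuous.norm
  obtain ⟨C, hC⟩ := h2.bddAbove_range_of_hasCompactSupport h1.hasCompactSupport.norm.mul_left
  exact ⟨C, fun x => hC ⟨x, rfl⟩⟩

variable (μ) in
-- Rapid decrease is imposed only on multiples of log|b|, since other values of φ are never seen. It
-- corresponds to smoothness of Fourier series on the circle.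
theorem IsGenerator.isProfileClass {b : K} (hb : IsGenerator p b) :
    IsProfileClass ℚ_[p] μ (padicChar p) SchwartzOnCircle (IsRapidOn (lg ℚ_[p] b)) where
  sch_add _ _ hf hg := ContDiff.add hf hg
  sch_smul c _ hf := ContDiff.const_smul c hf
  sch_mul _ _ hf hg := ContDiff.mul hf hg
  measurable _ hφ := hφ.measurable
  integrable φ hφ := by
    refine (hb.integrable_comp_ord μ hφ.rapid.summable_norm).congr ?_
    filter_upwards [hb.ae_comp_lg φ] with y hy
    rw [hy]
  bounded φ hφ := by
    obtain ⟨C, hC⟩ := hφ.rapid 0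
    refine ⟨C, fun y hy => ?_⟩
    rw [hb.lg_eq hy]
    simpa using hC (ord p b y)
  id_mul φ hφ := by
    refine ⟨Complex.measurable_ofReal.mul hφ.measurable, ?_⟩
    have h := hφ.rapid.id_mul.const_mul (lg ℚ_[p] b)
    convert! h using 2 with m
    push_cast
    ring
  exp_mul t φ hφ := by
    refine ⟨(by fun_prop : Measurable fun s : ℝ => Complex.exp (t * s * Complex.I)).mul
      hφ.measurable, hφ.rapid.of_norm_le fun m => ?_⟩
    rw [norm_mul, ← Complex.ofReal_mul, Complex.norm_exp_ofReal_mul_I, one_mul]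
  conj φ hφ := by
    refine ⟨Complex.continuous_conj.measurable.comp hφ.measurable,
      hφ.rapid.of_norm_le fun m => ?_⟩
    rw [RCLike.norm_conj]
  gaussian := ⟨by fun_prop, isRapidSeq_gaussian hb.lg_pos⟩
  correlation κ φ hφ hκ h := by
    obtain ⟨C, hC⟩ := h
    have hκb : ∀ m : ℤ, ‖κ (m * lg ℚ_[p] b)‖
        ≤ C * Real.exp (-(lg ℚ_[p] b / 2 * |(m : ℝ)|)) := fun m => by
      have := hC (b ^ m) (zpow_ne_zero _ hb.ne_zero)
      rw [hb.lg_zpow, abs_mul, abs_of_pos hb.lg_pos] at this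
      convert! this using 3
      ring
    have hC0 : 0 ≤ C := by
      have := (norm_nonneg _).trans (hκb 0)
      simpa using this
    refine ⟨?_, ?_⟩
    · have P := hb.isPlace μ
      have hl : Measurable fun z : ℝ × K => lg ℚ_[p] z.2 := P.measurable_lg.comp measurable_snd
      have h1 : Measurable fun z : ℝ × K =>
          κ (z.1 + lg ℚ_[p] z.2) * φ (lg ℚ_[p] z.2) * ((absv ℚ_[p] z.2)⁻¹ : ℝ) :=
        ((hκ.comp (measurable_fst.add hl)).mul (hφ.measurable.comp hl)).mul
          (Complex.measurable_ofReal.comp (P.measurable_absv.comp measurable_snd).inv)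
      exact (h1.stronglyMeasurable.integral_prod_right' (ν := μ)).measurable
    · have h1 := (hφ.rapid.correlation (κ := fun m => κ (m * lg ℚ_[p] b))
        (half_pos hb.lg_pos) hκb).const_mul ((μ {y : K | absv ℚ_[p] y = 1}).toReal)
      convert! h1 using 2 with n
      refine hb.logCorr_eq μ hφ (C := C) (fun m => (hκb m).trans ?_) n
      refine mul_le_of_le_one_right hC0 (Real.exp_le_one_iff.2 (neg_nonpos.2 ?_))
      have := hb.lg_pos
      positivity
  sch_logMellin φ hφ := by
    rw [show logMellin ℚ_[p] μ φ = _ from funext (hb.logMellin_eq μ hφ)]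
    exact contDiff_const.mul (hφ.rapid.contDiff_fourierSum _)
  exists_logMellin_eq f χ hf h := by
    have P := hb.isPlace μ
    have h1 := P.integrable_mellin hf χ 0
    obtain ⟨a, ha, h2⟩ := hb.exists_integral_eq_fourierSum μ
      (f := fun y => f y * wt ℚ_[p] y * extChar χ y) (by simpa using h1)
    have h3 : mellin ℚ_[p] f χ = fourierSum (lg ℚ_[p] b) a := funext fun τ => by
      rw [mellin_eq_integral, ← h2]
      simp only [mul_assoc]
    have hv : ((μ {y : K | absv ℚ_[p] y = 1}).toReal : ℂ) ≠ 0 := by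
      exact_mod_cast (hb.measure_absv_eq_one_pos μ).ne'
    have ha' : IsRapidSeq a := isRapidSeq_of_contDiff_fourierSum hb.lg_pos ha (h3 ▸ h)
    -- Rounding turns the coefficient sequence into a measurable function on the line. The inverse
    -- volume of the units compensates the factor in the Mellin transform.
    have hφ : IsRapidOn (lg ℚ_[p] b) fun s =>
        ((μ {y : K | absv ℚ_[p] y = 1}).toReal : ℂ)⁻¹ * a (round (s / lg ℚ_[p] b)) := by
      refine ⟨?_, ?_⟩
      · have h4 : Measurable fun s : ℝ => round (s / lg ℚ_[p] b) := by
          rw [show (fun s : ℝ => round (s / lg ℚ_[p] b)) = fun s => ⌊s / lg ℚ_[p] b + 1 / 2⌋ from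
            funext fun s => round_eq _]
          exact Int.measurable_floor.comp (by fun_prop)
        exact ((measurable_from_top (f := a)).comp h4).const_mul _
      · simp only [hb.round_mul_div]
        exact ha'.const_mul _
    refine ⟨_, hφ, fun τ => ?_⟩
    rw [hb.logMellin_eq μ hφ, h3, fourierSum, fourierSum, ← tsum_mul_left]
    refine tsum_congr fun m => ?_
    rw [hb.round_mul_div, ← mul_assoc, mul_inv_cancel_left₀ hv]
  exists_decomposition φ χ hφ := by
    have hv : ((μ {y : K | absv ℚ_[p] y = 1}).toReal : ℂ) ≠ 0 := by
      exact_mod_cast (hb.measure_absv_eq_one_pos μ).ne'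
    -- The kernel supported at 0 with this value is the unit for convolution, so φ reproduces itself
    -- and the second term is taken to be zero.
    set c := ((μ {y : K | absv ℚ_[p] y = 1}).toReal : ℂ)⁻¹ with hc
    have h0 : IsRapidOn (lg ℚ_[p] b) fun _ => 0 := ⟨measurable_const, fun n => ⟨0, by simp⟩⟩
    refine ⟨_, φ, _, fun _ => 0, ⟨isAdmissible_of_padic χ c, hφ⟩, ⟨isAdmissible_of_padic χ c, h0⟩,
      fun y hy => ?_⟩
    have h1 : ∀ m : ℤ, (if ((ord p b y - m : ℤ) : ℝ) * lg ℚ_[p] b = 0 then c else 0) *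
        φ (m * lg ℚ_[p] b) = if m = ord p b y then c * φ (ord p b y * lg ℚ_[p] b) else 0 := by
      intro m
      have h4 : ((ord p b y - m : ℤ) : ℝ) * lg ℚ_[p] b = 0 ↔ m = ord p b y := by
        rw [mul_eq_zero, or_iff_left hb.lg_pos.ne', Int.cast_eq_zero, sub_eq_zero, eq_comm]
      by_cases hm : m = ord p b y
      · rw [if_pos (h4.2 hm), if_pos hm, hm]
      · rw [if_neg (mt h4.1 hm), if_neg hm, zero_mul]
    have h2 := hb.integral_comp_ord μ (a := fun m : ℤ =>
      (if ((ord p b y - m : ℤ) : ℝ) * lg ℚ_[p] b = 0 then c else 0) * φ (m * lg ℚ_[p] b)) (by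
        simp only [h1]
        exact (hasSum_ite_eq (ord p b y) _).summable.norm)
    simp only [h1] at h2
    rw [tsum_ite_eq, hc, mul_inv_cancel_left₀ hv] at h2
    have h3 : logConv ℚ_[p] μ (fun s => if s = 0 then c else 0) (fun _ => 0) (lg ℚ_[p] y) = 0 := by
      rw [logConv]
      simp
    rw [h3, add_zero, hb.lg_eq hy, ← h2, logConv]
    refine integral_congr_ae ?_
    filter_upwards [(hb.isPlace μ).ae_ne_zero] with u hu
    rw [← h1, hb.lg_eq hu, Int.cast_sub, sub_mul]

end PadicDomain

theorem hasStableDomain_padic {p : ℕ} [Fact p.Prime] {K : Type*} [NormedField K]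
    [NormedAlgebra ℚ_[p] K] [FiniteDimensional ℚ_[p] K] [MeasurableSpace K] [BorelSpace K]
    {μ : Measure K} [μ.IsAddHaarMeasure] (hself : IsSelfDualNormalized (padicChar p) μ) :
    HasStableDomain (padicChar p) SchwartzOnCircle μ := by
  have : ProperSpace K := FiniteDimensional.proper ℚ_[p] K
  obtain ⟨b, hb⟩ := exists_generator p (K := K)
  obtain ⟨d, hd⟩ := exists_isConductor p K
  have hb : IsGenerator p b := hb
  have P := hb.isPlace μ
  exact (hb.isProfileClass μ).hasStableDomain P (NeZero.ne μ)
    (isFourierTransform_padicFourier P hd hself)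

end

end LocalCommutator

theorem mainTheorem7 :
    LocalCommutator.HasStableDomain (K := ℝ) LocalCommutator.realChar
      LocalCommutator.SchwartzOnLine MeasureTheory.volume ∧
    LocalCommutator.HasStableDomain (K := ℂ) LocalCommutator.realChar
      LocalCommutator.SchwartzOnLine ((2 : ENNReal) • MeasureTheory.volume) ∧
    ∀ (p : ℕ) [Fact p.Prime] (K : Type*) [NormedField K] [NormedAlgebra ℚ_[p] K]
      [FiniteDimensional ℚ_[p] K] [MeasurableSpace K] [BorelSpace K]
      (μ : MeasureTheory.Measure K) [μ.IsAddHaarMeasure],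
      LocalCommutator.IsSelfDualNormalized (LocalCommutator.padicChar p) μ →
      LocalCommutator.HasStableDomain (LocalCommutator.padicChar p)
        LocalCommutator.SchwartzOnCircle μ :=
  ⟨LocalCommutator.hasStableDomain_real, LocalCommutator.hasStableDomain_complex,
    fun _ _ _ _ _ _ _ _ _ _ h => LocalCommutator.hasStableDomain_padic h⟩
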